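/- **Conventions.** $\mathbb N=\{1,2,\dots\}$. *Machines.* An algorithm is a program of a random access machine with registers and indirectly addressed memory holding natural numbers (operations: constants, addition, truncated subtraction, load, store, branching and looping on a register being nonzero, fair coin flip); the time of a run is the sum of the logarithmic costs of its operations. Approximation algorithms output a rational number. For a set $\mathcal K$ of inputs, $T_{\mathcal A}(\mathcal K)\in\mathbb N\cup\{\infty\}$ is the supremum of the running times of $\mathcal A$ over all inputs in $\mathcal K$ and all outcomes of the coin flips. A probabilistic algorithm $\mathcal A$ satisfies $|\mathcal A(\Phi)-\mathcal T(\Phi)|<\varepsilon$ if this holds with probability at least $2/3$. *Satisfiability.* For $k,n,C\in\mathbb N$ let $\mathcal S_k(n)$ be the set of formulas in conjunctive normal form (nonempty finite sets of nonempty clauses, a clause being a set of literals) in variables $x_1,\dots,x_n$ with at most $k$ literals per clause, and let $\widetilde{\mathcal S}_k(n)\subseteq\mathcal S_k(n)$ be the set of those with at most $Cn$ clauses. A decision algorithm for $k$SAT halts on all formulas in $\bigcup_n\mathcal S_k(n)$ (given as lists of clauses, which are lists of literals), decides satisfiability correctly with probability at least $2/3$, and accepts an input that is not such a formula with probability at most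 $1/3$. Let $$\widetilde s_k:=\inf\{s>0 : \text{there is a decision algorithm } \mathcal B \text{ for } k\text{SAT with } T_{\mathcal B}(\widetilde{\mathcal S}_k(n))=\mathcal O(2^{sn}) \text{ as } n\to\infty\}.$$ *Networks.* $\mathcal N(d,w,L,\theta)$ is the set of feed-forward networks with $d$ inputs, one output, at most $L$ layers (weight matrices), all layer widths (including input and output) between $1$ and $w$, and all weights and biases in $\theta\subseteq\mathbb R$. $\mathcal R_\Phi$ denotes the realization of $\Phi$ with activation $\sigma(x)=\max\{0,x\}$ in all layers but the last. A network with parameters in a fixed finite set $\theta$ is given to a machine by its depth, its widths, and the list of its parameters, each represented by its position in $\theta$. **Theorem (high-precision setting).** Let $d,k,C,w_r,L_r\in\mathbb N$, $0<\delta<1/2$, let $\theta_r\subset\mathbb R$ be finite, let $\Psi\in\mathcal N(1,w_r,L_r,\theta_r)$, and let $r:\mathbb R\to[0,1]$ be continuous with $r(x)=0$ for $x\le 1/2$, $r(x)=1$ for $x\ge 1-\delta$, and $\mathcal R_\Psi=r$. Let $\theta\subset\mathbb R$ be a finite set that contains $\theta_{\rm CV}=\{-1,0,1,-\delta^{-1},\delta^{-1},\delta,-(1-\delta)\}$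 and $\theta_{\rm CNF}$, the set of the numbers $-1,0,1$ and of all numbers $a$, $-a$, $a+b$, $ab$, $m\,ab+c$ and $a(b-1)$ with $a,b,c\in\theta_r$ and $m\in\{0,\dots,k\}$. For $n\ge d$ define $$\mathcal K(n):=\{\Phi\in\mathcal N(d,\max(2,Cw_rk)\,n,\;3L_r+(n-d)-1,\;\theta) : 0\le\mathcal R_\Phi(x)\le 1 \text{ for all } x\in\mathbb R^d\},$$ and $\mathcal K(n):=\mathcal K(d)$ for $0\le n<d$. Let $\mathcal A$ be a (probabilistic) approximation algorithm such that for all $n\in\mathbb N$ and all $\Phi\in\mathcal K(n)\setminus\mathcal K(n-1)$ $$\Big|\mathcal A(\Phi)-\int_{[0,1]^d}\mathcal R_\Phi(x)\,dx\Big|<\frac{\delta^n}{2}.$$ If $T_{\mathcal A}(\mathcal K(n))=\mathcal O(2^{tn})$ as $n\to\infty$ for some $t>0$, then $t\ge\widetilde s_k$. -/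

import Mathlib

open MeasureTheory
open scoped ENNReal Matrix

namespace QuadHard

/-! ## Model of computation: probabilistic random access machines, logarithmic cost

A machine has scalar registers `reg 0, reg 1, …` and memory banks `mem 0, mem 1, …`, all holding
natural numbers, and an infinite sequence of random bits. A program is a finite text and mentions
only finitely many registers and banks; the cells of a bank are addressed indirectly. -/

structure State where
  reg : ℕ → ℕ
  mem : ℕ → ℕ → ℕ
  coins : ℕ → Bool

/-- Write `v` into register `r`. -/
def State.setReg (s : State) (r v : ℕ) : State :=
  { s with reg := Function.update s.reg r v }

/-- Write `v` into cell `i` of bank `a`. -/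
def State.setMem (s : State) (a i v : ℕ) : State :=
  { s with mem := Function.update s.mem a (Function.update (s.mem a) i v) }

/-- Programs of the machine. -/
inductive Prog where
  | skip : Prog
  /-- `reg r := c` for a constant `c` -/
  | const (r c : ℕ) : Prog
  /-- `reg r := reg a + reg b` -/
  | add (r a b : ℕ) : Prog
  /-- `reg r := max (reg a - reg b) 0` -/
  | sub (r a b : ℕ) : Prog
  /-- `reg r := mem a [reg i]` -/
  | load (r a i : ℕ) : Prog
  /-- `mem a [reg i] := reg b` -/
  | store (a i b : ℕ) : Prog
  /-- `reg r := ` a fresh random bit -/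
  | flip (r : ℕ) : Prog
  /-- first `p`, then `q` -/
  | seq (p q : Prog) : Prog
  /-- if `reg r ≠ 0` then `p` else `q` -/
  | ite (r : ℕ) (p q : Prog) : Prog
  /-- while `reg r ≠ 0` do `p` -/
  | loop (r : ℕ) (p : Prog) : Prog

/-- The logarithmic cost of handling the number `x`: one plus its binary length. -/
def logCost (x : ℕ) : ℕ := Nat.size x + 1

/-- `Exec p s T s'`: started in state `s`, the program `p` halts in state `s'`, and the total cost of
the operations carried out is `T`. -/
inductive Exec : Prog → State → ℕ → State → Prop where
  | skip (s : State) : Exec .skip s 1 s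
  | const (s : State) (r c : ℕ) : Exec (.const r c) s (logCost c) (s.setReg r c)
  | add (s : State) (r a b : ℕ) :
      Exec (.add r a b) s (logCost (s.reg a) + logCost (s.reg b))
        (s.setReg r (s.reg a + s.reg b))
  | sub (s : State) (r a b : ℕ) :
      Exec (.sub r a b) s (logCost (s.reg a) + logCost (s.reg b))
        (s.setReg r (s.reg a - s.reg b))
  | load (s : State) (r a i : ℕ) :
      Exec (.load r a i) s (logCost (s.reg i) + logCost (s.mem a (s.reg i)))
        (s.setReg r (s.mem a (s.reg i)))
  | store (s : State) (a i b : ℕ) :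
      Exec (.store a i b) s (logCost (s.reg i) + logCost (s.reg b))
        (s.setMem a (s.reg i) (s.reg b))
  | flip (s : State) (r : ℕ) :
      Exec (.flip r) s 1
        { s.setReg r (s.coins 0).toNat with coins := fun i => s.coins (i + 1) }
  | seq {p q : Prog} {s s₁ s₂ : State} {T₁ T₂ : ℕ} (hp : Exec p s T₁ s₁) (hq : Exec q s₁ T₂ s₂) :
      Exec (.seq p q) s (T₁ + T₂) s₂
  | iteTrue {r : ℕ} {p q : Prog} {s s₁ : State} {T : ℕ} (h : s.reg r ≠ 0) (hp : Exec p s T s₁) :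
      Exec (.ite r p q) s (logCost (s.reg r) + T) s₁
  | iteFalse {r : ℕ} {p q : Prog} {s s₁ : State} {T : ℕ} (h : s.reg r = 0) (hq : Exec q s T s₁) :
      Exec (.ite r p q) s (logCost (s.reg r) + T) s₁
  | loopDone {r : ℕ} {p : Prog} {s : State} (h : s.reg r = 0) :
      Exec (.loop r p) s (logCost (s.reg r)) s
  | loopStep {r : ℕ} {p : Prog} {s s₁ s₂ : State} {T₁ T₂ : ℕ} (h : s.reg r ≠ 0)
      (hp : Exec p s T₁ s₁) (hq : Exec (.loop r p) s₁ T₂ s₂) :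
      Exec (.loop r p) s (logCost (s.reg r) + T₁ + T₂) s₂

/-- For a given sequence of random bits (part of the state), the run is deterministic: the final
state and the cost are unique. -/
theorem Exec.det {p : Prog} {s s₁ s₂ : State} {T₁ T₂ : ℕ}
    (h₁ : Exec p s T₁ s₁) (h₂ : Exec p s T₂ s₂) : T₁ = T₂ ∧ s₁ = s₂ := by
  induction h₁ generalizing T₂ s₂ with
  | skip | const | add | sub | load | store | flip => cases h₂; exact ⟨rfl, rfl⟩
  | seq _ _ ih₁ ih₂ =>
    cases h₂ with
    | seq hp hq =>
      obtain ⟨rfl, rfl⟩ := ih₁ hp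
      obtain ⟨rfl, rfl⟩ := ih₂ hq
      exact ⟨rfl, rfl⟩
  | iteTrue h _ ih =>
    cases h₂ with
    | iteTrue _ hp => obtain ⟨rfl, rfl⟩ := ih hp; exact ⟨rfl, rfl⟩
    | iteFalse h' _ => exact absurd h' h
  | iteFalse h _ ih =>
    cases h₂ with
    | iteTrue h' _ => exact absurd h h'
    | iteFalse _ hq => obtain ⟨rfl, rfl⟩ := ih hq; exact ⟨rfl, rfl⟩
  | loopDone h =>
    cases h₂ with
    | loopDone _ => exact ⟨rfl, rfl⟩
    | loopStep h' _ _ => exact absurd h h'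
  | loopStep h _ _ ih₁ ih₂ =>
    cases h₂ with
    | loopDone h' => exact absurd h' h
    | loopStep _ hp hq =>
      obtain ⟨rfl, rfl⟩ := ih₁ hp
      obtain ⟨rfl, rfl⟩ := ih₂ hq
      exact ⟨rfl, rfl⟩

/-- Initial state on input `x`: bank `0` holds the entries of `x`, register `0` its length, everything
else is zero; `ω` is the sequence of random bits. -/
def initState (x : List ℕ) (ω : ℕ → Bool) : State where
  reg r := if r = 0 then x.length else 0
  mem a i := if a = 0 then x.getD i 0 else 0
  coins := ω

/-- Fair coin tossing: the infinite product of the uniform distribution on `{0,1}`. -/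
noncomputable def coinMeasure : Measure (ℕ → Bool) :=
  Measure.infinitePi fun _ => (PMF.uniformOfFintype Bool).toMeasure

def Prog.Halts (p : Prog) (x : List ℕ) (ω : ℕ → Bool) : Prop :=
  ∃ T s, Exec p (initState x ω) T s

/-- The running time on input `x` with random bits `ω`; it is `⊤` if the program does not halt. -/
noncomputable def Prog.time (p : Prog) (x : List ℕ) (ω : ℕ → Bool) : ℕ∞ :=
  ⨅ (T : ℕ) (_ : ∃ s, Exec p (initState x ω) T s), (T : ℕ∞)

/-- The worst case running time over a set of inputs (and over all random bits). -/
noncomputable def Prog.worstTime (p : Prog) (I : Set (List ℕ)) : ℕ∞ :=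
  ⨆ x ∈ I, ⨆ ω, p.time x ω

/-- Natural-number output: the content of register `0` upon halting. -/
def Prog.OutputsNat (p : Prog) (x : List ℕ) (ω : ℕ → Bool) (v : ℕ) : Prop :=
  ∃ T s, Exec p (initState x ω) T s ∧ s.reg 0 = v

/-- Numerical output of an approximation algorithm: the rational number with numerator
`reg 0 - reg 1` and denominator `reg 2 + 1` upon halting. -/
def Prog.OutputsReal (p : Prog) (x : List ℕ) (ω : ℕ → Bool) (v : ℝ) : Prop :=
  ∃ T s, Exec p (initState x ω) T s ∧
    v = ((s.reg 0 : ℝ) - (s.reg 1 : ℝ)) / ((s.reg 2 : ℝ) + 1)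

/-- `T(n) = O(2^(t n))` as `n → ∞`. -/
def IsBigOExp (T : ℕ → ℕ∞) (t : ℝ) : Prop :=
  ∃ c : ℝ, ∃ n₀ : ℕ, ∀ n ≥ n₀, ((T n : ℕ∞) : ℝ≥0∞) ≤ ENNReal.ofReal (c * (2 : ℝ) ^ (t * n))

/-! ## Formulas in conjunctive normal form -/

/-- `(i, true)` is the variable `x_i`, `(i, false)` its negation. -/
abbrev Literal := ℕ × Bool

abbrev Clause := Finset Literal

abbrev CNF := Finset Clause

def CNF.Satisfiable (α : CNF) : Prop :=
  ∃ z : ℕ → Bool, ∀ c ∈ α, ∃ l ∈ c, z l.1 = l.2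

/-- Formulas in the variables `x_1, …, x_n` with at most `k` literals per clause; clauses and
formulas are nonempty. -/
def kCNF (k n : ℕ) : Set CNF :=
  {α | α.Nonempty ∧ ∀ c ∈ α, c.Nonempty ∧ c.card ≤ k ∧ ∀ l ∈ c, 1 ≤ l.1 ∧ l.1 ≤ n}

/-- Formulas in `kCNF k n` with at most `C * n` clauses. -/
def sparseCNF (C k n : ℕ) : Set CNF :=
  {α | α ∈ kCNF k n ∧ α.card ≤ C * n}

/-- `x_i` is coded by `2 i`, its negation by `2 i + 1`. -/
def Literal.code (l : Literal) : ℕ := 2 * l.1 + (if l.2 then 0 else 1)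

/-- The machine input `x` presents the formula `α`: it lists the clauses of `α` in some order, without
repetition, each clause as the list of the codes of its literals in some order, without repetition,
followed by the end mark `0`. -/
def Presents (x : List ℕ) (α : CNF) : Prop :=
  ∃ cs : List (List Literal),
    (∀ c ∈ cs, c.Nodup) ∧ (cs.map List.toFinset).Nodup ∧ (cs.map List.toFinset).toFinset = α ∧
    x = cs.flatMap fun c => c.map Literal.code ++ [0]

/-- `B` is a probabilistic decision algorithm for `k`SAT: it produces an output on every formula, the
output is correct with probability at least `2/3`, and an input that presents no formula with at most
`k` literals per clause is accepted with probability at most `1/3`. -/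
def DecidesKSAT (k : ℕ) (B : Prog) : Prop :=
  (∀ n, ∀ α ∈ kCNF k n, ∀ x, Presents x α → ∀ ω, B.Halts x ω) ∧
  (∀ n, ∀ α ∈ kCNF k n, ∀ x, Presents x α →
    (α.Satisfiable → 2 / 3 ≤ coinMeasure {ω | B.OutputsNat x ω 1}) ∧
    (¬ α.Satisfiable → 2 / 3 ≤ coinMeasure {ω | B.OutputsNat x ω 0})) ∧
  (∀ x, (∀ n, ∀ α ∈ kCNF k n, ¬ Presents x α) → coinMeasure {ω | B.OutputsNat x ω 1} ≤ 1 / 3)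

/-- The infimum of all `s > 0` such that some decision algorithm for `k`SAT has worst case running time
`O(2^(s n))` on the formulas in `n` variables with at most `C n` clauses. -/
noncomputable def sTilde (C k : ℕ) : ℝ :=
  sInf {s : ℝ | 0 < s ∧ ∃ B : Prog, DecidesKSAT k B ∧
    IsBigOExp (fun n => B.worstTime {x | ∃ α ∈ sparseCNF C k n, Presents x α}) s}

/-! ## ReLU networks -/

/-- Feed-forward networks with `d` inputs and `m` outputs: a list of layers, each given by a weight
matrix and a bias vector. -/
inductive Network : ℕ → ℕ → Type where
  | last {d m : ℕ} (W : Matrix (Fin m) (Fin d) ℝ) (b : Fin m → ℝ) : Network d m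
  | cons {d w m : ℕ} (W : Matrix (Fin w) (Fin d) ℝ) (b : Fin w → ℝ) (Φ : Network w m) : Network d m

namespace Network

/-- The realization with activation function `σ(x) = max{0, x}` in all layers but the last. -/
noncomputable def realize : {d m : ℕ} → Network d m → (Fin d → ℝ) → (Fin m → ℝ)
  | _, _, last W b, x => W *ᵥ x + b
  | _, _, cons W b Φ, x => Φ.realize fun i => max 0 ((W *ᵥ x + b) i)

/-- The number of layers (weight matrices). -/
def depth : {d m : ℕ} → Network d m → ℕ
  | _, _, last _ _ => 1
  | _, _, cons _ _ Φ => Φ.depth + 1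

/-- The list `w_0, w_1, …, w_L` of the layer widths, beginning with the input dimension. -/
def widths : {d m : ℕ} → Network d m → List ℕ
  | d, m, last _ _ => [d, m]
  | d, _, cons _ _ Φ => d :: Φ.widths

/-- The list of all weights and biases: layer by layer, first the matrix row by row, then the bias. -/
def params : {d m : ℕ} → Network d m → List ℝ
  | d, m, last W b =>
      ((List.finRange m).flatMap fun i => (List.finRange d).map fun j => W i j) ++
        (List.finRange m).map b
  | d, _, cons (w := w) W b Φ =>
      ((List.finRange w).flatMap fun i => (List.finRange d).map fun j => W i j) ++
        (List.finRange w).map b ++ Φ.params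

/-- Networks with `d` inputs, one output, widths in `[1, w]`, depth at most `L`, parameters in `θ`. -/
def netClass (d w L : ℕ) (θ : Finset ℝ) : Set (Network d 1) :=
  {Φ | Φ.depth ≤ L ∧ (∀ v ∈ Φ.widths, 1 ≤ v ∧ v ≤ w) ∧ ∀ a ∈ Φ.params, a ∈ θ}

/-- The machine input for a network with parameters in the finite set `θ`: the depth, the widths, and
the parameters, where `a ∈ θ` is represented by its position in the increasing enumeration of `θ`. -/
noncomputable def encode (θ : Finset ℝ) {d m : ℕ} (Φ : Network d m) : List ℕ :=
  Φ.depth :: (Φ.widths ++ Φ.params.map fun a => (θ.filter (· < a)).card)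

end Network

section Weights

open scoped Pointwise

/-- The weights and biases that arise when a formula with at most `k` literals per clause is turned
into a network by composing and adding copies of a network with parameters in `θr`, coordinate
projections, and the map `x ↦ 1 - x`: layers are merged by composing an output layer
`y ↦ v · y + b'` with a first layer `x ↦ w x + b`, possibly after summing at most `k` outputs or after
subtracting `1` from the output. -/
noncomputable def cnfWeights (θr : Finset ℝ) (k : ℕ) : Finset ℝ :=
  {-1, 0, 1} ∪ θr ∪ -θr ∪ (θr + θr) ∪ θr * θr ∪
    ((Finset.range (k + 1)).biUnion fun m => (θr * θr).image (fun a => (m : ℝ) * a) + θr) ∪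
    θr * (θr.image fun a => a - 1)

/-- The weights and biases of the networks that realize the curve `t ↦ (s(⋯s(t)), …, s(t), t)` with
`s(t) = 1 - δ⁻¹ σ(δ - t) - δ⁻¹ σ(t - (1 - δ))`. -/
noncomputable def curveWeights (δ : ℝ) : Finset ℝ :=
  {-1, 0, 1, -δ⁻¹, δ⁻¹, δ, -(1 - δ)}

end Weights

/-- The class `K(n)` for `n ≥ d`, and `K(d)` for `n < d`. -/
def inputClass (d k C wr Lr : ℕ) (θ : Finset ℝ) (n : ℕ) : Set (Network d 1) :=
  {Φ | Φ ∈ Network.netClass d (max 2 (C * wr * k) * max n d) (3 * Lr + (max n d - d) - 1) θ ∧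
    ∀ x : Fin d → ℝ, 0 ≤ Φ.realize x 0 ∧ Φ.realize x 0 ≤ 1}

end QuadHard

/-! The infimum is at most t once `A` is turned, for every s > t, into a decision algorithm for kSAT
with running time O(2^(s n)) on sparse formulas. A formula becomes a network whose integral over the
cube is 0 if the formula is unsatisfiable and at least a known power of δ otherwise; `A` is accurate
enough to tell the two cases apart.

The network looks only at the first coordinate x and iterates the trapezoid function s. Since s maps
each of [0, δ] and [1 - δ, 1] affinely onto [0, 1], every pattern of N values near 0 or near 1 is
taken by x, s(x), s(s(x)), … on an interval of length δ^N (`exists_interval`). One iterate y serves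
as one variable, and σ(2y - 1), σ(1 - 2y) are its two literals. A literal that is false after
rounding y at 1/2 is exactly 0; a true one is at least 1 - 2δ if y is near 0 or 1. Every further
layer multiplies the literals by δ⁻¹, so that e₀ extra layers lift the true ones to at least 1. A
clause is computed as σ(1 - sum of its literals), which is 0 if one literal is at least 1, and the
conjunction as σ(1 - sum of the clause values). Hence an unsatisfiable formula gives the zero
function (`SatNet.profile_eq_zero`), and a satisfiable one gives a function that equals 1 on a slab
of thickness δ^(N+1) (`SatNet.profile_eq_one`, `SatNet.le_integral_satNet`). Only parameters from
`curveWeights δ` occur.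

Let M be so large that t(M + 3) < sM, and let g be the least scale for which N = M g variables and C
M g clauses accommodate the formula. Padding the layers places the network in K((M + 3)g) but not in
K((M + 3)g - 1). The error of `A` is then below δ^((M+3)g)/2, and some 2^(-e g) separates the two
cases; a power of two is used because δ need not be computable. On sparse formulas g is at most n/M
plus a constant, so `A` needs O(2^(un)) steps with u = t(M + 3)/M < s, and a polynomial factor is
absorbed by 2^((s-u)n).

That the remaining work is polynomial is proved on the machine itself. Checking, scaling and
printing are written as arithmetic terms with bounded sums, which compile to programs of polynomial
cost (`Tm.compile_runsTo`, `Printer.compile_runsTo`). `A` runs as a subroutine on low registers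
(`Exec.local_run`), and its results have few enough digits (`Exec.sizeLE`) for the final comparison
to cost at most a polynomial times the running time of `A`. -/

namespace QuadHard

/-! ## Polynomial bounds -/

/-- The function agrees with a polynomial with natural coefficients. -/
def IsPoly (f : ℕ → ℕ) : Prop := ∃ p : Polynomial ℕ, ∀ B, p.eval B = f B

namespace IsPoly

theorem const (c : ℕ) : IsPoly fun _ => c := ⟨Polynomial.C c, fun _ => by simp⟩

theorem id : IsPoly fun B => B := ⟨Polynomial.X, fun _ => by simp⟩

theorem add {f g : ℕ → ℕ} (hf : IsPoly f) (hg : IsPoly g) : IsPoly fun B => f B + g B := by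
  obtain ⟨p, hp⟩ := hf
  obtain ⟨q, hq⟩ := hg
  exact ⟨p + q, fun B => by simp [hp, hq]⟩

theorem mul {f g : ℕ → ℕ} (hf : IsPoly f) (hg : IsPoly g) : IsPoly fun B => f B * g B := by
  obtain ⟨p, hp⟩ := hf
  obtain ⟨q, hq⟩ := hg
  exact ⟨p * q, fun B => by simp [hp, hq]⟩

theorem comp {f g : ℕ → ℕ} (hf : IsPoly f) (hg : IsPoly g) : IsPoly fun B => f (g B) := by
  obtain ⟨p, hp⟩ := hf
  obtain ⟨q, hq⟩ := hg
  exact ⟨p.comp q, fun B => by simp [hp, hq]⟩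

end IsPoly

/-! ## Runs of bounded cost -/

/-- This exponential loss is harmless outside `A` and the final comparison: all other numbers are
polynomial in n, and only polynomial cost is claimed. -/
theorem logCost_le (x : ℕ) : logCost x ≤ x + 1 := by
  unfold logCost
  have : x.size ≤ x := Nat.size_le.2 Nat.lt_two_pow_self
  omega

@[simp] theorem State.setReg_reg (s : State) (r v i : ℕ) :
    (s.setReg r v).reg i = if i = r then v else s.reg i := by
  simp [State.setReg, Function.update_apply]

@[simp] theorem State.setReg_mem (s : State) (r v : ℕ) : (s.setReg r v).mem = s.mem := rfl

@[simp] theorem State.setReg_coins (s : State) (r v : ℕ) : (s.setReg r v).coins = s.coins := rfl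

@[simp] theorem State.setMem_reg (s : State) (a i v : ℕ) : (s.setMem a i v).reg = s.reg := rfl

@[simp] theorem State.setMem_coins (s : State) (a i v : ℕ) :
    (s.setMem a i v).coins = s.coins := rfl

@[simp] theorem State.setMem_mem (s : State) (a i v b j : ℕ) :
    (s.setMem a i v).mem b j = if b = a ∧ j = i then v else s.mem b j := by
  simp only [State.setMem, Function.update_apply]
  by_cases hb : b = a
  · subst hb; simp [Function.update_apply]
  · simp [hb]

/-- Started in `s`, the program `p` halts at cost at most `c` in a state with property `Q`. -/
def RunsTo (p : Prog) (s : State) (c : ℕ) (Q : State → Prop) : Prop :=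
  ∃ T s', Exec p s T s' ∧ T ≤ c ∧ Q s'

namespace RunsTo

variable {p q : Prog} {s : State} {c c₁ c₂ : ℕ} {Q Q' : State → Prop}

theorem mono (h : RunsTo p s c₁ Q) (hc : c₁ ≤ c₂) (hQ : ∀ s', Q s' → Q' s') :
    RunsTo p s c₂ Q' := by
  obtain ⟨T, s', he, hT, hs⟩ := h
  exact ⟨T, s', he, hT.trans hc, hQ _ hs⟩

theorem seq (h : RunsTo p s c₁ fun s₁ => RunsTo q s₁ c₂ Q) :
    RunsTo (.seq p q) s (c₁ + c₂) Q := by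
  obtain ⟨T, s', he, hT, T', s'', he', hT', hs⟩ := h
  exact ⟨_, s'', .seq he he', add_le_add hT hT', hs⟩

theorem seq_le (h : RunsTo p s c₁ fun s₁ => RunsTo q s₁ c₂ Q) (hc : c₁ + c₂ ≤ c) :
    RunsTo (.seq p q) s c Q := h.seq.mono hc fun _ => _root_.id

theorem const {r v : ℕ} (h : Q (s.setReg r v)) : RunsTo (.const r v) s (v + 1) Q :=
  ⟨_, _, .const s r v, logCost_le v, h⟩

theorem add {r a b : ℕ} (hc : s.reg a + s.reg b + 2 ≤ c)
    (h : Q (s.setReg r (s.reg a + s.reg b))) : RunsTo (.add r a b) s c Q :=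
  ⟨_, _, .add s r a b, by
    have := logCost_le (s.reg a); have := logCost_le (s.reg b); omega, h⟩

theorem sub {r a b : ℕ} (hc : s.reg a + s.reg b + 2 ≤ c)
    (h : Q (s.setReg r (s.reg a - s.reg b))) : RunsTo (.sub r a b) s c Q :=
  ⟨_, _, .sub s r a b, by
    have := logCost_le (s.reg a); have := logCost_le (s.reg b); omega, h⟩

theorem load {r a i : ℕ} (hc : s.reg i + s.mem a (s.reg i) + 2 ≤ c)
    (h : Q (s.setReg r (s.mem a (s.reg i)))) : RunsTo (.load r a i) s c Q :=
  ⟨_, _, .load s r a i, by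
    have := logCost_le (s.reg i); have := logCost_le (s.mem a (s.reg i)); omega, h⟩

theorem store {a i b : ℕ} (hc : s.reg i + s.reg b + 2 ≤ c)
    (h : Q (s.setMem a (s.reg i) (s.reg b))) : RunsTo (.store a i b) s c Q :=
  ⟨_, _, .store s a i b, by
    have := logCost_le (s.reg i); have := logCost_le (s.reg b); omega, h⟩

theorem ite_of_ne {r : ℕ} (hr : s.reg r ≠ 0) (h : RunsTo p s c Q) :
    RunsTo (.ite r p q) s (s.reg r + 1 + c) Q := by
  obtain ⟨T, s', he, hT, hs⟩ := h
  exact ⟨_, s', .iteTrue hr he, add_le_add (logCost_le _) hT, hs⟩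

theorem ite_of_eq {r : ℕ} (hr : s.reg r = 0) (h : RunsTo q s c Q) :
    RunsTo (.ite r p q) s (s.reg r + 1 + c) Q := by
  obtain ⟨T, s', he, hT, hs⟩ := h
  exact ⟨_, s', .iteFalse hr he, add_le_add (logCost_le _) hT, hs⟩

/-- A loop that counts register `r` down to zero; `I j` is the invariant with `j` rounds to go. -/
theorem loop {r n : ℕ} (I : ℕ → State → Prop) (hr : ∀ j s, I j s → s.reg r = j)
    (hstep : ∀ j s, j < n → I (j + 1) s → RunsTo p s c (I j)) :
    ∀ j s, j ≤ n → I j s → RunsTo (.loop r p) s ((j + 1) * (n + 1) + j * c) (I 0) := by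
  intro j
  induction j with
  | zero =>
    intro s _ hI
    have h0 := hr _ _ hI
    exact ⟨_, s, .loopDone h0, by rw [h0]; have := logCost_le 0; omega, hI⟩
  | succ j ih =>
    intro s hj hI
    have h0 := hr _ _ hI
    obtain ⟨T, s', he, hT, hs⟩ := hstep j s (by omega) hI
    obtain ⟨T', s'', he', hT', hs'⟩ := ih s' (by omega) hs
    refine ⟨_, s'', .loopStep (by omega) he he', ?_, hs'⟩
    rw [h0]
    have := logCost_le (j + 1)
    nlinarith

end RunsTo

/-! ## Arithmetic terms with bounded sums and their compilation -/

/-- Terms over an array: variables, constants, array access, arithmetic, conditionals and bounded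
sums `∑ v < b, t`. -/
inductive Tm where
  | var (v : ℕ) : Tm
  | const (c : ℕ) : Tm
  | get (t : Tm) : Tm
  | add (a b : Tm) : Tm
  | sub (a b : Tm) : Tm
  | ite (c a b : Tm) : Tm
  | sum (v : ℕ) (b t : Tm) : Tm

namespace Tm

/-- The value of a term for the array `X` and the values `σ` of the variables. -/
def eval (X : ℕ → ℕ) : Tm → (ℕ → ℕ) → ℕ
  | var v, σ => σ v
  | const c, _ => c
  | get t, σ => X (t.eval X σ)
  | add a b, σ => a.eval X σ + b.eval X σ
  | sub a b, σ => a.eval X σ - b.eval X σ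
  | ite c a b, σ => if c.eval X σ ≠ 0 then a.eval X σ else b.eval X σ
  | sum v b t, σ => ∑ i ∈ Finset.range (b.eval X σ), t.eval X (Function.update σ v i)

/-- The program that writes the value of a term into register `h`. The variables are held by the
registers `ρ v < h`, the array by bank `0`; the registers from `h` on serve as scratch space. -/
def compile : Tm → (ℕ → ℕ) → ℕ → Prog
  | var v, ρ, h => .seq (.const h 0) (.add h h (ρ v))
  | const c, _, h => .const h c
  | get t, ρ, h => .seq (t.compile ρ h) (.load h 0 h)
  | add a b, ρ, h => .seq (a.compile ρ h) (.seq (b.compile ρ (h + 1)) (.add h h (h + 1)))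
  | sub a b, ρ, h => .seq (a.compile ρ h) (.seq (b.compile ρ (h + 1)) (.sub h h (h + 1)))
  | ite c a b, ρ, h => .seq (c.compile ρ h) (.ite h (a.compile ρ h) (b.compile ρ h))
  | sum v b t, ρ, h =>
    .seq (b.compile ρ h) <| .seq (.const (h + 1) 0) <| .seq (.const (h + 2) 0) <|
      .seq (.const (h + 3) 1) <| .seq
        (.loop h (.seq (t.compile (Function.update ρ v (h + 2)) (h + 4)) <|
          .seq (.add (h + 1) (h + 1) (h + 4)) <| .seq (.add (h + 2) (h + 2) (h + 3))
            (.sub h h (h + 3))))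
        (.add h h (h + 1))

/-- A bound for the value if the variables and the array are bounded by the argument. -/
def valBound : Tm → ℕ → ℕ
  | var _, B => B
  | const c, _ => c
  | get _, B => B
  | add a b, B => a.valBound B + b.valBound B
  | sub a _, B => a.valBound B
  | ite _ a b, B => a.valBound B + b.valBound B
  | sum _ b t, B => b.valBound B * t.valBound (B + b.valBound B)

/-- A bound for the cost of the compiled program. -/
def costBound : Tm → ℕ → ℕ
  | var _, B => B + 3
  | const c, _ => c + 1
  | get t, B => t.costBound B + (t.valBound B + B + 2)
  | add a b, B => a.costBound B + (b.costBound B + (a.valBound B + b.valBound B + 2))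
  | sub a b, B => a.costBound B + (b.costBound B + (a.valBound B + b.valBound B + 2))
  | ite c a b, B => c.costBound B + (c.valBound B + 1 + (a.costBound B + b.costBound B))
  | sum _ b t, B =>
    b.costBound B + (1 + (1 + (2 + (((b.valBound B + 1) * (b.valBound B + 1) + b.valBound B *
      (t.costBound (B + b.valBound B) +
        ((b.valBound B * t.valBound (B + b.valBound B) + t.valBound (B + b.valBound B) + 2) +
          ((b.valBound B + 3) + (b.valBound B + 3))))) +
      (b.valBound B * t.valBound (B + b.valBound B) + 2)))))

theorem isPoly_valBound (t : Tm) : IsPoly t.valBound := by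
  induction t with
  | var v => exact .id
  | const c => exact .const c
  | get t ih => exact .id
  | add a b iha ihb => exact iha.add ihb
  | sub a b iha ihb => exact iha
  | ite c a b _ iha ihb => exact iha.add ihb
  | sum v b t ihb iht => exact ihb.mul (iht.comp (IsPoly.id.add ihb))

theorem isPoly_costBound (t : Tm) : IsPoly t.costBound := by
  induction t with
  | var v => exact IsPoly.id.add (.const 3)
  | const c => exact .const _
  | get t ih => exact ih.add ((t.isPoly_valBound.add .id).add (.const 2))
  | add a b iha ihb =>
    exact iha.add (ihb.add ((a.isPoly_valBound.add b.isPoly_valBound).add (.const 2)))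
  | sub a b iha ihb =>
    exact iha.add (ihb.add ((a.isPoly_valBound.add b.isPoly_valBound).add (.const 2)))
  | ite c a b ihc iha ihb =>
    exact ihc.add ((c.isPoly_valBound.add (.const 1)).add (iha.add ihb))
  | sum v b t ihb iht =>
    have hb := b.isPoly_valBound
    have hB := IsPoly.id.add hb
    have ht := t.isPoly_valBound.comp hB
    exact ihb.add <| (IsPoly.const 1).add <| (IsPoly.const 1).add <| (IsPoly.const 2).add <|
      IsPoly.add (((hb.add (.const 1)).mul (hb.add (.const 1))).add <| hb.mul <|
        (iht.comp hB).add <| (((hb.mul ht).add ht).add (.const 2)).add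
          ((hb.add (.const 3)).add (hb.add (.const 3)))) ((hb.mul ht).add (.const 2))

theorem update_le {σ : ℕ → ℕ} {B b v i : ℕ} (hσ : ∀ v, σ v ≤ B) (hi : i ≤ b) (w : ℕ) :
    Function.update σ v i w ≤ B + b := by
  have := hσ w
  rw [Function.update_apply]
  split_ifs <;> omega

theorem eval_le {X : ℕ → ℕ} (t : Tm) {B : ℕ} {σ : ℕ → ℕ} (hX : ∀ i, X i ≤ B)
    (hσ : ∀ v, σ v ≤ B) : t.eval X σ ≤ t.valBound B := by
  induction t generalizing B σ with
  | var v => exact hσ v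
  | const c => exact le_rfl
  | get t ih => exact hX _
  | add a b iha ihb => exact add_le_add (iha hX hσ) (ihb hX hσ)
  | sub a b iha ihb => exact (Nat.sub_le _ _).trans (iha hX hσ)
  | ite c a b _ iha ihb =>
    have := iha hX hσ
    have := ihb hX hσ
    simp only [eval, valBound]
    split_ifs <;> omega
  | sum v b t ihb iht =>
    have h := ihb hX hσ
    refine (Finset.sum_le_card_nsmul _ _ (t.valBound (B + b.valBound B)) fun i hi => ?_).trans ?_
    · exact iht (fun i => (hX i).trans (Nat.le_add_right _ _))
        (update_le hσ ((Finset.mem_range.1 hi).le.trans h))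
    · simpa [valBound] using Nat.mul_le_mul_right _ h

/-- What a compiled term leaves unchanged. -/
structure Frame (h : ℕ) (s s' : State) : Prop where
  reg : ∀ r < h, s'.reg r = s.reg r
  mem : s'.mem = s.mem
  coins : s'.coins = s.coins

/-- Registers are used like a stack: a subterm is compiled at a higher `h`, so the variables and the
intermediate results below `h` survive it. The frame condition is what carries the induction. -/
theorem compile_runsTo (t : Tm) {ρ : ℕ → ℕ} {h : ℕ} {s : State} {B : ℕ} (hρ : ∀ v, ρ v < h)
    (hX : ∀ i, s.mem 0 i ≤ B) (hσ : ∀ v, s.reg (ρ v) ≤ B) :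
    RunsTo (t.compile ρ h) s (t.costBound B) fun s' =>
      Frame h s s' ∧ s'.reg h = t.eval (s.mem 0) fun v => s.reg (ρ v) := by
  induction t generalizing ρ h s B with
  | var v =>
    have h1 := hρ v
    have h2 := hσ v
    refine RunsTo.seq_le (RunsTo.const (RunsTo.add (c := B + 2) ?_ ⟨⟨?_, rfl, rfl⟩, ?_⟩)) ?_
    · simp [h1.ne]; omega
    · intro r hr; simp [hr.ne]
    · simp [h1.ne, eval]
    · simp only [costBound]; omega
  | const c =>
    refine RunsTo.const ⟨⟨?_, rfl, rfl⟩, ?_⟩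
    · intro r hr; simp [hr.ne]
    · simp [eval]
  | get t ih =>
    refine RunsTo.seq ((ih hρ hX hσ).mono le_rfl ?_)
    rintro s₁ ⟨hf, hv⟩
    have := hX (s₁.reg h)
    have := eval_le t hX hσ
    refine RunsTo.load ?_ ⟨⟨?_, hf.mem, hf.coins⟩, ?_⟩
    · rw [hf.mem]; omega
    · intro r hr; simp [hr.ne, hf.reg r hr]
    · simp [eval, hv, hf.mem]
  | add a b iha ihb =>
    refine RunsTo.seq ((iha hρ hX hσ).mono le_rfl ?_)
    rintro s₁ ⟨hf, hv⟩
    have hσ₁ : ∀ v, s₁.reg (ρ v) = s.reg (ρ v) := fun v => hf.reg _ (hρ v)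
    refine RunsTo.seq ((ihb (fun v => (hρ v).trans (Nat.lt_succ_self h))
      (by rw [hf.mem]; exact hX) (by intro v; rw [hσ₁]; exact hσ v)).mono le_rfl ?_)
    rintro s₂ ⟨hf₂, hv₂⟩
    rw [hf.mem] at hv₂
    simp only [hσ₁] at hv₂
    have h2 := hf₂.reg h (Nat.lt_succ_self h)
    have := eval_le a hX hσ
    have := eval_le b hX hσ
    refine RunsTo.add (by rw [h2, hv, hv₂]; omega)
      ⟨⟨?_, by simp [hf₂.mem, hf.mem], by simp [hf₂.coins, hf.coins]⟩, ?_⟩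
    · intro r hr; simp [hr.ne, hf₂.reg r (by omega), hf.reg r hr]
    · simp [eval, h2, hv, hv₂]
  | sub a b iha ihb =>
    refine RunsTo.seq ((iha hρ hX hσ).mono le_rfl ?_)
    rintro s₁ ⟨hf, hv⟩
    have hσ₁ : ∀ v, s₁.reg (ρ v) = s.reg (ρ v) := fun v => hf.reg _ (hρ v)
    refine RunsTo.seq ((ihb (fun v => (hρ v).trans (Nat.lt_succ_self h))
      (by rw [hf.mem]; exact hX) (by intro v; rw [hσ₁]; exact hσ v)).mono le_rfl ?_)
    rintro s₂ ⟨hf₂, hv₂⟩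
    rw [hf.mem] at hv₂
    simp only [hσ₁] at hv₂
    have h2 := hf₂.reg h (Nat.lt_succ_self h)
    have := eval_le a hX hσ
    have := eval_le b hX hσ
    refine RunsTo.sub (by rw [h2, hv, hv₂]; omega)
      ⟨⟨?_, by simp [hf₂.mem, hf.mem], by simp [hf₂.coins, hf.coins]⟩, ?_⟩
    · intro r hr; simp [hr.ne, hf₂.reg r (by omega), hf.reg r hr]
    · simp [eval, h2, hv, hv₂]
  | ite c a b ihc iha ihb =>
    refine RunsTo.seq ((ihc hρ hX hσ).mono le_rfl ?_)
    rintro s₁ ⟨hf, hv⟩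
    have hσ₁ : ∀ v, s₁.reg (ρ v) = s.reg (ρ v) := fun v => hf.reg _ (hρ v)
    have hX₁ : ∀ i, s₁.mem 0 i ≤ B := by rw [hf.mem]; exact hX
    have hσ₂ : ∀ v, s₁.reg (ρ v) ≤ B := by intro v; rw [hσ₁]; exact hσ v
    have hc := eval_le c hX hσ
    have key : ∀ s' t, Frame h s₁ s' ∧ s'.reg h = eval (s₁.mem 0) t (fun v => s₁.reg (ρ v)) →
        Frame h s s' ∧ s'.reg h = eval (s.mem 0) t (fun v => s.reg (ρ v)) := by
      rintro s' t ⟨hf', hv'⟩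
      simp only [hσ₁, hf.mem] at hv'
      exact ⟨⟨fun r hr => (hf'.reg r hr).trans (hf.reg r hr), hf'.mem.trans hf.mem,
        hf'.coins.trans hf.coins⟩, hv'⟩
    by_cases h0 : s₁.reg h = 0
    · refine (RunsTo.ite_of_eq h0 (ihb hρ hX₁ hσ₂)).mono (by omega) fun s' hs' => ?_
      have := key s' b hs'
      rw [hv] at h0
      simpa [eval, h0] using this
    · refine (RunsTo.ite_of_ne h0 (iha hρ hX₁ hσ₂)).mono (by omega) fun s' hs' => ?_
      have := key s' a hs'
      rw [hv] at h0
      simpa [eval, h0] using this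
  | sum v b t ihb iht =>
    refine RunsTo.seq ((ihb hρ hX hσ).mono le_rfl ?_)
    rintro s₁ ⟨hf, hv⟩
    have hn := eval_le b hX hσ
    set n := eval (s.mem 0) b fun v => s.reg (ρ v) with hn_def
    set σ : ℕ → ℕ := fun v => s.reg (ρ v) with hσ_def
    set V := t.valBound (B + b.valBound B) with hV
    let val : ℕ → ℕ := fun i => eval (s.mem 0) t (Function.update σ v i)
    have hval : ∀ i ≤ n, val i ≤ V := fun i hi =>
      eval_le t (fun i => (hX i).trans (Nat.le_add_right _ _)) (update_le hσ (hi.trans hn))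
    have hsum : ∀ i ≤ n, ∑ a ∈ Finset.range i, val a ≤ b.valBound B * V := fun i hi => by
      refine (Finset.sum_le_card_nsmul _ _ V fun a ha =>
        hval a ((Finset.mem_range.1 ha).le.trans hi)).trans ?_
      simpa using Nat.mul_le_mul_right V (hi.trans hn)
    refine RunsTo.seq (RunsTo.const (RunsTo.seq (RunsTo.const (RunsTo.seq (RunsTo.const
      (RunsTo.seq ?_))))))
    -- The counter in `h` runs down while the summation index in `h + 2` runs up, so with `j` rounds
    -- to go the index is `n - j` and the terms below `n - j` have been summed.
    let I : ℕ → State → Prop := fun j s' => j ≤ n ∧ Frame h s s' ∧ s'.reg h = j ∧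
      s'.reg (h + 1) = ∑ a ∈ Finset.range (n - j), val a ∧ s'.reg (h + 2) = n - j ∧
      s'.reg (h + 3) = 1
    refine (RunsTo.loop (n := n) (c := t.costBound (B + b.valBound B) +
      ((b.valBound B * V + V + 2) + ((b.valBound B + 3) + (b.valBound B + 3)))) I
      (fun j s hI => hI.2.2.1) ?_ n _ le_rfl ?_).mono
      (c₂ := ((b.valBound B + 1) * (b.valBound B + 1) + b.valBound B *
      (t.costBound (B + b.valBound B) + ((b.valBound B * V + V + 2) +
          ((b.valBound B + 3) + (b.valBound B + 3)))))) ?_ ?_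
    · rintro j s' hj ⟨-, hf', h0, h1, h2, h3⟩
      have hρ' : ∀ w, Function.update ρ v (h + 2) w < h + 4 := by
        intro w
        have := hρ w
        rw [Function.update_apply]
        split_ifs <;> omega
      have hσ' : (fun w => s'.reg (Function.update ρ v (h + 2) w)) =
          Function.update σ v (n - (j + 1)) := by
        funext w
        simp only [Function.update_apply]
        split_ifs
        · exact h2
        · exact hf'.reg _ (hρ w)
      refine RunsTo.seq ((iht (s := s') (B := B + b.valBound B) hρ' ?_ ?_).mono le_rfl ?_)
      · intro i; rw [hf'.mem]; exact (hX i).trans (Nat.le_add_right _ _)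
      · intro w
        rw [show s'.reg (Function.update ρ v (h + 2) w) = _ from congrFun hσ' w]
        exact update_le hσ (by omega) w
      · rintro s'' ⟨hf'', hv''⟩
        rw [hσ', hf'.mem] at hv''
        have e0 := hf''.reg h (by omega)
        have e1 := hf''.reg (h + 1) (by omega)
        have e2 := hf''.reg (h + 2) (by omega)
        have e3 := hf''.reg (h + 3) (by omega)
        have hb1 := hsum (n - (j + 1)) (by omega)
        have hb2 : s''.reg (h + 4) ≤ V := by rw [hv'']; exact hval _ (by omega)
        refine RunsTo.seq (RunsTo.add (by omega) (RunsTo.seq (RunsTo.add ?_ (RunsTo.sub ?_ ?_))))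
        · simp; omega
        · simp; omega
        · refine ⟨by omega, ⟨?_, by simp [hf''.mem, hf'.mem], by simp [hf''.coins, hf'.coins]⟩,
            ?_, ?_, ?_, ?_⟩
          · intro r hr
            have a1 : r ≠ h := by omega
            have a2 : r ≠ h + 1 := by omega
            have a3 : r ≠ h + 2 := by omega
            simp [a1, a2, a3, hf''.reg r (by omega), hf'.reg r hr]
          · simp; omega
          · have : n - j = n - (j + 1) + 1 := by omega
            rw [this, Finset.sum_range_succ]
            simp [e1, h1, hv'', val]
          · simp; omega
          · simp; omega
    · refine ⟨le_rfl, ⟨?_, hf.mem, hf.coins⟩, ?_, ?_, ?_, ?_⟩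
      · intro r hr
        have a1 : r ≠ h + 1 := by omega
        have a2 : r ≠ h + 2 := by omega
        have a3 : r ≠ h + 3 := by omega
        simp [a1, a2, a3, hf.reg r hr]
      all_goals simp [hv]
    · have := hn
      gcongr
    · rintro s' ⟨-, hf', h0, h1, -, -⟩
      have hb := hsum n le_rfl
      -- The loop leaves 0 in register `h`, so this addition merely moves the sum there.
      refine RunsTo.add ?_ ⟨⟨?_, hf'.mem, hf'.coins⟩, ?_⟩
      · rw [h0, h1]; simp; omega
      · intro r hr; simp [hr.ne, hf'.reg r hr]
      · simp only [State.setReg_reg, if_true, h0, h1, zero_add]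
        rfl

end Tm

/-! ## Programs that print lists -/

/-- Printing commands: print the value of a term, sequencing, repetition for all `v < b`. -/
inductive Printer where
  | emit (t : Tm) : Printer
  | seq (a b : Printer) : Printer
  | rep (v : ℕ) (b : Tm) (e : Printer) : Printer

namespace Printer

/-- The printed list. -/
def out (X : ℕ → ℕ) : Printer → (ℕ → ℕ) → List ℕ
  | emit t, σ => [t.eval X σ]
  | seq a b, σ => a.out X σ ++ b.out X σ
  | rep v b e, σ => (List.range (b.eval X σ)).flatMap fun i => e.out X (Function.update σ v i)

/-- The program that appends the printed list to the list in bank `o` whose length is held by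
register `q`. -/
def compile (o q : ℕ) : Printer → (ℕ → ℕ) → ℕ → Prog
  | emit t, ρ, h =>
    .seq (t.compile ρ h) <| .seq (.store o q h) <| .seq (.const h 1) (.add q q h)
  | seq a b, ρ, h => .seq (a.compile o q ρ h) (b.compile o q ρ h)
  | rep v b e, ρ, h =>
    .seq (b.compile ρ h) <| .seq (.const (h + 1) 0) <|
      .loop h (.seq (e.compile o q (Function.update ρ v (h + 1)) (h + 2)) <|
        .seq (.const (h + 2) 1) <| .seq (.add (h + 1) (h + 1) (h + 2)) (.sub h h (h + 2)))

/-- A bound for the printed values. -/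
def valBound : Printer → ℕ → ℕ
  | emit t, B => t.valBound B
  | seq a b, B => a.valBound B + b.valBound B
  | rep _ b e, B => e.valBound (B + b.valBound B)

/-- A bound for the length of the printed list. -/
def lenBound : Printer → ℕ → ℕ
  | emit _, _ => 1
  | seq a b, B => a.lenBound B + b.lenBound B
  | rep _ b e, B => b.valBound B * e.lenBound (B + b.valBound B)

/-- A bound for the cost of the compiled program, if the length of the list does not exceed `K`. -/
def costBound : Printer → ℕ → ℕ → ℕ
  | emit t, K, B => t.costBound B + ((K + t.valBound B + 2) + (2 + (K + 3)))
  | seq a b, K, B => a.costBound K B + b.costBound K B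
  | rep _ b e, K, B => b.costBound B + (1 + ((b.valBound B + 1) * (b.valBound B + 1) +
      b.valBound B * (e.costBound K (B + b.valBound B) +
        (2 + ((b.valBound B + 3) + (b.valBound B + 3))))))

theorem isPoly_valBound (e : Printer) : IsPoly e.valBound := by
  induction e with
  | emit t => exact t.isPoly_valBound
  | seq a b iha ihb => exact iha.add ihb
  | rep v b e ih => exact ih.comp (IsPoly.id.add b.isPoly_valBound)

theorem isPoly_lenBound (e : Printer) : IsPoly e.lenBound := by
  induction e with
  | emit t => exact .const 1
  | seq a b iha ihb => exact iha.add ihb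
  | rep v b e ih => exact b.isPoly_valBound.mul (ih.comp (IsPoly.id.add b.isPoly_valBound))

theorem isPoly_costBound (e : Printer) {f g : ℕ → ℕ} (hf : IsPoly f) (hg : IsPoly g) :
    IsPoly fun B => e.costBound (f B) (g B) := by
  induction e generalizing g with
  | emit t =>
    exact (t.isPoly_costBound.comp hg).add <| ((hf.add (t.isPoly_valBound.comp hg)).add
      (.const 2)).add ((IsPoly.const 2).add (hf.add (.const 3)))
  | seq a b iha ihb => exact (iha hg).add (ihb hg)
  | rep v b e ih =>
    have hb := b.isPoly_valBound.comp hg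
    exact (b.isPoly_costBound.comp hg).add <| (IsPoly.const 1).add <|
      ((hb.add (.const 1)).mul (hb.add (.const 1))).add <| hb.mul <| (ih (hg.add hb)).add <|
        (IsPoly.const 2).add ((hb.add (.const 3)).add (hb.add (.const 3)))

theorem le_valBound {X : ℕ → ℕ} (e : Printer) {B : ℕ} {σ : ℕ → ℕ} (hX : ∀ i, X i ≤ B)
    (hσ : ∀ v, σ v ≤ B) : ∀ y ∈ e.out X σ, y ≤ e.valBound B := by
  induction e generalizing B σ with
  | emit t => simpa [out, valBound] using t.eval_le hX hσ
  | seq a b iha ihb =>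
    intro y hy
    rcases List.mem_append.1 hy with hy | hy
    · exact (iha hX hσ y hy).trans (Nat.le_add_right _ _)
    · exact (ihb hX hσ y hy).trans (Nat.le_add_left _ _)
  | rep v b e ih =>
    intro y hy
    obtain ⟨i, hi, hy⟩ := List.mem_flatMap.1 hy
    exact ih (fun i => (hX i).trans (Nat.le_add_right _ _))
      (Tm.update_le hσ ((List.mem_range.1 hi).le.trans (b.eval_le hX hσ))) y hy

theorem length_flatMap_range_le {f : ℕ → List ℕ} {n K : ℕ} (hf : ∀ i < n, (f i).length ≤ K) :
    ((List.range n).flatMap f).length ≤ n * K := by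
  induction n with
  | zero => simp
  | succ n ih =>
    rw [List.range_succ, List.flatMap_append, List.length_append]
    have h1 := ih fun i hi => hf i (by omega)
    have h2 := hf n (by omega)
    simp only [List.flatMap_singleton]
    rw [Nat.succ_mul]
    omega

theorem length_out_le {X : ℕ → ℕ} (e : Printer) {B : ℕ} {σ : ℕ → ℕ} (hX : ∀ i, X i ≤ B)
    (hσ : ∀ v, σ v ≤ B) : (e.out X σ).length ≤ e.lenBound B := by
  induction e generalizing B σ with
  | emit t => simp [out, lenBound]
  | seq a b iha ihb => simpa [out, lenBound] using add_le_add (iha hX hσ) (ihb hX hσ)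
  | rep v b e ih =>
    have hb := b.eval_le hX hσ
    exact (length_flatMap_range_le fun i hi => ih (fun i => (hX i).trans (Nat.le_add_right _ _))
      (Tm.update_le hσ (hi.le.trans hb))).trans (Nat.mul_le_mul_right _ hb)

/-- Bank `o` and register `q` hold the list `l` and its length. -/
def Holds (o q : ℕ) (l : List ℕ) (s : State) : Prop :=
  (∀ i, s.mem o i = l.getD i 0) ∧ s.reg q = l.length

/-- What a compiled printer leaves unchanged. -/
structure Frame (o q h : ℕ) (s s' : State) : Prop where
  reg : ∀ r < h, r ≠ q → s'.reg r = s.reg r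
  mem : ∀ a, a ≠ o → s'.mem a = s.mem a
  coins : s'.coins = s.coins

theorem Frame.trans {o q h : ℕ} {s s' s'' : State} (h₁ : Frame o q h s s')
    (h₂ : Frame o q h s' s'') : Frame o q h s s'' :=
  ⟨fun r hr hq => (h₂.reg r hr hq).trans (h₁.reg r hr hq),
    fun a ha => (h₂.mem a ha).trans (h₁.mem a ha), h₂.coins.trans h₁.coins⟩

theorem getD_append_singleton (l : List ℕ) (v i : ℕ) :
    (l ++ [v]).getD i 0 = if i = l.length then v else l.getD i 0 := by
  rcases lt_trichotomy i l.length with h | h | h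
  · rw [List.getD_append _ _ _ _ h, if_neg h.ne]
  · subst h; simp
  · rw [if_neg h.ne', List.getD_eq_default _ _ (by simp; omega), List.getD_eq_default _ _ h.le]

/-- The output goes to a bank other than 0, so the array that the terms read does not change during
printing. `K` bounds the final length and hence every address written. -/
theorem compile_runsTo (e : Printer) {o q : ℕ} (ho : o ≠ 0) {ρ : ℕ → ℕ} {h : ℕ} {s : State}
    {B K : ℕ} {acc : List ℕ} (hρ : ∀ v, ρ v < h) (hρq : ∀ v, ρ v ≠ q) (hq : q < h)
    (hX : ∀ i, s.mem 0 i ≤ B) (hσ : ∀ v, s.reg (ρ v) ≤ B) (hs : Holds o q acc s)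
    (hK : acc.length + e.lenBound B ≤ K) :
    RunsTo (e.compile o q ρ h) s (e.costBound K B) fun s' =>
      Frame o q h s s' ∧ Holds o q (acc ++ e.out (s.mem 0) fun v => s.reg (ρ v)) s' := by
  induction e generalizing ρ h s B acc with
  | emit t =>
    refine RunsTo.seq ((t.compile_runsTo hρ hX hσ).mono le_rfl ?_)
    rintro s₁ ⟨hf, hv⟩
    have hval := t.eval_le hX hσ
    have hq₁ : s₁.reg q = acc.length := (hf.reg q hq).trans hs.2
    simp only [lenBound] at hK
    refine RunsTo.seq (RunsTo.store (by rw [hq₁, hv]; omega) (RunsTo.seq (RunsTo.const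
      (RunsTo.add ?_ ⟨⟨?_, ?_, ?_⟩, ?_, ?_⟩))))
    · simp [hq.ne, hq₁]; omega
    · intro r hr hrq; simp [hrq, hr.ne, hf.reg r hr]
    · intro a ha
      funext i
      simp [ha, hf.mem]
    · simp [hf.coins]
    · intro i
      simp only [out, getD_append_singleton, State.setReg_mem, State.setMem_mem, hq₁, hv, hf.mem,
        hs.1, true_and]
    · simp [hq.ne, hq₁, out]
  | seq a b iha ihb =>
    simp only [lenBound] at hK
    have hla := a.length_out_le hX hσ
    refine RunsTo.seq ((iha hρ hρq hq hX hσ hs (by omega)).mono le_rfl ?_)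
    rintro s₁ ⟨hf, hv⟩
    have h0 : s₁.mem 0 = s.mem 0 := hf.mem 0 ho.symm
    have hσ₁ : ∀ v, s₁.reg (ρ v) = s.reg (ρ v) := fun v => hf.reg _ (hρ v) (hρq v)
    refine (ihb hρ hρq hq (by rw [h0]; exact hX) (by intro v; rw [hσ₁]; exact hσ v) hv
      (by rw [List.length_append]; omega)).mono le_rfl ?_
    rintro s₂ ⟨hf₂, hv₂⟩
    simp only [h0, hσ₁, List.append_assoc] at hv₂
    exact ⟨hf.trans hf₂, hv₂⟩
  | rep v b e ih =>
    refine RunsTo.seq ((b.compile_runsTo hρ hX hσ).mono le_rfl ?_)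
    rintro s₁ ⟨hf, hv⟩
    have hn := b.eval_le hX hσ
    set σ : ℕ → ℕ := fun v => s.reg (ρ v) with hσ_def
    set n := b.eval (s.mem 0) σ with hn_def
    set L := e.lenBound (B + b.valBound B) with hL
    let val : ℕ → List ℕ := fun i => e.out (s.mem 0) (Function.update σ v i)
    have hval : ∀ i < n, (val i).length ≤ L := fun i hi =>
      e.length_out_le (fun i => (hX i).trans (Nat.le_add_right _ _))
        (Tm.update_le hσ (hi.le.trans hn))
    have hK' : acc.length + b.valBound B * L ≤ K := hK
    let I : ℕ → State → Prop := fun j s' => j ≤ n ∧ Frame o q h s s' ∧ s'.reg h = j ∧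
      s'.reg (h + 1) = n - j ∧ Holds o q (acc ++ (List.range (n - j)).flatMap val) s'
    refine RunsTo.seq (RunsTo.const ?_)
    refine (RunsTo.loop (n := n) (c := e.costBound K (B + b.valBound B) +
        (2 + ((b.valBound B + 3) + (b.valBound B + 3)))) I
      (fun j s hI => hI.2.2.1) ?_ n _ le_rfl ?_).mono ?_ ?_
    · rintro j s' hj ⟨-, hf', h0, h1, h2⟩
      have hρ' : ∀ w, Function.update ρ v (h + 1) w < h + 2 := by
        intro w
        have := hρ w
        rw [Function.update_apply]
        split_ifs <;> omega
      have hρq' : ∀ w, Function.update ρ v (h + 1) w ≠ q := by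
        intro w
        have := hρq w
        rw [Function.update_apply]
        split_ifs <;> omega
      have hσ' : (fun w => s'.reg (Function.update ρ v (h + 1) w)) =
          Function.update σ v (n - (j + 1)) := by
        funext w
        simp only [Function.update_apply]
        split_ifs
        · exact h1
        · exact hf'.reg _ (hρ w) (hρq w)
      have hm : s'.mem 0 = s.mem 0 := hf'.mem 0 ho.symm
      refine RunsTo.seq ((ih (s := s') (B := B + b.valBound B) hρ' hρq' (by omega) ?_ ?_ h2
        ?_).mono le_rfl ?_)
      · intro i; rw [hm]; exact (hX i).trans (Nat.le_add_right _ _)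
      · intro w
        rw [show s'.reg (Function.update ρ v (h + 1) w) = _ from congrFun hσ' w]
        exact Tm.update_le hσ (by omega) w
      -- The rounds done so far and the present one are at most `b.valBound B` in number, and each
      -- adds at most `L` entries.
      · have h3 : ((List.range (n - (j + 1))).flatMap val).length ≤ (n - (j + 1)) * L :=
          length_flatMap_range_le fun i hi => hval i (by omega)
        have h4 : (n - (j + 1) + 1) * L ≤ b.valBound B * L := Nat.mul_le_mul_right _ (by omega)
        rw [Nat.succ_mul] at h4
        rw [List.length_append]
        omega
      · rintro s'' ⟨hf'', hv''⟩
        rw [hσ', hm] at hv''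
        have e0 := hf''.reg h (by omega) (by omega)
        have e1 := hf''.reg (h + 1) (by omega) (by omega)
        refine RunsTo.seq (RunsTo.const (RunsTo.seq (RunsTo.add ?_ (RunsTo.sub ?_ ?_))))
        · simp; omega
        · simp; omega
        · refine ⟨by omega, ⟨?_, ?_, ?_⟩, ?_, ?_, ?_, ?_⟩
          · intro r hr hrq
            have a1 : r ≠ h := by omega
            have a2 : r ≠ h + 1 := by omega
            have a3 : r ≠ h + 2 := by omega
            simp [a1, a2, a3, hf''.reg r (by omega) hrq, hf'.reg r hr hrq]
          · intro a ha; simp [hf''.mem a ha, hf'.mem a ha]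
          · simp [hf''.coins, hf'.coins]
          · simp; omega
          · simp; omega
          · intro i
            have : n - j = n - (j + 1) + 1 := by omega
            rw [this, List.range_succ, List.flatMap_append, List.flatMap_singleton,
              ← List.append_assoc]
            exact hv''.1 i
          · have : n - j = n - (j + 1) + 1 := by omega
            rw [this, List.range_succ, List.flatMap_append, List.flatMap_singleton,
              ← List.append_assoc]
            have a1 : q ≠ h := by omega
            have a2 : q ≠ h + 1 := by omega
            have a3 : q ≠ h + 2 := by omega
            simp only [State.setReg_reg, a1, a2, a3, if_false]
            exact hv''.2
    · have a1 : q ≠ h + 1 := by omega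
      refine ⟨le_rfl, ⟨?_, ?_, hf.coins⟩, ?_, ?_, ?_, ?_⟩
      · intro r hr hrq
        have a1 : r ≠ h + 1 := by omega
        simp [a1, hf.reg r hr]
      · intro a ha; simp [hf.mem]
      · simp [hv]
      · simp
      · simpa [hf.mem] using hs.1
      · simpa [a1, hf.reg q hq] using hs.2
    · gcongr
    · rintro s' ⟨-, hf', h0, h1, h2⟩
      exact ⟨hf', h2⟩

end Printer

/-! ## Subroutines: locality and growth of the numbers -/

/-- The registers and banks that a program mentions are below this number. -/
def Prog.bound : Prog → ℕ
  | .skip => 0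
  | .const r _ => r + 1
  | .add r a b => r + a + b + 1
  | .sub r a b => r + a + b + 1
  | .load r a i => r + a + i + 1
  | .store a i b => a + i + b + 1
  | .flip r => r + 1
  | .seq p q => p.bound + q.bound
  | .ite r p q => r + 1 + p.bound + q.bound
  | .loop r p => r + 1 + p.bound

/-- The states agree on the registers and banks below `R` and on the random bits. -/
structure AgreeBelow (R : ℕ) (s s' : State) : Prop where
  reg : ∀ r < R, s.reg r = s'.reg r
  mem : ∀ a < R, s.mem a = s'.mem a
  coins : s.coins = s'.coins

theorem AgreeBelow.setReg {R : ℕ} {s s' : State} (h : AgreeBelow R s s') (r v : ℕ) :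
    AgreeBelow R (s.setReg r v) (s'.setReg r v) :=
  ⟨fun i hi => by simp [h.reg i hi], h.mem, h.coins⟩

theorem AgreeBelow.setMem {R : ℕ} {s s' : State} (h : AgreeBelow R s s') (a i v : ℕ) :
    AgreeBelow R (s.setMem a i v) (s'.setMem a i v) :=
  ⟨h.reg, fun b hb => by funext j; simp [h.mem b hb], h.coins⟩

/-- A program cannot see beyond the registers and banks that it mentions. Hence `A` behaves on a
used machine as on a fresh one, with the same coins and the same cost, and data kept in registers
from `R` on survive its run. -/
theorem Exec.local_run {p : Prog} {s s₁ : State} {T R : ℕ} (h : Exec p s T s₁)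
    (hR : p.bound ≤ R) {s' : State} (hs : AgreeBelow R s s') :
    ∃ s₁', Exec p s' T s₁' ∧ AgreeBelow R s₁ s₁' ∧ ∀ r, R ≤ r → s₁'.reg r = s'.reg r := by
  have upd : ∀ {r R : ℕ} (s : State) (v : ℕ), r < R → ∀ i, R ≤ i →
      (s.setReg r v).reg i = s.reg i := fun s v hr i hi => by
    have : i ≠ _ := (hr.trans_le hi).ne'
    simp [this]
  induction h generalizing s' with
  | skip s => exact ⟨s', .skip s', hs, fun _ _ => rfl⟩
  | const s r c =>
    exact ⟨_, .const s' r c, hs.setReg r c, upd _ _ (by simp only [Prog.bound] at hR; omega)⟩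
  | add s r a b =>
    simp only [Prog.bound] at hR
    rw [hs.reg a (by omega), hs.reg b (by omega)]
    exact ⟨_, .add s' r a b, hs.setReg _ _, upd _ _ (by omega)⟩
  | sub s r a b =>
    simp only [Prog.bound] at hR
    rw [hs.reg a (by omega), hs.reg b (by omega)]
    exact ⟨_, .sub s' r a b, hs.setReg _ _, upd _ _ (by omega)⟩
  | load s r a i =>
    simp only [Prog.bound] at hR
    rw [hs.reg i (by omega), hs.mem a (by omega)]
    exact ⟨_, .load s' r a i, hs.setReg _ _, upd _ _ (by omega)⟩
  | store s a i b =>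
    simp only [Prog.bound] at hR
    rw [hs.reg i (by omega), hs.reg b (by omega)]
    exact ⟨_, .store s' a i b, hs.setMem _ _ _, fun _ _ => rfl⟩
  | flip s r =>
    simp only [Prog.bound] at hR
    refine ⟨_, .flip s' r, ⟨?_, hs.mem, by rw [hs.coins]⟩, upd _ _ (by omega)⟩
    rw [hs.coins]
    exact (hs.setReg _ _).reg
  | seq _ _ ih₁ ih₂ =>
    simp only [Prog.bound] at hR
    obtain ⟨s₁', e₁, h₁, f₁⟩ := ih₁ (by omega) hs
    obtain ⟨s₂', e₂, h₂, f₂⟩ := ih₂ (by omega) h₁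
    exact ⟨s₂', .seq e₁ e₂, h₂, fun r hr => (f₂ r hr).trans (f₁ r hr)⟩
  | iteTrue h _ ih =>
    simp only [Prog.bound] at hR
    obtain ⟨s₁', e₁, h₁, f₁⟩ := ih (by omega) hs
    rw [hs.reg _ (by omega)] at h ⊢
    exact ⟨s₁', .iteTrue h e₁, h₁, f₁⟩
  | iteFalse h _ ih =>
    simp only [Prog.bound] at hR
    obtain ⟨s₁', e₁, h₁, f₁⟩ := ih (by omega) hs
    rw [hs.reg _ (by omega)] at h ⊢
    exact ⟨s₁', .iteFalse h e₁, h₁, f₁⟩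
  | loopDone h =>
    simp only [Prog.bound] at hR
    rw [hs.reg _ (by omega)] at h ⊢
    exact ⟨s', .loopDone h, hs, fun _ _ => rfl⟩
  | loopStep h _ _ ih₁ ih₂ =>
    obtain ⟨s₁', e₁, h₁, f₁⟩ := ih₁ (by simp only [Prog.bound] at hR; omega) hs
    obtain ⟨s₂', e₂, h₂, f₂⟩ := ih₂ hR h₁
    simp only [Prog.bound] at hR
    rw [hs.reg _ (by omega)] at h ⊢
    exact ⟨s₂', .loopStep h e₁ e₂, h₂, fun r hr => (f₂ r hr).trans (f₁ r hr)⟩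

/-- All numbers in the state have at most `b` binary digits. -/
structure SizeLE (b : ℕ) (s : State) : Prop where
  reg : ∀ r, (s.reg r).size ≤ b
  mem : ∀ a i, (s.mem a i).size ≤ b

theorem SizeLE.mono {b b' : ℕ} {s : State} (h : SizeLE b s) (hb : b ≤ b') : SizeLE b' s :=
  ⟨fun r => (h.reg r).trans hb, fun a i => (h.mem a i).trans hb⟩

theorem SizeLE.setReg {b : ℕ} {s : State} (h : SizeLE b s) {r v : ℕ} (hv : v.size ≤ b) :
    SizeLE b (s.setReg r v) := by
  refine ⟨fun i => ?_, h.mem⟩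
  rw [State.setReg_reg]
  split_ifs
  exacts [hv, h.reg i]

theorem SizeLE.setMem {b : ℕ} {s : State} (h : SizeLE b s) {a i v : ℕ} (hv : v.size ≤ b) :
    SizeLE b (s.setMem a i v) := by
  refine ⟨h.reg, fun c j => ?_⟩
  rw [State.setMem_mem]
  split_ifs
  exacts [hv, h.mem c j]

theorem size_add_le {a c b : ℕ} (ha : a.size ≤ b) (hc : c.size ≤ b) : (a + c).size ≤ b + 1 := by
  rw [Nat.size_le] at *
  rw [pow_succ]
  omega

/-- An addition gains one binary digit and costs at least one; a constant is charged more than its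
length; the other operations create no longer numbers, a coin flip at most one digit at cost one. -/
theorem Exec.sizeLE {p : Prog} {s s₁ : State} {T b : ℕ} (h : Exec p s T s₁) (hs : SizeLE b s) :
    SizeLE (b + T) s₁ := by
  induction h generalizing b with
  | skip s => exact hs.mono (by omega)
  | const s r c => exact (hs.mono (by omega)).setReg (by unfold logCost; omega)
  | add s r a c =>
    exact (hs.mono (by omega)).setReg ((size_add_le (hs.reg a) (hs.reg c)).trans
      (by unfold logCost; omega))
  | sub s r a c =>
    exact (hs.mono (by omega)).setReg ((Nat.size_le_size (Nat.sub_le _ _)).trans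
      ((hs.reg a).trans (by omega)))
  | load s r a i => exact (hs.mono (by omega)).setReg ((hs.mem a _).trans (by omega))
  | store s a i c => exact (hs.mono (by omega)).setMem ((hs.reg c).trans (by omega))
  | flip s r =>
    have h2 := (hs.mono (Nat.le_add_right b 1)).setReg (r := r) (v := (s.coins 0).toNat)
      (by cases s.coins 0 <;> simp)
    exact ⟨h2.reg, h2.mem⟩
  | seq _ _ ih₁ ih₂ => exact (ih₂ (ih₁ hs)).mono (by omega)
  | iteTrue _ _ ih => exact (ih hs).mono (by omega)
  | iteFalse _ _ ih => exact (ih hs).mono (by omega)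
  | loopDone _ => exact hs.mono (by omega)
  | loopStep _ _ _ ih₁ ih₂ => exact (ih₂ (ih₁ hs)).mono (by omega)

/-! ## The sawtooth curve -/

/-- The trapezoid function `s(t) = 1 - δ⁻¹ σ(δ - t) - δ⁻¹ σ(t - (1 - δ))`. -/
noncomputable def trapezoid (δ y : ℝ) : ℝ :=
  1 - δ⁻¹ * max 0 (δ - y) - δ⁻¹ * max 0 (y - (1 - δ))

/-- The inverse of the rising branch over [0, δ]; the next lemma inverts the falling branch over [1
- δ, 1]. On each branch only one of the two ReLU terms is active. -/
theorem trapezoid_mul {δ : ℝ} (h0 : 0 < δ) (h1 : δ < 1 / 2) {t : ℝ} (ht : t ∈ Set.Icc (0 : ℝ) 1) :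
    trapezoid δ (δ * t) = t := by
  obtain ⟨ht0, ht1⟩ := ht
  have e1 : 0 ≤ δ - δ * t := by nlinarith
  have e2 : δ * t - (1 - δ) ≤ 0 := by nlinarith
  rw [trapezoid, max_eq_right e1, max_eq_left e2]
  field_simp
  ring

theorem trapezoid_one_sub {δ : ℝ} (h0 : 0 < δ) (h1 : δ < 1 / 2) {t : ℝ}
    (ht : t ∈ Set.Icc (0 : ℝ) 1) : trapezoid δ (1 - δ * t) = t := by
  obtain ⟨ht0, ht1⟩ := ht
  have e1 : δ - (1 - δ * t) ≤ 0 := by nlinarith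
  have e2 : 0 ≤ 1 - δ * t - (1 - δ) := by nlinarith
  rw [trapezoid, max_eq_left e1, max_eq_right e2]
  field_simp
  ring

/-- The number `y` is close to the truth value `b`. -/
def Near (δ : ℝ) (b : Bool) (y : ℝ) : Prop := if b then 1 - δ ≤ y else y ≤ δ

/-- Every pattern of `N` truth values is taken by the iterates on an interval of length `δ ^ N`. -/
theorem exists_interval {δ : ℝ} (h0 : 0 < δ) (h1 : δ < 1 / 2) (N : ℕ) (z : ℕ → Bool) :
    ∃ a, 0 ≤ a ∧ a + δ ^ N ≤ 1 ∧ ∀ t ∈ Set.Icc a (a + δ ^ N), ∀ i < N,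
      Near δ (z i) ((trapezoid δ)^[i] t) := by
  induction N generalizing z with
  | zero => exact ⟨0, le_rfl, by simp, fun t _ i hi => absurd hi (Nat.not_lt_zero i)⟩
  | succ N ih =>
    obtain ⟨a, ha0, ha1, ha⟩ := ih fun i => z (i + 1)
    have hp : 0 < δ ^ N := pow_pos h0 N
    have key : ∀ t t' : ℝ, t' ∈ Set.Icc a (a + δ ^ N) → trapezoid δ t = t' → Near δ (z 0) t →
        ∀ i < N + 1, Near δ (z i) ((trapezoid δ)^[i] t) := by
      rintro t t' ht' rfl hn (_ | i) hi
      · exact hn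
      · rw [Function.iterate_succ_apply]
        exact ha _ ht' i (by omega)
    -- The interval of the shifted pattern is pulled back along the rising branch if the first value
    -- is to be near 0, and along the falling branch if it is to be near 1. Both contract by δ.
    rcases hz : z 0 with _ | _
    · refine ⟨δ * a, by positivity, by rw [pow_succ]; nlinarith, fun t ht => ?_⟩
      obtain ⟨t', rfl⟩ : ∃ t', t = δ * t' := ⟨t / δ, by field_simp⟩
      have ht' : t' ∈ Set.Icc a (a + δ ^ N) := by
        rw [pow_succ] at ht
        exact ⟨le_of_mul_le_mul_left ht.1 h0, le_of_mul_le_mul_left (by linarith [ht.2]) h0⟩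
      have hu : t' ∈ Set.Icc (0 : ℝ) 1 := ⟨ha0.trans ht'.1, ht'.2.trans ha1⟩
      refine key _ t' ht' (trapezoid_mul h0 h1 hu) ?_
      simp only [Near, hz, Bool.false_eq_true, if_false]
      nlinarith [hu.2]
    · refine ⟨1 - δ * (a + δ ^ N), by nlinarith, by rw [pow_succ]; nlinarith, fun t ht => ?_⟩
      obtain ⟨t', rfl⟩ : ∃ t', t = 1 - δ * t' := ⟨(1 - t) / δ, by field_simp; ring⟩
      have ht' : t' ∈ Set.Icc a (a + δ ^ N) := by
        rw [pow_succ] at ht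
        exact ⟨le_of_mul_le_mul_left (by linarith [ht.2]) h0,
          le_of_mul_le_mul_left (by linarith [ht.1]) h0⟩
      have hu : t' ∈ Set.Icc (0 : ℝ) 1 := ⟨ha0.trans ht'.1, ht'.2.trans ha1⟩
      refine key _ t' ht' (trapezoid_one_sub h0 h1 hu) ?_
      simp only [Near, hz, if_true]
      nlinarith [hu.2]

/-! ## The network of a formula -/

namespace SatNet

/-- Weights of the first layer. -/
noncomputable def firstWeight (i j : ℕ) : ℝ :=
  if j = 0 then if i = 0 ∨ i = 2 then -1 else if i = 1 ∨ i = 3 then 1 else 0 else 0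

/-- Biases of the first layer. -/
noncomputable def firstBias (δ : ℝ) (i : ℕ) : ℝ :=
  if i = 0 ∨ i = 2 then δ else if i = 1 ∨ i = 3 then -(1 - δ) else 0

/-- Weights of the layers that iterate the trapezoid function. -/
noncomputable def curveWeight (δ : ℝ) (i j : ℕ) : ℝ :=
  if i = 0 ∨ i = 2 then if j < 2 then δ⁻¹ else 0
  else if i = 1 ∨ i = 3 then if j < 2 then -δ⁻¹ else 0
  else if i = 4 then if j < 4 then -δ⁻¹ else 0
  else if i = 5 then if j < 4 then δ⁻¹ else 0
  else if i = j + 2 then δ⁻¹ else 0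

/-- Biases of the layers that iterate the trapezoid function. -/
noncomputable def curveBias (δ : ℝ) (i : ℕ) : ℝ :=
  if i = 0 ∨ i = 2 then -(1 - δ) else if i = 1 ∨ i = 3 then δ
  else if i = 4 then 1 else if i = 5 then -1 else 0

open Classical in
/-- Weights of the layer that evaluates the clauses. -/
noncomputable def clauseWeight (lit : ℕ → ℕ → Prop) (c j : ℕ) : ℝ := if lit c j then -1 else 0

/-- The last three layers: clauses, conjunction, output. -/
noncomputable def clauseNet (W m : ℕ) (lit : ℕ → ℕ → Prop) : Network W 1 :=
  .cons (w := m) (Matrix.of fun c j => clauseWeight lit c j) (fun _ => 1) <|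
    .cons (w := 1) (Matrix.of fun _ _ => -1) (fun _ => 1) <|
      .last (Matrix.of fun _ _ => 1) fun _ => 0

/-- `P` layers that iterate the trapezoid function, followed by `Φ`. -/
noncomputable def curveNet (δ : ℝ) {W : ℕ} (Φ : Network W 1) : ℕ → Network W 1
  | 0 => Φ
  | P + 1 => .cons (Matrix.of fun i j : Fin W => curveWeight δ i j)
      (fun i => curveBias δ i) (curveNet δ Φ P)

/-- The network with `m` clauses; the literals of clause `c` are the neurons `j` with `lit c j`. -/
noncomputable def satNet (δ : ℝ) (d W P m : ℕ) (lit : ℕ → ℕ → Prop) : Network d 1 :=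
  .cons (Matrix.of fun (i : Fin W) (j : Fin d) => firstWeight i j) (fun i => firstBias δ i)
    (curveNet δ (clauseNet W m lit) P)

/-- The values of the neurons after the first layer and `ℓ` curve layers. -/
noncomputable def neuron (δ x : ℝ) : ℕ → ℕ → ℝ
  | 0, i => max 0 ((if i = 0 ∨ i = 2 then -x else if i = 1 ∨ i = 3 then x else 0) + firstBias δ i)
  | ℓ + 1, i => max 0 ((if i = 0 ∨ i = 2 then δ⁻¹ * (neuron δ x ℓ 0 + neuron δ x ℓ 1)
      else if i = 1 ∨ i = 3 then -δ⁻¹ * (neuron δ x ℓ 0 + neuron δ x ℓ 1)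
      else if i = 4 then
        -δ⁻¹ * (neuron δ x ℓ 0 + neuron δ x ℓ 1 + neuron δ x ℓ 2 + neuron δ x ℓ 3)
      else if i = 5 then
        δ⁻¹ * (neuron δ x ℓ 0 + neuron δ x ℓ 1 + neuron δ x ℓ 2 + neuron δ x ℓ 3)
      else δ⁻¹ * neuron δ x ℓ (i - 2)) + curveBias δ i)

theorem neuron_nonneg (δ x : ℝ) (ℓ i : ℕ) : 0 ≤ neuron δ x ℓ i := by
  cases ℓ <;> exact le_max_left _ _

theorem curveWeight_sum (δ : ℝ) {W : ℕ} (hW : 4 ≤ W) (Z : ℕ → ℝ) (i : Fin W) :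
    ∑ j : Fin W, curveWeight δ i j * Z j =
      if (i : ℕ) = 0 ∨ (i : ℕ) = 2 then δ⁻¹ * (Z 0 + Z 1)
      else if (i : ℕ) = 1 ∨ (i : ℕ) = 3 then -δ⁻¹ * (Z 0 + Z 1)
      else if (i : ℕ) = 4 then -δ⁻¹ * (Z 0 + Z 1 + Z 2 + Z 3)
      else if (i : ℕ) = 5 then δ⁻¹ * (Z 0 + Z 1 + Z 2 + Z 3)
      else δ⁻¹ * Z (i - 2) := by
  have hi := i.2
  rw [Fin.sum_univ_eq_sum_range (fun j => curveWeight δ i j * Z j)]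
  obtain ⟨V, rfl⟩ := Nat.exists_eq_add_of_le hW
  have two : ∀ c : ℝ, ∑ j ∈ Finset.range (4 + V), (if j < 2 then c else 0) * Z j =
      c * (Z 0 + Z 1) := fun c => by
    rw [Finset.sum_range_add, Finset.sum_eq_zero (s := Finset.range V) fun j _ => by
      rw [if_neg (by omega), zero_mul]]
    simp [Finset.sum_range_succ]; ring
  have four : ∀ c : ℝ, ∑ j ∈ Finset.range (4 + V), (if j < 4 then c else 0) * Z j =
      c * (Z 0 + Z 1 + Z 2 + Z 3) := fun c => by
    rw [Finset.sum_range_add, Finset.sum_eq_zero (s := Finset.range V) fun j _ => by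
      rw [if_neg (by omega), zero_mul]]
    simp [Finset.sum_range_succ]; ring
  simp only [curveWeight]
  split_ifs with h1 h2 h3 h4
  · exact two _
  · exact two _
  · exact four _
  · exact four _
  · rw [Finset.sum_eq_single ((i : ℕ) - 2)]
    · rw [if_pos (by omega)]
    · intro j _ hj
      rw [if_neg (by omega), zero_mul]
    · intro h
      exact absurd (Finset.mem_range.2 (by omega)) h

/-- All curve layers have the same weights, so the hidden state after any number of them follows the
width-independent recursion `neuron`. -/
theorem realize_curveNet (δ x : ℝ) {W : ℕ} (hW : 4 ≤ W) (Φ : Network W 1) (P ℓ : ℕ) :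
    (curveNet δ Φ P).realize (fun i => neuron δ x ℓ i) =
      Φ.realize fun i => neuron δ x (ℓ + P) i := by
  induction P generalizing ℓ with
  | zero => rfl
  | succ P ih =>
    rw [curveNet, Network.realize]
    have : (fun i : Fin W => max 0 (((Matrix.of fun i j : Fin W => curveWeight δ i j) *ᵥ
        (fun i : Fin W => neuron δ x ℓ i) + fun i : Fin W => curveBias δ i) i)) =
        fun i : Fin W => neuron δ x (ℓ + 1) i := by
      funext i
      rw [Pi.add_apply, Matrix.mulVec, dotProduct]
      simp only [Matrix.of_apply]
      rw [curveWeight_sum δ hW (neuron δ x ℓ), neuron]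
    rw [this, ih, show ℓ + 1 + P = ℓ + (P + 1) by omega]

/-- The function that the network realizes, as a function of the first coordinate. -/
noncomputable def profile (δ : ℝ) (W P m : ℕ) (lit : ℕ → ℕ → Prop) (x : ℝ) : ℝ :=
  max 0 (1 - ∑ c : Fin m, max 0 (1 + ∑ j : Fin W, clauseWeight lit c j * neuron δ x P j))

theorem realize_satNet (δ : ℝ) {d W : ℕ} (hd : 0 < d) (hW : 4 ≤ W) (P m : ℕ)
    (lit : ℕ → ℕ → Prop) (x : Fin d → ℝ) :
    (satNet δ d W P m lit).realize x 0 = profile δ W P m lit (x ⟨0, hd⟩) := by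
  have h0 : (fun i : Fin W => max 0 (((Matrix.of fun (i : Fin W) (j : Fin d) =>
      firstWeight i j) *ᵥ x + fun i : Fin W => firstBias δ i) i)) =
      fun i : Fin W => neuron δ (x ⟨0, hd⟩) 0 i := by
    funext i
    rw [Pi.add_apply, Matrix.mulVec, dotProduct, neuron]
    congr 2
    rw [Finset.sum_eq_single ⟨0, hd⟩]
    · simp only [Matrix.of_apply, firstWeight, if_true]
      split_ifs <;> ring
    · intro j _ hj
      have : (j : ℕ) ≠ 0 := fun h => hj (Fin.ext h)
      simp [firstWeight, this]
    · simp
  rw [satNet, Network.realize, h0, realize_curveNet δ _ hW, zero_add]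
  simp only [clauseNet, Network.realize, profile, Pi.add_apply, Matrix.mulVec, dotProduct,
    Matrix.of_apply, Finset.sum_neg_distrib, neg_mul, one_mul, add_zero, Finset.univ_unique,
    Finset.sum_singleton, sub_eq_neg_add, add_comm (1 : ℝ)]

theorem profile_mem_Icc (δ : ℝ) (W P m : ℕ) (lit : ℕ → ℕ → Prop) (x : ℝ) :
    profile δ W P m lit x ∈ Set.Icc (0 : ℝ) 1 := by
  refine ⟨le_max_left _ _, max_le zero_le_one ?_⟩
  have : 0 ≤ ∑ c : Fin m, max 0 (1 + ∑ j : Fin W, clauseWeight lit c j * neuron δ x P j) :=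
    Finset.sum_nonneg fun _ _ => le_max_left _ _
  linarith

/-- Neurons 0 and 1 are the two ReLU terms of s at the current iterate, so s(y) = 1 - δ⁻¹(n₀ + n₁),
and δ - s(y) and s(y) - (1 - δ) are affine in them with coefficients from `curveWeights δ`. Neurons
2 and 3 are copies; they provide the coefficient 2δ⁻¹ in 2s(y) - 1 without a new weight. -/
theorem neuron_gate (δ x : ℝ) (ℓ : ℕ) :
    (neuron δ x ℓ 0 = max 0 (δ - (trapezoid δ)^[ℓ] x) ∧
      neuron δ x ℓ 1 = max 0 ((trapezoid δ)^[ℓ] x - (1 - δ))) ∧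
    neuron δ x ℓ 2 = neuron δ x ℓ 0 ∧ neuron δ x ℓ 3 = neuron δ x ℓ 1 := by
  refine ⟨?_, by cases ℓ <;> rfl, by cases ℓ <;> rfl⟩
  induction ℓ with
  | zero =>
    constructor
    · simp [neuron, firstBias, sub_eq_neg_add]
    · simp [neuron, firstBias, sub_eq_add_neg]
  | succ ℓ ih =>
    rw [Function.iterate_succ_apply']
    constructor
    · simp only [neuron, curveBias, true_or, if_true, ih.1, ih.2, trapezoid]
      congr 1; ring
    · simp only [neuron, curveBias, true_or, if_true, ih.1, ih.2, trapezoid, one_ne_zero,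
        OfNat.one_ne_ofNat, or_self, if_false]
      congr 1; ring

/-- The neurons from 4 on form a shift register: each layer puts the literals of the new iterate
into 4 and 5 and moves older pairs up by two places, multiplied by δ⁻¹. Being nonnegative, they pass
the ReLU unchanged. -/
theorem neuron_literal {δ : ℝ} (h0 : 0 < δ) (x : ℝ) (ℓ a : ℕ) :
    neuron δ x (ℓ + 1 + a) (4 + 2 * a) =
        δ⁻¹ ^ a * max 0 (2 * (trapezoid δ)^[ℓ + 1] x - 1) ∧
      neuron δ x (ℓ + 1 + a) (5 + 2 * a) =
        δ⁻¹ ^ a * max 0 (1 - 2 * (trapezoid δ)^[ℓ + 1] x) := by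
  have hinv : 0 ≤ δ⁻¹ := inv_nonneg.2 h0.le
  induction a with
  | zero =>
    obtain ⟨⟨g0, g1⟩, g2, g3⟩ := neuron_gate δ x ℓ
    rw [Function.iterate_succ_apply']
    constructor
    · simp [neuron, curveBias, g2, g3, g0, g1, trapezoid]
      congr 1; ring
    · simp [neuron, curveBias, g2, g3, g0, g1, trapezoid]
      congr 1; ring
  | succ a ih =>
    have step : ∀ i, 4 ≤ i → neuron δ x (ℓ + 1 + (a + 1)) (i + 2) =
        δ⁻¹ * neuron δ x (ℓ + 1 + a) i := by
      intro i hi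
      rw [show ℓ + 1 + (a + 1) = ℓ + 1 + a + 1 by omega, neuron, curveBias]
      have e0 : i + 2 ≠ 0 := by omega
      have e1 : i + 2 ≠ 1 := by omega
      have e2 : i + 2 ≠ 2 := by omega
      have e3 : i + 2 ≠ 3 := by omega
      have e4 : i + 2 ≠ 4 := by omega
      have e5 : i + 2 ≠ 5 := by omega
      simp only [e0, e1, e2, e3, e4, e5, or_self, if_false, Nat.add_sub_cancel, add_zero]
      exact max_eq_right (mul_nonneg hinv (neuron_nonneg _ _ _ _))
    constructor
    · rw [show 4 + 2 * (a + 1) = 4 + 2 * a + 2 by omega, step _ (by omega), ih.1]; ring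
    · rw [show 5 + 2 * (a + 1) = 5 + 2 * a + 2 by omega, step _ (by omega), ih.2]; ring

/-- The neuron that holds a literal of the variable `v`. -/
def litNeuron (e₀ v : ℕ) (b : Bool) : ℕ := 2 * v + (if b then 0 else 1) + 2 + 2 * e₀

/-- Variable v is read off the iterate N + 1 - v, which in layer N + e₀ has been shifted v - 1 + e₀
times. Reversing the order makes the position the literal code plus the constant 2 + 2e₀, whatever N
is. -/
theorem neuron_litNeuron {δ : ℝ} (h0 : 0 < δ) (x : ℝ) {N e₀ v : ℕ} (hv1 : 1 ≤ v) (hvN : v ≤ N)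
    (b : Bool) : neuron δ x (N + e₀) (litNeuron e₀ v b) = δ⁻¹ ^ (v - 1 + e₀) *
      max 0 (if b then 2 * (trapezoid δ)^[N + 1 - v] x - 1
        else 1 - 2 * (trapezoid δ)^[N + 1 - v] x) := by
  have h := neuron_literal h0 x (N - v) (v - 1 + e₀)
  rw [show N - v + 1 + (v - 1 + e₀) = N + e₀ by omega, show N - v + 1 = N + 1 - v by omega] at h
  cases b
  · rw [show litNeuron e₀ v false = 5 + 2 * (v - 1 + e₀) by simp [litNeuron]; omega]
    simpa using h.2
  · rw [show litNeuron e₀ v true = 4 + 2 * (v - 1 + e₀) by simp [litNeuron]; omega]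
    simpa using h.1

variable {δ : ℝ} {W N e₀ m : ℕ} {lit : ℕ → ℕ → Prop}

/-- The truth value of a neuron's literal under an assignment. -/
def LitTrue (e₀ N : ℕ) (z : ℕ → Bool) (j : ℕ) : Prop :=
  ∃ v b, 1 ≤ v ∧ v ≤ N ∧ j = litNeuron e₀ v b ∧ z v = b

/-- Every input x induces an assignment by rounding the iterates at 1/2. It violates some clause;
all literal neurons of this clause are exactly 0, so the clause value is 1 and already cancels the
bias of the conjunction. -/
theorem profile_eq_zero (h0 : 0 < δ)
    (hlit : ∀ c < m, ∀ j, lit c j → ∃ v b, 1 ≤ v ∧ v ≤ N ∧ j = litNeuron e₀ v b)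
    (hun : ∀ z : ℕ → Bool, ∃ c < m, ∀ j, lit c j → ¬ LitTrue e₀ N z j) (x : ℝ) :
    profile δ W (N + e₀) m lit x = 0 := by
  obtain ⟨c, hc, hcj⟩ := hun fun v => decide (1 / 2 < (trapezoid δ)^[N + 1 - v] x)
  refine max_eq_left ?_
  have h1 : (1 : ℝ) ≤ max 0 (1 + ∑ j : Fin W,
      clauseWeight lit ((⟨c, hc⟩ : Fin m) : ℕ) j * neuron δ x (N + e₀) j) := by
    refine le_max_of_le_right ?_
    rw [Finset.sum_eq_zero, add_zero]
    intro j _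
    rw [clauseWeight]
    split_ifs with hj
    · obtain ⟨v, b, hv1, hvN, he⟩ := hlit c hc j hj
      have hfalse := hcj j hj
      rw [he, neuron_litNeuron h0 x hv1 hvN]
      rw [max_eq_left, mul_zero, mul_zero]
      have hzb : ¬ (decide (1 / 2 < (trapezoid δ)^[N + 1 - v] x) = b) :=
        fun h => hfalse ⟨v, b, hv1, hvN, he, h⟩
      cases b
      · simp only [decide_eq_false_iff_not, not_not] at hzb
        simp only [Bool.false_eq_true, if_false]
        linarith
      · simp only [decide_eq_true_eq, not_lt] at hzb
        simp only [if_true]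
        linarith
    · rw [zero_mul]
  have h2 := Finset.single_le_sum (f := fun c : Fin m => max 0 (1 + ∑ j : Fin W,
      clauseWeight lit c j * neuron δ x (N + e₀) j)) (fun _ _ => le_max_left _ _)
      (Finset.mem_univ ⟨c, hc⟩)
  linarith

/-- A true literal has value at least 1 - 2δ when it enters the shift register, and at least e₀
amplifications raise it to 1. One such literal suppresses its clause neuron, since the other
literals only lower the sum further. -/
theorem profile_eq_one (h0 : 0 < δ) (h1 : δ < 1 / 2) (he : 1 ≤ δ⁻¹ ^ e₀ * (1 - 2 * δ))
    {z : ℕ → Bool} (hz : ∀ c < m, ∃ j < W, lit c j ∧ LitTrue e₀ N z j) {x : ℝ}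
    (hx : ∀ v, 1 ≤ v → v ≤ N → Near δ (z v) ((trapezoid δ)^[N + 1 - v] x)) :
    profile δ W (N + e₀) m lit x = 1 := by
  rw [profile, Finset.sum_eq_zero, sub_zero, max_eq_right zero_le_one]
  intro c _
  refine max_eq_left ?_
  obtain ⟨j, hjW, hj, v, b, hv1, hvN, rfl, hzv⟩ := hz c c.2
  have key : 1 ≤ neuron δ x (N + e₀) (litNeuron e₀ v b) := by
    rw [neuron_litNeuron h0 x hv1 hvN]
    have hn := hx v hv1 hvN
    rw [hzv] at hn
    have hm : 1 - 2 * δ ≤ max 0 (if b then 2 * (trapezoid δ)^[N + 1 - v] x - 1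
        else 1 - 2 * (trapezoid δ)^[N + 1 - v] x) := by
      refine le_max_of_le_right ?_
      cases b <;> simp [Near] at hn ⊢ <;> linarith
    have hpow : δ⁻¹ ^ e₀ ≤ δ⁻¹ ^ (v - 1 + e₀) :=
      pow_le_pow_right₀ ((one_le_inv₀ h0).2 (by linarith)) (by omega)
    calc (1 : ℝ) ≤ δ⁻¹ ^ e₀ * (1 - 2 * δ) := he
      _ ≤ _ := mul_le_mul hpow hm (by linarith) (by positivity)
  have hle : ∀ j ∈ (Finset.univ : Finset (Fin W)),
      0 ≤ -(clauseWeight lit c j * neuron δ x (N + e₀) j) := by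
    intro j _
    have := neuron_nonneg δ x (N + e₀) j
    rw [clauseWeight]
    split_ifs <;> linarith
  have hs := Finset.single_le_sum hle (Finset.mem_univ ⟨litNeuron e₀ v b, hjW⟩)
  rw [Finset.sum_neg_distrib] at hs
  simp only [clauseWeight, hj, if_true] at hs ⊢
  linarith

end SatNet

/-! ### Integrals, parameters and class membership of the network -/

theorem Network.continuous_realize {d m : ℕ} (Φ : Network d m) : Continuous Φ.realize := by
  induction Φ with
  | last W b =>
    simp only [Network.realize]
    exact (Continuous.matrix_mulVec continuous_const continuous_id).add continuous_const
  | cons W b Φ ih =>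
    simp only [Network.realize]
    refine ih.comp (continuous_pi fun i => continuous_const.max ?_)
    exact (continuous_apply i).comp
      ((Continuous.matrix_mulVec continuous_const continuous_id).add continuous_const)

/-- A nonnegative function that equals one on a slab has at least the integral of the slab. -/
theorem le_integral_of_slab {d : ℕ} (i₀ : Fin d) {F : (Fin d → ℝ) → ℝ} (hF : Continuous F)
    (hF0 : ∀ x, 0 ≤ F x) {a b : ℝ} (ha : 0 ≤ a) (hab : a ≤ b) (hb : b ≤ 1)
    (h1 : ∀ x, x i₀ ∈ Set.Icc a b → F x = 1) :
    b - a ≤ ∫ x in Set.Icc (0 : Fin d → ℝ) 1, F x := by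
  set l : Fin d → ℝ := Function.update 0 i₀ a with hl
  set u : Fin d → ℝ := Function.update 1 i₀ b with hu
  have hlu : l ≤ u := by
    intro i
    by_cases hi : i = i₀
    · subst hi; simpa [hl, hu] using hab
    · simp [hl, hu, hi]
  have hsub : Set.Icc l u ⊆ Set.Icc (0 : Fin d → ℝ) 1 := by
    refine Set.Icc_subset_Icc (fun i => ?_) fun i => ?_
    · by_cases hi : i = i₀
      · subst hi; simpa [hl] using ha
      · simp [hl, hi]
    · by_cases hi : i = i₀
      · subst hi; simpa [hu] using hb
      · simp [hu, hi]
  have hvol : (volume (Set.Icc l u)).toReal = b - a := by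
    rw [Real.volume_Icc_pi_toReal hlu, Finset.prod_eq_single i₀]
    · simp [hl, hu]
    · intro i _ hi; simp [hl, hu, hi]
    · simp
  have hint : IntegrableOn F (Set.Icc (0 : Fin d → ℝ) 1) :=
    hF.continuousOn.integrableOn_compact isCompact_Icc
  calc b - a = ∫ x in Set.Icc l u, (1 : ℝ) := by simp [Measure.real, hvol]
    _ = ∫ x in Set.Icc l u, F x := by
      refine setIntegral_congr_fun measurableSet_Icc fun x hx => (h1 x ?_).symm
      have hx1 := hx.1 i₀
      have hx2 := hx.2 i₀
      simp only [hl, hu, Function.update_self] at hx1 hx2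
      exact ⟨hx1, hx2⟩
    _ ≤ _ := setIntegral_mono_set hint (Filter.Eventually.of_forall hF0) hsub.eventuallyLE

namespace SatNet

variable {δ : ℝ} {d W N e₀ m : ℕ} {lit : ℕ → ℕ → Prop}

theorem integral_satNet_eq_zero (hd : 0 < d) (hW : 4 ≤ W) (h0 : 0 < δ)
    (hlit : ∀ c < m, ∀ j, lit c j → ∃ v b, 1 ≤ v ∧ v ≤ N ∧ j = litNeuron e₀ v b)
    (hun : ∀ z : ℕ → Bool, ∃ c < m, ∀ j, lit c j → ¬ LitTrue e₀ N z j) :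
    ∫ x in Set.Icc (0 : Fin d → ℝ) 1, (satNet δ d W (N + e₀) m lit).realize x 0 = 0 := by
  simp [realize_satNet δ hd hW, profile_eq_zero h0 hlit hun]

theorem le_integral_satNet (hd : 0 < d) (hW : 4 ≤ W) (h0 : 0 < δ) (h1 : δ < 1 / 2)
    (he : 1 ≤ δ⁻¹ ^ e₀ * (1 - 2 * δ))
    {z : ℕ → Bool} (hz : ∀ c < m, ∃ j < W, lit c j ∧ LitTrue e₀ N z j) :
    δ ^ (N + 1) ≤
      ∫ x in Set.Icc (0 : Fin d → ℝ) 1, (satNet δ d W (N + e₀) m lit).realize x 0 := by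
  -- The iterates 1, …, N carry the variables N, …, 1. Iterate 0 is x itself, which never enters the
  -- shift register; its prescribed value is arbitrary and costs the additional factor δ.
  obtain ⟨a, ha0, ha1, ha⟩ := exists_interval h0 h1 (N + 1) fun i => z (N + 1 - i)
  have := le_integral_of_slab (⟨0, hd⟩ : Fin d) (a := a) (b := a + δ ^ (N + 1))
    (F := fun x => (satNet δ d W (N + e₀) m lit).realize x 0)
    ((continuous_apply 0).comp
      (Network.continuous_realize (satNet δ d W (N + e₀) m lit))) ?_ ha0
    (by linarith [pow_pos h0 (N + 1)]) ha1 ?_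
  · linarith
  · intro x
    rw [realize_satNet δ hd hW]
    exact (profile_mem_Icc ..).1
  · intro x hx
    simp only [realize_satNet δ hd hW]
    refine profile_eq_one h0 h1 he hz fun v hv1 hvN => ?_
    have := ha _ hx (N + 1 - v) (by omega)
    rwa [show N + 1 - (N + 1 - v) = v by omega] at this

/-- The parameters of a layer with `r` rows, `c` columns, weights `w` and biases `b`. -/
def layerParams {α : Type*} (r c : ℕ) (w : ℕ → ℕ → α) (b : ℕ → α) : List α :=
  ((List.range r).flatMap fun i => (List.range c).map fun j => w i j) ++ (List.range r).map b

theorem layerParams_finRange {α : Type*} (r c : ℕ) (w : ℕ → ℕ → α) (b : ℕ → α) :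
    (((List.finRange r).flatMap fun i : Fin r => (List.finRange c).map fun j : Fin c => w i j) ++
      (List.finRange r).map fun i : Fin r => b i) = layerParams r c w b := by
  simp only [layerParams, ← List.map_coe_finRange_eq_range, List.map_map, List.flatMap_map]
  rfl

theorem map_layerParams {α β : Type*} (f : α → β) (r c : ℕ) (w : ℕ → ℕ → α) (b : ℕ → α) :
    (layerParams r c w b).map f = layerParams r c (fun i j => f (w i j)) fun i => f (b i) := by
  simp [layerParams, List.map_flatMap, Function.comp_def]

theorem widths_curveNet (Φ : Network W 1) (P : ℕ) :
    (curveNet δ Φ P).widths = List.replicate P W ++ Φ.widths := by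
  induction P with
  | zero => rfl
  | succ P ih => rw [curveNet, Network.widths, ih]; rfl

theorem depth_curveNet (Φ : Network W 1) (P : ℕ) :
    (curveNet δ Φ P).depth = P + Φ.depth := by
  induction P with
  | zero => simp [curveNet]
  | succ P ih => rw [curveNet, Network.depth, ih]; omega

theorem params_curveNet (Φ : Network W 1) (P : ℕ) :
    (curveNet δ Φ P).params =
      ((List.range P).flatMap fun _ => layerParams W W (curveWeight δ) (curveBias δ)) ++
        Φ.params := by
  induction P with
  | zero => rfl
  | succ P ih =>
    rw [curveNet, Network.params, ih, List.range_succ_eq_map, List.flatMap_cons,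
      List.flatMap_map, List.append_assoc]
    rw [← layerParams_finRange W W (curveWeight δ) (curveBias δ), List.append_assoc]
    simp only [Matrix.of_apply, List.append_assoc]

theorem depth_satNet (P : ℕ) : (satNet δ d W P m lit).depth = P + 4 := by
  rw [satNet, Network.depth, depth_curveNet]
  rfl

theorem widths_satNet (P : ℕ) :
    (satNet δ d W P m lit).widths = d :: (List.replicate (P + 1) W ++ [m, 1, 1]) := by
  rw [satNet, Network.widths, widths_curveNet, List.replicate_succ']
  simp [clauseNet, Network.widths]

theorem params_satNet (P : ℕ) :
    (satNet δ d W P m lit).params = layerParams W d firstWeight (firstBias δ) ++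
      (((List.range P).flatMap fun _ => layerParams W W (curveWeight δ) (curveBias δ)) ++
        (layerParams m W (clauseWeight lit) (fun _ => 1) ++
          (layerParams 1 m (fun _ _ => -1) (fun _ => 1) ++
            layerParams 1 1 (fun _ _ => 1) fun _ => 0))) := by
  rw [satNet, Network.params, params_curveNet]
  congr 1
  · exact layerParams_finRange W d firstWeight (firstBias δ)
  congr 1
  simp only [clauseNet, Network.params, Matrix.of_apply, List.append_assoc]
  rw [← layerParams_finRange m W, ← layerParams_finRange 1 m, ← layerParams_finRange 1 1]
  simp

theorem mem_layerParams {α : Type*} {r c : ℕ} {w : ℕ → ℕ → α} {b : ℕ → α} {S : Set α}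
    (hw : ∀ i j, w i j ∈ S) (hb : ∀ i, b i ∈ S) : ∀ a ∈ layerParams r c w b, a ∈ S := by
  intro a ha
  rcases List.mem_append.1 ha with h | h
  · obtain ⟨i, _, h⟩ := List.mem_flatMap.1 h
    obtain ⟨j, _, rfl⟩ := List.mem_map.1 h
    exact hw i j
  · obtain ⟨i, _, rfl⟩ := List.mem_map.1 h
    exact hb i

theorem params_satNet_mem (P : ℕ) : ∀ a ∈ (satNet δ d W P m lit).params, a ∈ curveWeights δ := by
  have e : ∀ x : ℝ, x ∈ curveWeights δ ↔
      x = -1 ∨ x = 0 ∨ x = 1 ∨ x = -δ⁻¹ ∨ x = δ⁻¹ ∨ x = δ ∨ x = -(1 - δ) := by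
    intro x; simp [curveWeights]
  have key : ∀ {r c : ℕ} {w : ℕ → ℕ → ℝ} {b : ℕ → ℝ},
      (∀ i j, w i j ∈ curveWeights δ) → (∀ i, b i ∈ curveWeights δ) →
      ∀ a ∈ layerParams r c w b, a ∈ curveWeights δ :=
    fun hw hb => mem_layerParams (S := {x | x ∈ curveWeights δ}) hw hb
  intro a ha
  rw [params_satNet] at ha
  simp only [List.mem_append, List.mem_flatMap] at ha
  rcases ha with h | ⟨_, _, h⟩ | h | h | h
  · refine key ?_ ?_ a h
    · intro i j; rw [e, firstWeight]; split_ifs <;> simp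
    · intro i; rw [e, firstBias]; split_ifs <;> simp
  · refine key ?_ ?_ a h
    · intro i j; rw [e, curveWeight]; split_ifs <;> simp
    · intro i; rw [e, curveBias]; split_ifs <;> simp
  · refine key ?_ ?_ a h
    · intro i j; rw [e, clauseWeight]; split_ifs <;> simp
    · intro i; rw [e]; simp
  · refine key ?_ ?_ a h
    · intro i j; rw [e]; simp
    · intro i; rw [e]; simp
  · refine key ?_ ?_ a h
    · intro i j; rw [e]; simp
    · intro i; rw [e]; simp

/-- The hidden layers are padded to the full width allowed in K(n). This excludes the network from
K(n - 1), so that the accuracy δ^n/2 is guaranteed for exactly this n; d < n makes the width bound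
of K(n - 1) strictly smaller. -/
theorem satNet_mem_inputClass {k C wr Lr n P : ℕ} {θ : Finset ℝ} (hθ : curveWeights δ ⊆ θ)
    (hd : 0 < d) (hdn : d < n) (hW : W = max 2 (C * wr * k) * n) (hW4 : 4 ≤ W) (hm : 1 ≤ m)
    (hmW : m ≤ W) (hP : P + 4 ≤ 3 * Lr + (n - d) - 1) :
    satNet δ d W P m lit ∈
      inputClass d k C wr Lr θ n \ inputClass d k C wr Lr θ (n - 1) := by
  have hpos : 0 < max 2 (C * wr * k) := by positivity
  have hmax : max n d = n := max_eq_left hdn.le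
  have hnW : n ≤ W := by rw [hW]; exact Nat.le_mul_of_pos_left n hpos
  refine ⟨⟨⟨?_, ?_, ?_⟩, ?_⟩, ?_⟩
  · rw [depth_satNet, hmax]; exact hP
  · rw [widths_satNet, hmax, ← hW]
    intro v hv
    simp only [List.mem_cons, List.mem_append, List.mem_replicate, List.not_mem_nil,
      or_false] at hv
    omega
  · exact fun a ha => hθ (params_satNet_mem P a ha)
  · intro x
    rw [realize_satNet δ hd hW4]
    exact profile_mem_Icc ..
  · rintro ⟨⟨-, h, -⟩, -⟩
    have := (h W (by rw [widths_satNet]; simp)).2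
    rw [hW, show max (n - 1) d = n - 1 by omega] at this
    have := Nat.le_of_mul_le_mul_left this hpos
    omega

end SatNet

theorem inputClass_mono {d k C wr Lr : ℕ} {θ : Finset ℝ} :
    Monotone (inputClass d k C wr Lr θ) := by
  rintro a b hab Φ ⟨⟨h1, h2, h3⟩, h4⟩
  have h : max a d ≤ max b d := max_le_max_right d hab
  exact ⟨⟨h1.trans (by omega), fun v hv => ⟨(h2 v hv).1, (h2 v hv).2.trans
    (Nat.mul_le_mul_left _ h)⟩, h3⟩, h4⟩

/-! ## Reading formulas from lists -/

/-- The number of end marks before position `i`: the number of the clause of this position. -/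
def clauseNo (X : ℕ → ℕ) (i : ℕ) : ℕ := ∑ a ∈ Finset.range i, if X a = 0 then 1 else 0

/-- The number of occurrences of the literal code `l` in clause number `c`. -/
def occ (X : ℕ → ℕ) (L l c : ℕ) : ℕ :=
  ∑ i ∈ Finset.range L, if X i = l ∧ clauseNo X i = c then 1 else 0

/-- The number of literals of clause number `c`. -/
def clauseLen (X : ℕ → ℕ) (L c : ℕ) : ℕ :=
  ∑ i ∈ Finset.range L, if X i ≠ 0 ∧ clauseNo X i = c then 1 else 0

/-- The array `X` of length `L` lists a formula with at most `k` literals per clause. -/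
structure Valid (k : ℕ) (X : ℕ → ℕ) (L : ℕ) : Prop where
  pos : clauseNo X L ≠ 0
  last : X (L - 1) = 0
  ne_one : ∀ i < L, X i ≠ 1
  len : ∀ c < clauseNo X L, clauseLen X L c ≠ 0 ∧ clauseLen X L c ≤ k
  nodup : ∀ i < L, X i ≠ 0 → occ X L (X i) (clauseNo X i) ≤ 1
  diff : ∀ a < clauseNo X L, ∀ b < a, ∃ i < L, X i ≠ 0 ∧
    ((clauseNo X i = a ∧ occ X L (X i) b = 0) ∨ (clauseNo X i = b ∧ occ X L (X i) a = 0))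

/-- The list of the literal codes of clause number `c`. -/
def clauseAt : List ℕ → ℕ → List ℕ
  | [], _ => []
  | 0 :: _, 0 => []
  | 0 :: x, c + 1 => clauseAt x c
  | (a + 1) :: x, 0 => (a + 1) :: clauseAt x 0
  | (_ + 1) :: x, c + 1 => clauseAt x (c + 1)

theorem clauseNo_zero (X : ℕ → ℕ) : clauseNo X 0 = 0 := rfl

theorem clauseNo_cons (a : ℕ) (x : List ℕ) (i : ℕ) :
    clauseNo (fun i => (a :: x).getD i 0) (i + 1) =
      clauseNo (fun i => x.getD i 0) i + if a = 0 then 1 else 0 := by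
  rw [clauseNo, Finset.sum_range_succ']
  simp only [List.getD_cons_succ, List.getD_cons_zero, clauseNo]

/-- Prepending an entry raises all clause numbers by one if it is an end mark and leaves them alone
otherwise, which is the recursion of `clauseAt`. Lengths, multiplicities and membership are all
special cases. -/
theorem countP_clauseAt (p : ℕ → Bool) (x : List ℕ) (c : ℕ) :
    ∑ i ∈ Finset.range x.length, (if x.getD i 0 ≠ 0 ∧ p (x.getD i 0) = true ∧
      clauseNo (fun i => x.getD i 0) i = c then 1 else 0) = (clauseAt x c).countP p := by
  induction x generalizing c with
  | nil => simp [clauseAt]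
  | cons a x ih =>
    rw [List.length_cons, Finset.sum_range_succ']
    simp only [List.getD_cons_succ, List.getD_cons_zero, clauseNo_cons, clauseNo_zero]
    rcases a with _ | a <;> rcases c with _ | c
    · simp [clauseAt]
    · simpa [clauseAt] using ih c
    · simpa [clauseAt, List.countP_cons] using ih 0
    · simpa [clauseAt] using ih (c + 1)

theorem clauseLen_eq (x : List ℕ) (c : ℕ) :
    clauseLen (fun i => x.getD i 0) x.length c = (clauseAt x c).length := by
  have := countP_clauseAt (fun _ => true) x c
  simpa [clauseLen] using this

theorem occ_eq (x : List ℕ) {l : ℕ} (hl : l ≠ 0) (c : ℕ) :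
    occ (fun i => x.getD i 0) x.length l c = (clauseAt x c).count l := by
  rw [List.count, ← countP_clauseAt, occ]
  refine Finset.sum_congr rfl fun i _ => ?_
  congr 1
  simp only [beq_iff_eq, eq_iff_iff]
  constructor
  · rintro ⟨rfl, h⟩; exact ⟨hl, rfl, h⟩
  · rintro ⟨_, h, h'⟩; exact ⟨h, h'⟩

theorem mem_clauseAt {x : List ℕ} {l c : ℕ} :
    l ∈ clauseAt x c ↔ ∃ i < x.length, x.getD i 0 ≠ 0 ∧ x.getD i 0 = l ∧
      clauseNo (fun i => x.getD i 0) i = c := by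
  have h := countP_clauseAt (fun a => a == l) x c
  rw [← List.count_pos_iff, List.count, ← h, Finset.sum_pos_iff]
  simp only [Finset.mem_range, beq_iff_eq]
  refine exists_congr fun i => and_congr_right fun _ => ?_
  split_ifs with hc
  · exact ⟨fun _ => hc, fun _ => one_pos⟩
  · exact ⟨fun h => absurd h (lt_irrefl 0), fun h => absurd h hc⟩

/-- The final end mark is needed: literals after the last end mark would belong to no counted
clause. -/
theorem flatMap_clauseAt {x : List ℕ} (hx : x ≠ []) (hlast : x.getD (x.length - 1) 0 = 0) :
    x = (List.range (clauseNo (fun i => x.getD i 0) x.length)).flatMap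
      fun c => clauseAt x c ++ [0] := by
  induction x with
  | nil => exact absurd rfl hx
  | cons a x ih =>
    rw [List.length_cons, clauseNo_cons]
    rcases eq_or_ne x [] with rfl | hx'
    · have ha : a = 0 := by simpa using hlast
      subst ha
      simp [clauseNo, clauseAt]
    · have hlen : 0 < x.length := List.length_pos_iff.2 hx'
      have hl : x.getD (x.length - 1) 0 = 0 := by
        rw [List.length_cons, Nat.add_sub_cancel] at hlast
        obtain ⟨n, hn⟩ : ∃ n, x.length = n + 1 := ⟨x.length - 1, by omega⟩
        rw [hn, List.getD_cons_succ] at hlast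
        rwa [hn, Nat.add_sub_cancel]
      have h := ih hx' hl
      rcases a with _ | a
      · simp only [if_true]
        rw [List.range_succ_eq_map, List.flatMap_cons, List.flatMap_map]
        simpa [clauseAt] using h
      · simp only [Nat.add_eq_zero_iff, one_ne_zero, and_false, if_false, add_zero]
        obtain ⟨n, hn⟩ : ∃ n, clauseNo (fun i => x.getD i 0) x.length = n + 1 := by
          refine ⟨clauseNo (fun i => x.getD i 0) x.length - 1, ?_⟩
          have : 0 < clauseNo (fun i => x.getD i 0) x.length := by
            refine Finset.sum_pos_iff.2 ⟨x.length - 1, by simp; omega, ?_⟩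
            simp only [hl, if_true]; exact one_pos
          omega
        rw [hn, List.range_succ_eq_map, List.flatMap_cons, List.flatMap_map] at h ⊢
        simp only [clauseAt]
        rw [List.cons_append, List.cons_append, ← h]

theorem clauseAt_append {l : List ℕ} (hl : ∀ a ∈ l, a ≠ 0) (y : List ℕ) (c : ℕ) :
    clauseAt (l ++ 0 :: y) c = if c = 0 then l else clauseAt y (c - 1) := by
  induction l with
  | nil => cases c <;> simp [clauseAt]
  | cons a l ih =>
    have ih := ih fun b hb => hl b (List.mem_cons_of_mem _ hb)
    obtain ⟨a, rfl⟩ := Nat.exists_eq_succ_of_ne_zero (hl a List.mem_cons_self)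
    rcases c with _ | c
    · simpa [clauseAt] using ih
    · simpa [clauseAt] using ih

theorem clauseAt_flatMap {ls : List (List ℕ)} (h : ∀ l ∈ ls, ∀ a ∈ l, a ≠ 0) (c : ℕ) :
    clauseAt (ls.flatMap fun l => l ++ [0]) c = ls.getD c [] := by
  induction ls generalizing c with
  | nil => simp [clauseAt]
  | cons l ls ih =>
    rw [List.flatMap_cons, List.append_assoc, List.singleton_append,
      clauseAt_append (h l List.mem_cons_self), ih fun l hl => h l (List.mem_cons_of_mem _ hl)]
    cases c <;> simp

theorem clauseNo_eq_count (x : List ℕ) :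
    clauseNo (fun i => x.getD i 0) x.length = x.count 0 := by
  induction x with
  | nil => rfl
  | cons a x ih =>
    rw [List.length_cons, clauseNo_cons, ih, List.count_cons]
    simp

theorem count_zero_flatMap {ls : List (List ℕ)} (h : ∀ l ∈ ls, ∀ a ∈ l, a ≠ 0) :
    (ls.flatMap fun l => l ++ [0]).count 0 = ls.length := by
  induction ls with
  | nil => rfl
  | cons l ls ih =>
    have : l.count 0 = 0 := List.count_eq_zero.2 fun h0 => h l List.mem_cons_self 0 h0 rfl
    rw [List.flatMap_cons, List.count_append, List.count_append, this,
      ih fun l hl => h l (List.mem_cons_of_mem _ hl)]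
    simp; omega

/-! ### Literal codes; presented formulas and valid lists -/

/-- The literal with a given code. -/
def decodeLit (l : ℕ) : Literal := (l / 2, l % 2 == 0)

theorem decodeLit_code (l : Literal) : decodeLit l.code = l := by
  obtain ⟨i, _ | _⟩ := l
  · simp [decodeLit, Literal.code]; omega
  · simp [decodeLit, Literal.code]

theorem code_decodeLit (l : ℕ) : (decodeLit l).code = l := by
  simp only [decodeLit, Literal.code, beq_iff_eq]
  split_ifs <;> omega

theorem code_injective : Function.Injective Literal.code :=
  Function.LeftInverse.injective decodeLit_code

/-- The facts about a presented formula that the reduction uses. -/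
structure Reads (x : List ℕ) (α : CNF) (k n : ℕ) : Prop where
  card : clauseNo (fun i => x.getD i 0) x.length = α.card
  pos : 0 < α.card
  lit_le : ∀ c, ∀ l ∈ clauseAt x c, 2 ≤ l ∧ l ≤ 2 * n + 1
  entry_le : ∀ i, x.getD i 0 ≤ 2 * n + 1
  length_le : x.length ≤ α.card * (k + 1)
  sat : α.Satisfiable ↔ ∃ z : ℕ → Bool, ∀ c < α.card, ∃ l ∈ clauseAt x c,
    z (decodeLit l).1 = (decodeLit l).2
  valid : Valid k (fun i => x.getD i 0) x.length

theorem length_flatMap_le {α β : Type*} (ls : List α) (f : α → List β) (K : ℕ)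
    (h : ∀ l ∈ ls, (f l).length ≤ K) : (ls.flatMap f).length ≤ ls.length * K := by
  induction ls with
  | nil => simp
  | cons l ls ih =>
    rw [List.flatMap_cons, List.length_append, List.length_cons, Nat.succ_mul]
    have := h l List.mem_cons_self
    have := ih fun l hl => h l (List.mem_cons_of_mem _ hl)
    omega

/-- Literal codes are at least 2, so 0 occurs only as an end mark and cutting at the zeros recovers
the clause lists. Everything else is read off from this. -/
theorem Presents.reads {x : List ℕ} {α : CNF} {k n : ℕ} (hα : α ∈ kCNF k n)
    (hx : Presents x α) : Reads x α k n := by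
  obtain ⟨cs, hnd, hdist, hcs, rfl⟩ := hx
  have hmem : ∀ c ∈ cs, c.toFinset ∈ α := fun c hc => by
    rw [← hcs]; simpa using ⟨c, hc, rfl⟩
  have hcode : ∀ c ∈ cs, ∀ l ∈ c, 2 ≤ l.code ∧ l.code ≤ 2 * n + 1 := fun c hc l hl => by
    have := (hα.2 _ (hmem c hc)).2.2 l (by simpa using hl)
    simp only [Literal.code]
    split_ifs <;> omega
  have hflat : (cs.flatMap fun c => c.map Literal.code ++ [0]) =
      (cs.map (List.map Literal.code)).flatMap fun l => l ++ [0] := by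
    rw [List.flatMap_map]
  have hne : ∀ l ∈ cs.map (List.map Literal.code), ∀ a ∈ l, a ≠ 0 := by
    intro l hl a ha
    obtain ⟨c, hc, rfl⟩ := List.mem_map.1 hl
    obtain ⟨b, hb, rfl⟩ := List.mem_map.1 ha
    have := hcode c hc b hb
    omega
  set x := cs.flatMap fun c => c.map Literal.code ++ [0] with hx
  have hat : ∀ c (hc : c < cs.length), clauseAt x c = (cs[c]).map Literal.code := by
    intro c hc
    rw [hflat, clauseAt_flatMap hne]
    simp [hc]
  have hat' : ∀ c, cs.length ≤ c → clauseAt x c = [] := by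
    intro c hc
    rw [hflat, clauseAt_flatMap hne]
    simp [hc]
  have hcount : clauseNo (fun i => x.getD i 0) x.length = cs.length := by
    rw [clauseNo_eq_count, hflat, count_zero_flatMap hne, List.length_map]
  have hcard : α.card = cs.length := by
    rw [← hcs, List.toFinset_card_of_nodup hdist, List.length_map]
  have hpos : 0 < α.card := Finset.card_pos.2 hα.1
  have hlen : ∀ c (hc : c < cs.length), (cs[c]).length ≤ k ∧ cs[c] ≠ [] := by
    intro c hc
    have h := hα.2 _ (hmem _ (List.getElem_mem hc))
    rw [List.toFinset_card_of_nodup (hnd _ (List.getElem_mem hc))] at h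
    refine ⟨h.2.1, ?_⟩
    rintro h0
    have := h.1
    rw [h0] at this
    simp at this
  have hlit : ∀ c, ∀ l ∈ clauseAt x c, 2 ≤ l ∧ l ≤ 2 * n + 1 := by
    intro c l hl
    rcases lt_or_ge c cs.length with hc | hc
    · rw [hat c hc] at hl
      obtain ⟨a, ha, rfl⟩ := List.mem_map.1 hl
      exact hcode _ (List.getElem_mem hc) a ha
    · rw [hat' c hc] at hl
      simp at hl
  have hent : ∀ i, i < x.length → x.getD i 0 ≠ 0 → 2 ≤ x.getD i 0 ∧ x.getD i 0 ≤ 2 * n + 1 :=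
    fun i hi h0 => hlit _ _ (mem_clauseAt.2 ⟨i, hi, h0, rfl, rfl⟩)
  have hlt : ∀ i, i < x.length → x.getD i 0 ≠ 0 →
      clauseNo (fun i => x.getD i 0) i < cs.length := fun i hi h0 => by
    by_contra! hc
    have := mem_clauseAt.2 ⟨i, hi, h0, rfl, rfl⟩
    rw [hat' _ hc] at this
    simp at this
  refine ⟨hcount.trans hcard.symm, hpos, hlit, ?_, ?_, ?_, ?_⟩
  · intro i
    rcases lt_or_ge i x.length with hi | hi
    · by_cases h0 : x.getD i 0 = 0
      · omega
      · exact (hent i hi h0).2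
    · rw [List.getD_eq_default _ _ hi]; omega
  · rw [hcard]
    refine length_flatMap_le _ _ _ fun c hc => ?_
    obtain ⟨i, hi, rfl⟩ := List.mem_iff_getElem.1 hc
    simpa using (hlen i hi).1
  · rw [hcard]
    refine exists_congr fun z => ⟨fun h c hc => ?_, fun h c hc => ?_⟩
    · obtain ⟨l, hl, hz⟩ := h _ (hmem _ (List.getElem_mem hc))
      refine ⟨l.code, ?_, by rwa [decodeLit_code]⟩
      rw [hat c hc]
      exact List.mem_map_of_mem (by simpa using hl)
    · rw [← hcs] at hc
      obtain ⟨c, hc', rfl⟩ : ∃ a ∈ cs, a.toFinset = c := by simpa using hc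
      obtain ⟨i, hi, rfl⟩ := List.mem_iff_getElem.1 hc'
      obtain ⟨l, hl, hz⟩ := h i hi
      rw [hat i hi] at hl
      obtain ⟨b, hb, rfl⟩ := List.mem_map.1 hl
      rw [decodeLit_code] at hz
      exact ⟨b, by simpa using hb, hz⟩
  · refine ⟨by omega, ?_, ?_, ?_, ?_, ?_⟩
    · have hcs0 : cs ≠ [] := by rw [← List.length_pos_iff]; omega
      have : x = (cs.dropLast.flatMap fun c => c.map Literal.code ++ [0]) ++
          (cs.getLast hcs0).map Literal.code ++ [0] := by
        rw [hx]
        conv_lhs => rw [← List.dropLast_append_getLast hcs0]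
        simp
      simp only [this, List.length_append, List.length_singleton, Nat.add_sub_cancel]
      rw [← List.length_append, Printer.getD_append_singleton, if_pos rfl]
    · intro i hi h1
      have := hent i hi (by omega)
      omega
    · intro c hc
      rw [hcount] at hc
      rw [clauseLen_eq, hat c hc]
      simpa [and_comm] using hlen c hc
    · intro i hi h0
      rw [occ_eq _ h0, hat _ (hlt i hi h0)]
      exact List.nodup_iff_count_le_one.1
        ((hnd _ (List.getElem_mem _)).map code_injective) _
    · intro a ha b hb
      rw [hcount] at ha
      have hab : (cs[a]).toFinset ≠ (cs[b]).toFinset := by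
        intro h
        have h1 : (cs.map List.toFinset)[a]'(by simpa using ha) =
            (cs.map List.toFinset)[b]'(by simp; omega) := by simpa using h
        have := (List.Nodup.getElem_inj_iff hdist).1 h1
        omega
      have key : ∀ a (ha : a < cs.length) b (hb : b < cs.length), ∀ l ∈ cs[a], l ∉ cs[b] →
          ∃ i < x.length, x.getD i 0 ≠ 0 ∧ clauseNo (fun i => x.getD i 0) i = a ∧
            occ (fun i => x.getD i 0) x.length (x.getD i 0) b = 0 := by
        intro a ha b hb l hl hl'
        have h1 : l.code ∈ clauseAt x a := by rw [hat a ha]; exact List.mem_map_of_mem hl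
        obtain ⟨i, hi, h0, he, hc⟩ := mem_clauseAt.1 h1
        refine ⟨i, hi, h0, hc, ?_⟩
        rw [occ_eq _ h0, he, hat b hb, List.count_eq_zero]
        intro h
        obtain ⟨l', hl'', e⟩ := List.mem_map.1 h
        exact hl' (code_injective e ▸ hl'')
      by_cases hsub : ∀ l ∈ cs[a], l ∈ cs[b]
      · have : ∃ l ∈ cs[b], l ∉ cs[a] := by
          by_contra! hsub'
          exact hab (Finset.ext fun l => by simpa using ⟨hsub l, hsub' l⟩)
        obtain ⟨l, hl, hl'⟩ := this
        obtain ⟨i, hi, h0, h1, h2⟩ := key b (by omega) a ha l hl hl'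
        exact ⟨i, hi, h0, Or.inr ⟨h1, h2⟩⟩
      · push Not at hsub
        obtain ⟨l, hl, hl'⟩ := hsub
        obtain ⟨i, hi, h0, h1, h2⟩ := key a ha b (by omega) l hl hl'
        exact ⟨i, hi, h0, Or.inl ⟨h1, h2⟩⟩

/-- The clauses are the decoded pieces between end marks. The converse of the validity part of
`Presents.reads`; it ensures that an input passing the check really is a formula. -/
theorem Valid.presents {x : List ℕ} {k : ℕ} (h : Valid k (fun i => x.getD i 0) x.length) :
    ∃ n, ∃ α ∈ kCNF k n, Presents x α := by
  set m := clauseNo (fun i => x.getD i 0) x.length with hm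
  let cl : ℕ → List Literal := fun c => (clauseAt x c).map decodeLit
  have hx : x ≠ [] := by
    rintro rfl
    exact h.pos rfl
  have hcl : ∀ c, (cl c).map Literal.code = clauseAt x c := fun c => by
    simp [cl, Function.comp_def, code_decodeLit]
  have hmem : ∀ {l : Literal} {c : ℕ}, l ∈ cl c ↔ l.code ∈ clauseAt x c := by
    intro l c
    rw [← hcl, List.mem_map_of_injective code_injective]
  have hnd : ∀ c, (cl c).Nodup := fun c => by
    refine List.Nodup.of_map Literal.code ?_
    rw [hcl, List.nodup_iff_count_le_one]
    intro l
    by_cases hl : l ∈ clauseAt x c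
    · obtain ⟨i, hi, h0, rfl, rfl⟩ := mem_clauseAt.1 hl
      rw [← occ_eq _ h0]
      exact h.nodup i hi h0
    · rw [List.count_eq_zero.2 hl]; exact zero_le_one
  have hcode : ∀ c, ∀ l ∈ cl c, 2 ≤ l.code ∧ l.code ≤ x.sum := fun c l hl => by
    obtain ⟨i, hi, h0, he, _⟩ := mem_clauseAt.1 (hmem.1 hl)
    have h1 := h.ne_one i hi
    refine ⟨by omega, ?_⟩
    rw [← he, List.getD_eq_getElem _ _ hi]
    exact List.single_le_sum (by simp) _ (List.getElem_mem hi)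
  -- The list does not record the number of variables; any bound for the indices will do, for
  -- instance the sum of all entries.
  refine ⟨x.sum, (((List.range m).map cl).map List.toFinset).toFinset, ⟨?_, ?_⟩,
    (List.range m).map cl, ?_, ?_, rfl, ?_⟩
  · refine ⟨(cl 0).toFinset, ?_⟩
    have : 0 < m := Nat.pos_of_ne_zero h.pos
    simp only [List.map_map, List.mem_toFinset, List.mem_map, List.mem_range]
    exact ⟨0, this, rfl⟩
  · intro c hc
    simp only [List.map_map, List.mem_toFinset, List.mem_map, List.mem_range] at hc
    obtain ⟨c, hc, rfl⟩ := hc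
    have hl := h.len c hc
    rw [clauseLen_eq] at hl
    simp only [Function.comp_apply]
    refine ⟨?_, ?_, ?_⟩
    · rw [List.toFinset_nonempty_iff]
      intro h0
      have := hcl c
      rw [h0] at this
      rw [← this] at hl
      simp at hl
    · rw [List.toFinset_card_of_nodup (hnd c)]
      simpa [cl] using hl.2
    · intro l hl
      have := hcode c l (by simpa using hl)
      simp only [Literal.code] at this
      split_ifs at this <;> omega
  · intro c hc
    obtain ⟨i, _, rfl⟩ := List.mem_map.1 hc
    exact hnd i
  · rw [List.map_map]
    refine List.Nodup.map_on ?_ List.nodup_range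
    have key : ∀ a < m, ∀ b < a, (cl a).toFinset ≠ (cl b).toFinset := by
      intro a ha b hb hab
      have hab' : ∀ l, l ∈ clauseAt x a ↔ l ∈ clauseAt x b := fun l => by
        have := Finset.ext_iff.1 hab (decodeLit l)
        simpa [hmem, code_decodeLit] using this
      obtain ⟨i, hi, h0, ⟨h1, h2⟩ | ⟨h1, h2⟩⟩ := h.diff a ha b hb
      · rw [occ_eq _ h0, List.count_eq_zero] at h2
        exact h2 ((hab' _).1 (mem_clauseAt.2 ⟨i, hi, h0, rfl, h1⟩))
      · rw [occ_eq _ h0, List.count_eq_zero] at h2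
        exact h2 ((hab' _).2 (mem_clauseAt.2 ⟨i, hi, h0, rfl, h1⟩))
    intro a ha b hb hab
    rw [List.mem_range] at ha hb
    rcases lt_trichotomy a b with hlt | he | hlt
    · exact absurd hab.symm (key b hb a hlt)
    · exact he
    · exact absurd hab (key a ha b hlt)
  · conv_lhs => rw [flatMap_clauseAt hx h.last]
    rw [List.flatMap_map]
    simp only [hcl]
    rfl

namespace Tm

/-! ## Logical connectives; a term holds if its value is not zero -/

def tnot (a : Tm) : Tm := ite a (const 0) (const 1)
def tand (a b : Tm) : Tm := ite a b (const 0)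
def tor (a b : Tm) : Tm := ite a (const 1) b
def teq (a b : Tm) : Tm := tnot (add (sub a b) (sub b a))
def tle (a b : Tm) : Tm := tnot (sub a b)
def tall (v : ℕ) (b p : Tm) : Tm := tnot (sum v b (tnot p))

/-- Multiplication by a constant. -/
def smul : ℕ → Tm → Tm
  | 0, _ => const 0
  | c + 1, t => add (smul c t) t

variable (X : ℕ → ℕ) (σ : ℕ → ℕ)

theorem eval_tnot (a : Tm) : (tnot a).eval X σ = if a.eval X σ = 0 then 1 else 0 := by
  simp only [tnot, eval, ne_eq, ite_not]

theorem eval_teq (a b : Tm) :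
    (teq a b).eval X σ = if a.eval X σ = b.eval X σ then 1 else 0 := by
  simp only [teq, eval_tnot, eval]
  congr 1
  simp only [eq_iff_iff]
  omega

theorem eval_smul (c : ℕ) (t : Tm) : (smul c t).eval X σ = c * t.eval X σ := by
  induction c with
  | zero => simp [smul, eval]
  | succ c ih => simp only [smul, eval, ih]; ring

theorem tnot_holds (a : Tm) : (tnot a).eval X σ ≠ 0 ↔ a.eval X σ = 0 := by
  rw [eval_tnot]; split_ifs <;> simp_all

theorem tand_holds (a b : Tm) :
    (tand a b).eval X σ ≠ 0 ↔ a.eval X σ ≠ 0 ∧ b.eval X σ ≠ 0 := by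
  simp only [tand, eval]; split_ifs <;> simp_all

theorem tor_holds (a b : Tm) :
    (tor a b).eval X σ ≠ 0 ↔ a.eval X σ ≠ 0 ∨ b.eval X σ ≠ 0 := by
  simp only [tor, eval]; split_ifs <;> simp_all

theorem teq_holds (a b : Tm) : (teq a b).eval X σ ≠ 0 ↔ a.eval X σ = b.eval X σ := by
  rw [eval_teq]; split_ifs <;> simp_all

theorem teq_eq_zero (a b : Tm) : (teq a b).eval X σ = 0 ↔ a.eval X σ ≠ b.eval X σ := by
  rw [eval_teq]; split_ifs <;> simp_all

theorem tle_holds (a b : Tm) : (tle a b).eval X σ ≠ 0 ↔ a.eval X σ ≤ b.eval X σ := by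
  rw [tle, tnot_holds]; simp only [eval]; omega

theorem sum_holds (v : ℕ) (b p : Tm) : (sum v b p).eval X σ ≠ 0 ↔
    ∃ i < b.eval X σ, p.eval X (Function.update σ v i) ≠ 0 := by
  simp [eval]

theorem tall_holds (v : ℕ) (b p : Tm) : (tall v b p).eval X σ ≠ 0 ↔
    ∀ i < b.eval X σ, p.eval X (Function.update σ v i) ≠ 0 := by
  rw [tall, tnot_holds]
  simp only [eval, Finset.sum_eq_zero_iff, Finset.mem_range]
  refine forall₂_congr fun i _ => ?_
  rw [eval_tnot]; split_ifs <;> simp_all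

/-! ## The check of the input; variable `0` holds its length -/

/-- The number of the clause at the position given by `t`. -/
def clauseNoTm (t : Tm) : Tm := sum 20 t (tnot (get (var 20)))

/-- The bound variables 20 and 21 are reserved for these auxiliary sums, so that the variables 1, 2,
3 of the check are not captured. -/
def occTm (a b : Tm) : Tm :=
  sum 21 (var 0) (tand (teq (get (var 21)) a) (teq (clauseNoTm (var 21)) b))

def clauseLenTm (b : Tm) : Tm :=
  sum 21 (var 0) (tand (tnot (tnot (get (var 21)))) (teq (clauseNoTm (var 21)) b))

theorem eval_clauseNoTm (t : Tm) : (clauseNoTm t).eval X σ = clauseNo X (t.eval X σ) := by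
  simp only [clauseNoTm, clauseNo, eval, eval_tnot, Function.update_self]

variable {X σ}

theorem eval_occTm {a b : Tm} (ha : ∀ i, a.eval X (Function.update σ 21 i) = a.eval X σ)
    (hb : ∀ i, b.eval X (Function.update σ 21 i) = b.eval X σ) :
    (occTm a b).eval X σ = occ X (σ 0) (a.eval X σ) (b.eval X σ) := by
  simp only [occTm, occ, eval, tand, eval_teq, eval_clauseNoTm, Function.update_self, ha, hb]
  refine Finset.sum_congr rfl fun i _ => ?_
  split_ifs <;> simp_all

theorem eval_clauseLenTm {b : Tm} (hb : ∀ i, b.eval X (Function.update σ 21 i) = b.eval X σ) :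
    (clauseLenTm b).eval X σ = clauseLen X (σ 0) (b.eval X σ) := by
  simp only [clauseLenTm, clauseLen, eval, tand, eval_teq, eval_tnot, eval_clauseNoTm,
    Function.update_self, hb]
  refine Finset.sum_congr rfl fun i _ => ?_
  split_ifs <;> simp_all

/-- The term that checks whether the array lists a formula with at most `k` literals per clause. -/
def checkTm (k : ℕ) : Tm :=
  tand (clauseNoTm (var 0)) <| tand (tnot (get (sub (var 0) (const 1)))) <|
  tand (tall 1 (var 0) (tnot (teq (get (var 1)) (const 1)))) <|
  tand (tall 1 (clauseNoTm (var 0))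
    (tand (clauseLenTm (var 1)) (tle (clauseLenTm (var 1)) (const k)))) <|
  tand (tall 1 (var 0) (tor (tnot (get (var 1)))
    (tle (occTm (get (var 1)) (clauseNoTm (var 1))) (const 1)))) <|
  tall 1 (clauseNoTm (var 0)) <| tall 2 (var 1) <| sum 3 (var 0) <| tand (get (var 3)) <|
    tor (tand (teq (clauseNoTm (var 3)) (var 1)) (tnot (occTm (get (var 3)) (var 2))))
      (tand (teq (clauseNoTm (var 3)) (var 2)) (tnot (occTm (get (var 3)) (var 1))))

theorem checkTm_holds (k : ℕ) : (checkTm k).eval X σ ≠ 0 ↔ Valid k X (σ 0) := by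
  have e1 : ∀ (σ : ℕ → ℕ) (w : ℕ), w ≠ 21 → ∀ i,
      (var w).eval X (Function.update σ 21 i) = (var w).eval X σ := fun σ w hw i => by
    simp [eval, hw]
  have e2 : ∀ (σ : ℕ → ℕ) (w : ℕ), w ≠ 21 → ∀ i,
      (get (var w)).eval X (Function.update σ 21 i) = (get (var w)).eval X σ := fun σ w hw i => by
    simp [eval, hw]
  have e3 : ∀ (σ : ℕ → ℕ) (w : ℕ), w ≠ 21 → ∀ i,
      (clauseNoTm (var w)).eval X (Function.update σ 21 i) = (clauseNoTm (var w)).eval X σ :=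
    fun σ w hw i => by simp [eval_clauseNoTm, eval, hw]
  have l1 : ∀ σ : ℕ → ℕ, (clauseLenTm (var 1)).eval X σ = clauseLen X (σ 0) (σ 1) := fun σ =>
    eval_clauseLenTm (e1 σ 1 (by decide))
  have o1 : ∀ σ : ℕ → ℕ, (occTm (get (var 1)) (clauseNoTm (var 1))).eval X σ =
      occ X (σ 0) (X (σ 1)) (clauseNo X (σ 1)) := fun σ => by
    rw [eval_occTm (e2 σ 1 (by decide)) (e3 σ 1 (by decide)), eval_clauseNoTm]; rfl
  have o2 : ∀ (σ : ℕ → ℕ) (w : ℕ), w ≠ 21 → (occTm (get (var 3)) (var w)).eval X σ =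
      occ X (σ 0) (X (σ 3)) (σ w) := fun σ w hw =>
    eval_occTm (e2 σ 3 (by decide)) (e1 σ w hw)
  simp only [checkTm, tand_holds, tnot_holds, tall_holds, tor_holds, tle_holds, teq_holds,
    sum_holds, eval_clauseNoTm, l1, o1, o2 _ 1 (by decide), o2 _ 2 (by decide), teq_eq_zero]
  simp only [eval, Function.update_apply, reduceIte, OfNat.zero_ne_ofNat,
    zero_ne_one, OfNat.one_ne_ofNat, Nat.reduceEqDiff]
  constructor
  · rintro ⟨h1, h2, h3, h4, h5, h6⟩
    exact ⟨h1, h2, h3, h4, fun i hi h0 => (h5 i hi).resolve_left h0, h6⟩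
  · rintro ⟨h1, h2, h3, h4, h5, h6⟩
    exact ⟨h1, h2, h3, h4, fun i hi => or_iff_not_imp_left.2 (h5 i hi), h6⟩

/-! ## The scale of the formula -/

/-- `v` is large enough for the formula listed by the array `X` of length `L`. -/
def ScaleOK (g₀ C M : ℕ) (X : ℕ → ℕ) (L v : ℕ) : Prop :=
  g₀ ≤ v ∧ clauseNo X L ≤ C * M * v ∧ ∀ i < L, X i ≤ 2 * M * v + 1

/-- The term for the least number that is large enough. -/
def scaleTm (g₀ C M : ℕ) : Tm :=
  sum 11 (add (add (var 0) (sum 13 (var 0) (get (var 13)))) (const g₀)) <| tnot <|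
    tand (tle (const g₀) (var 11)) <|
    tand (tle (clauseNoTm (var 0)) (smul (C * M) (var 11))) <|
      tall 12 (var 0) (tle (get (var 12)) (add (smul (2 * M) (var 11)) (const 1)))

open Classical in
/-- The value of `scaleTm`. -/
noncomputable def scale (g₀ C M : ℕ) (X : ℕ → ℕ) (L : ℕ) : ℕ :=
  ∑ v ∈ Finset.range (L + ∑ i ∈ Finset.range L, X i + g₀), if ScaleOK g₀ C M X L v then 0 else 1

theorem eval_scaleTm (g₀ C M : ℕ) : (scaleTm g₀ C M).eval X σ = scale g₀ C M X (σ 0) := by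
  rw [scaleTm, scale, eval]
  refine Finset.sum_congr ?_ fun v _ => ?_
  · simp [eval]
  · rw [eval_tnot]
    have : ∀ t : Tm, ∀ σ, t.eval X σ = 0 ↔ ¬ t.eval X σ ≠ 0 := fun _ _ => not_not.symm
    simp only [this]
    simp only [tand_holds, tle_holds, tall_holds, eval_clauseNoTm]
    simp only [eval, eval_smul, Function.update_apply, reduceIte, OfNat.zero_ne_ofNat,
      Nat.reduceEqDiff, ScaleOK, ite_not]
    split_ifs with h
    exacts [(if_pos h).symm, (if_neg h).symm]

/-- For an upward closed property, the least element equals the number of failures below any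
success; so bounded sums can express a minimum. -/
theorem sum_ite_not_eq_find {p : ℕ → Prop} [DecidablePred p] (hp : ∀ a b, a ≤ b → p a → p b)
    {B : ℕ} (hB : p B) :
    ∑ v ∈ Finset.range B, (if p v then 0 else 1) = Nat.find (⟨B, hB⟩ : ∃ v, p v) := by
  have h1 : ∀ v, p v ↔ Nat.find (⟨B, hB⟩ : ∃ v, p v) ≤ v := fun v =>
    ⟨fun h => Nat.find_min' _ h, fun h => hp _ _ h (Nat.find_spec (⟨B, hB⟩ : ∃ v, p v))⟩
  generalize Nat.find (⟨B, hB⟩ : ∃ v, p v) = f at h1 ⊢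
  have hfB : f ≤ B := (h1 B).1 hB
  obtain ⟨r, rfl⟩ := Nat.exists_eq_add_of_le hfB
  rw [Finset.sum_range_add, Finset.sum_eq_zero (s := Finset.range r) fun v _ => by
    rw [if_pos ((h1 _).2 (Nat.le_add_right _ _))], Finset.sum_congr rfl (g := fun _ => 1)
    fun v hv => by rw [if_neg ((h1 _).not.2 (by simpa using hv))]]
  simp

theorem scale_spec {g₀ C M : ℕ} (hC : 1 ≤ C) (hM : 1 ≤ M) (X : ℕ → ℕ) (L : ℕ) :
    ScaleOK g₀ C M X L (scale g₀ C M X L) ∧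
      ∀ v, ScaleOK g₀ C M X L v → scale g₀ C M X L ≤ v := by
  classical
  have hmono : ∀ a b, a ≤ b → ScaleOK g₀ C M X L a → ScaleOK g₀ C M X L b := by
    rintro a b hab ⟨h1, h2, h3⟩
    exact ⟨h1.trans hab, h2.trans (Nat.mul_le_mul_left _ hab), fun i hi =>
      (h3 i hi).trans (Nat.succ_le_succ (Nat.mul_le_mul_left _ hab))⟩
  -- The upper limit of the sum in `scale` is itself large enough: it dominates `g₀`, the number of
  -- clauses and every entry.
  have hB : ScaleOK g₀ C M X L (L + ∑ i ∈ Finset.range L, X i + g₀) := by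
    refine ⟨by omega, ?_, fun i hi => ?_⟩
    · have h1 : clauseNo X L ≤ L := by
        refine (Finset.sum_le_card_nsmul _ _ 1 fun a _ => ?_).trans (by simp)
        split_ifs <;> omega
      calc clauseNo X L ≤ 1 * (L + ∑ i ∈ Finset.range L, X i + g₀) := by omega
        _ ≤ _ := Nat.mul_le_mul_right _ (Nat.mul_pos hC hM)
    · have h1 := Finset.single_le_sum (f := X) (fun _ _ => Nat.zero_le _) (Finset.mem_range.2 hi)
      calc X i ≤ 1 * (L + ∑ i ∈ Finset.range L, X i + g₀) := by omega
        _ ≤ 2 * M * (L + ∑ i ∈ Finset.range L, X i + g₀) := Nat.mul_le_mul_right _ (by omega)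
        _ ≤ _ := Nat.le_succ _
  have hs : scale g₀ C M X L = Nat.find ⟨_, hB⟩ := by
    rw [← sum_ite_not_eq_find hmono hB, scale]
  rw [hs]
  exact ⟨Nat.find_spec ⟨_, hB⟩, fun v hv => Nat.find_min' _ hv⟩

end Tm

/-! ## Printing the network -/

namespace Printer

/-- Print the parameters of a layer; the row is variable `2`, the column variable `3`. -/
def layer (r c w b : Tm) : Printer := seq (rep 2 r (rep 3 c (emit w))) (rep 2 r (emit b))

theorem out_layer {X σ : ℕ → ℕ} {r c w b : Tm} {nr nc : ℕ} {w' : ℕ → ℕ → ℕ} {b' : ℕ → ℕ}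
    (hr : r.eval X σ = nr) (hc : ∀ i, c.eval X (Function.update σ 2 i) = nc)
    (hw : ∀ i j, w.eval X (Function.update (Function.update σ 2 i) 3 j) = w' i j)
    (hb : ∀ i, b.eval X (Function.update σ 2 i) = b' i) :
    (layer r c w b).out X σ = SatNet.layerParams nr nc w' b' := by
  simp only [layer, out, hr, hc, hw, hb, SatNet.layerParams,
    ← List.map_eq_flatMap]

end Printer

namespace SatNet
open Tm

/-- The position of a parameter in the increasing enumeration of `θ`. -/
noncomputable def pos (θ : Finset ℝ) (a : ℝ) : ℕ := (θ.filter (· < a)).card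

/-- Real numbers enter the program only as fixed positions in θ, so nothing has to be computed about
δ or θ. Variable 2 is the row and variable 3 the column. -/
noncomputable def firstWeightTm (θ : Finset ℝ) : Tm :=
  ite (teq (var 3) (const 0))
    (ite (tor (teq (var 2) (const 0)) (teq (var 2) (const 2))) (const (pos θ (-1)))
      (ite (tor (teq (var 2) (const 1)) (teq (var 2) (const 3))) (const (pos θ 1))
        (const (pos θ 0))))
    (const (pos θ 0))

noncomputable def firstBiasTm (θ : Finset ℝ) (δ : ℝ) : Tm :=
  ite (tor (teq (var 2) (const 0)) (teq (var 2) (const 2))) (const (pos θ δ))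
    (ite (tor (teq (var 2) (const 1)) (teq (var 2) (const 3))) (const (pos θ (-(1 - δ))))
      (const (pos θ 0)))

noncomputable def curveWeightTm (θ : Finset ℝ) (δ : ℝ) : Tm :=
  ite (tor (teq (var 2) (const 0)) (teq (var 2) (const 2)))
    (ite (tle (add (var 3) (const 1)) (const 2)) (const (pos θ δ⁻¹)) (const (pos θ 0)))
  (ite (tor (teq (var 2) (const 1)) (teq (var 2) (const 3)))
    (ite (tle (add (var 3) (const 1)) (const 2)) (const (pos θ (-δ⁻¹))) (const (pos θ 0)))
  (ite (teq (var 2) (const 4))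
    (ite (tle (add (var 3) (const 1)) (const 4)) (const (pos θ (-δ⁻¹))) (const (pos θ 0)))
  (ite (teq (var 2) (const 5))
    (ite (tle (add (var 3) (const 1)) (const 4)) (const (pos θ δ⁻¹)) (const (pos θ 0)))
  (ite (teq (var 2) (add (var 3) (const 2))) (const (pos θ δ⁻¹)) (const (pos θ 0))))))

noncomputable def curveBiasTm (θ : Finset ℝ) (δ : ℝ) : Tm :=
  ite (tor (teq (var 2) (const 0)) (teq (var 2) (const 2))) (const (pos θ (-(1 - δ))))
  (ite (tor (teq (var 2) (const 1)) (teq (var 2) (const 3))) (const (pos θ δ))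
  (ite (teq (var 2) (const 4)) (const (pos θ 1))
  (ite (teq (var 2) (const 5)) (const (pos θ (-1))) (const (pos θ 0)))))

noncomputable def clauseWeightTm (θ : Finset ℝ) (e₀ : ℕ) : Tm :=
  ite (sum 4 (var 0) (tand (get (var 4))
      (tand (teq (add (get (var 4)) (const (2 + 2 * e₀))) (var 3))
        (teq (clauseNoTm (var 4)) (var 2)))))
    (const (pos θ (-1))) (const (pos θ 0))

/-- Neuron `j` holds a literal of clause number `c` of the listed formula. -/
def clauseLit (X : ℕ → ℕ) (L e₀ c j : ℕ) : Prop :=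
  ∃ i < L, X i ≠ 0 ∧ X i + (2 + 2 * e₀) = j ∧ clauseNo X i = c

variable {X σ : ℕ → ℕ} {θ : Finset ℝ} {δ : ℝ}

theorem eval_firstWeightTm :
    (firstWeightTm θ).eval X σ = pos θ (firstWeight (σ 2) (σ 3)) := by
  simp only [firstWeightTm, eval, teq_holds, tor_holds, firstWeight, apply_ite (pos θ)]

theorem eval_firstBiasTm : (firstBiasTm θ δ).eval X σ = pos θ (firstBias δ (σ 2)) := by
  simp only [firstBiasTm, eval, teq_holds, tor_holds, firstBias, apply_ite (pos θ)]

theorem eval_curveWeightTm :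
    (curveWeightTm θ δ).eval X σ = pos θ (curveWeight δ (σ 2) (σ 3)) := by
  simp only [curveWeightTm, eval, teq_holds, tor_holds, tle_holds, curveWeight,
    apply_ite (pos θ), Nat.lt_iff_add_one_le]

theorem eval_curveBiasTm : (curveBiasTm θ δ).eval X σ = pos θ (curveBias δ (σ 2)) := by
  simp only [curveBiasTm, eval, teq_holds, tor_holds, curveBias, apply_ite (pos θ)]

theorem eval_clauseWeightTm (e₀ : ℕ) : (clauseWeightTm θ e₀).eval X σ =
    pos θ (clauseWeight (clauseLit X (σ 0) e₀) (σ 2) (σ 3)) := by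
  rw [clauseWeightTm, eval, clauseWeight, apply_ite (pos θ)]
  simp only [sum_holds, tand_holds, teq_holds, eval_clauseNoTm, clauseLit]
  simp only [eval, Function.update_apply, reduceIte, Nat.reduceEqDiff]
  split_ifs with h
  exacts [(if_pos h).symm, (if_neg h).symm]

/-- The number of variables, the width and so on are multiples of the scale. -/
noncomputable def printer (θ : Finset ℝ) (δ : ℝ) (d e₀ M K : ℕ) (g : Tm) : Printer :=
  .seq (.emit (add (smul M g) (const (e₀ + 4)))) <| .seq (.emit (const d)) <|
  .seq (.rep 1 (add (smul M g) (const (e₀ + 1))) (.emit (smul K g))) <|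
  .seq (.emit (clauseNoTm (var 0))) <| .seq (.emit (const 1)) <| .seq (.emit (const 1)) <|
  .seq (.layer (smul K g) (const d) (firstWeightTm θ) (firstBiasTm θ δ)) <|
  .seq (.rep 1 (add (smul M g) (const e₀))
    (.layer (smul K g) (smul K g) (curveWeightTm θ δ) (curveBiasTm θ δ))) <|
  .seq (.layer (clauseNoTm (var 0)) (smul K g) (clauseWeightTm θ e₀) (const (pos θ 1))) <|
  .seq (.layer (const 1) (clauseNoTm (var 0)) (const (pos θ (-1))) (const (pos θ 1))) <|
    .layer (const 1) (const 1) (const (pos θ 1)) (const (pos θ 0))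

/-- The hypothesis on `g` says that it depends on the length alone among the variables, so it may be
used under the row, column and layer loops. -/
theorem out_printer (d e₀ M K : ℕ) {g : Tm} {gv : ℕ}
    (hg : ∀ σ' : ℕ → ℕ, σ' 0 = σ 0 → g.eval X σ' = gv) :
    (printer θ δ d e₀ M K g).out X σ = (satNet δ d (K * gv) (M * gv + e₀) (clauseNo X (σ 0))
      (clauseLit X (σ 0) e₀)).encode θ := by
  have u1 : ∀ (σ : ℕ → ℕ) (v i : ℕ), v ≠ 0 → Function.update σ v i 0 = σ 0 :=
    fun σ v i hv => Function.update_of_ne hv.symm _ _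
  have gs : ∀ (K : ℕ) (σ' : ℕ → ℕ), σ' 0 = σ 0 → (smul K g).eval X σ' = K * gv :=
    fun K σ' h => by rw [eval_smul, hg σ' h]
  rw [Network.encode, depth_satNet, widths_satNet, params_satNet]
  simp only [List.map_append, List.map_flatMap, map_layerParams, ← pos.eq_def]
  simp only [printer, Printer.out]
  rw [Printer.out_layer (nr := K * gv) (nc := d) (w' := fun i j => pos θ (firstWeight i j))
      (b' := fun i => pos θ (firstBias δ i)) (gs K σ rfl) (fun _ => rfl)
      (fun i j => by rw [eval_firstWeightTm]; simp)
      (fun i => by rw [eval_firstBiasTm]; simp),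
    Printer.out_layer (r := clauseNoTm (var 0)) (nr := clauseNo X (σ 0)) (nc := K * gv)
      (w' := fun i j => pos θ (clauseWeight (clauseLit X (σ 0) e₀) i j))
      (b' := fun i => pos θ 1) (by rw [eval_clauseNoTm]; rfl)
      (fun i => gs K _ (u1 _ _ _ (by decide)))
      (fun i j => by rw [eval_clauseWeightTm]; simp)
      (fun i => rfl),
    Printer.out_layer (r := const 1) (nr := 1) (nc := clauseNo X (σ 0))
      (w' := fun i j => pos θ (-1))
      (b' := fun i => pos θ 1) rfl (fun i => by rw [eval_clauseNoTm]; simp [eval])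
      (fun i j => rfl) (fun i => rfl),
    Printer.out_layer (r := const 1) (c := const 1) (nr := 1) (nc := 1)
      (w' := fun i j => pos θ 1)
      (b' := fun i => pos θ 0) rfl (fun i => rfl) (fun i j => rfl) (fun i => rfl)]
  have hc : ∀ a, (Printer.layer (smul K g) (smul K g) (curveWeightTm θ δ)
      (curveBiasTm θ δ)).out X (Function.update σ 1 a) = layerParams (K * gv) (K * gv)
        (fun i j => pos θ (curveWeight δ i j)) fun i => pos θ (curveBias δ i) := fun a =>
    Printer.out_layer (gs K _ (u1 _ _ _ (by decide)))
      (fun i => gs K _ (by rw [u1 _ _ _ (by decide), u1 _ _ _ (by decide)]))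
      (fun i j => by rw [eval_curveWeightTm]; simp)
      (fun i => by rw [eval_curveBiasTm]; simp)
  have hw : ∀ a, (smul K g).eval X (Function.update σ 1 a) = K * gv := fun a =>
    gs K _ (u1 _ _ _ (by decide))
  simp only [hc, hw, eval, gs M σ rfl, eval_clauseNoTm, List.cons_append, List.nil_append,
    List.append_assoc]
  simp [add_assoc, List.map_const', ← List.map_eq_flatMap]

end SatNet

/-! ## The decision program -/

namespace RunsTo

variable {p q : Prog} {s : State} {c : ℕ} {Q : State → Prop}

theorem add_log {r a b : ℕ} (hc : logCost (s.reg a) + logCost (s.reg b) ≤ c)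
    (h : Q (s.setReg r (s.reg a + s.reg b))) : RunsTo (.add r a b) s c Q :=
  ⟨_, _, .add s r a b, hc, h⟩

theorem sub_log {r a b : ℕ} (hc : logCost (s.reg a) + logCost (s.reg b) ≤ c)
    (h : Q (s.setReg r (s.reg a - s.reg b))) : RunsTo (.sub r a b) s c Q :=
  ⟨_, _, .sub s r a b, hc, h⟩

end RunsTo

/-- Overwrite the first `reg 0` cells of bank `0` by zeros. -/
def clearProg (h : ℕ) : Prog :=
  .seq (.const h 0) <| .seq (.add h h 0) <| .seq (.const (h + 1) 1) <| .seq (.const (h + 2) 0) <|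
    .loop h (.seq (.sub h h (h + 1)) (.store 0 h (h + 2)))

/-- Copy the first `reg q` cells of bank `o` to bank `0`. -/
def copyProg (h o q : ℕ) : Prog :=
  .seq (.const h 0) <| .seq (.add h h q) <| .seq (.const (h + 1) 1) <|
    .loop h (.seq (.sub h h (h + 1)) <| .seq (.load (h + 2) o h) (.store 0 h (h + 2)))

theorem clearProg_runsTo {h L : ℕ} (hh : 0 < h) {s : State} (hL : s.reg 0 = L)
    (hz : ∀ i, L ≤ i → s.mem 0 i = 0) :
    RunsTo (clearProg h) s (L + 6 + ((L + 1) * (L + 1) + L * (2 * L + 7))) fun s' =>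
      (∀ r < h, s'.reg r = s.reg r) ∧ (∀ a, a ≠ 0 → s'.mem a = s.mem a) ∧
        (∀ i, s'.mem 0 i = 0) ∧ s'.coins = s.coins := by
  let I : ℕ → State → Prop := fun j s' => s'.reg h = j ∧ s'.reg (h + 1) = 1 ∧
    s'.reg (h + 2) = 0 ∧ (∀ r < h, s'.reg r = s.reg r) ∧ (∀ a, a ≠ 0 → s'.mem a = s.mem a) ∧
    (∀ i, j ≤ i → s'.mem 0 i = 0) ∧ s'.coins = s.coins
  have h0 : (0 : ℕ) ≠ h := by omega
  refine RunsTo.seq_le (c₂ := L + 2 + (2 + (1 + ((L + 1) * (L + 1) + L * (2 * L + 7)))))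
    (RunsTo.const (RunsTo.seq (RunsTo.add (by simp [h0, hL]) (RunsTo.seq
      (RunsTo.const (RunsTo.seq (RunsTo.const ?_))))))) (by omega)
  refine (RunsTo.loop (n := L) (c := 2 * L + 7) I (fun j s hI => hI.1) ?_ L _ le_rfl ?_).mono
    le_rfl ?_
  · rintro j s' hj ⟨h1, h2, h3, h4, h5, h6, h7⟩
    refine RunsTo.seq_le (RunsTo.sub (c := L + 3) (by rw [h1, h2]; omega)
      (RunsTo.store (c := L + 4) (by simp [h1, h2, h3]; omega) ?_)) (by omega)
    refine ⟨by simp [h1, h2], by simp [h2], by simp [h3], ?_, ?_, ?_, by simp [h7]⟩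
    · intro r hr; simp [hr.ne, h4 r hr]
    · intro a ha; funext i; simp [ha, h5 a ha]
    · intro i hi
      by_cases hij : i = j
      · simp [hij, h1, h2, h3]
      · simp [hij, h1, h2, h6 i (by omega)]
  · refine ⟨by simp [h0, hL], by simp, by simp, ?_, fun _ _ => rfl, hz, rfl⟩
    intro r hr
    have a1 : r ≠ h + 1 := by omega
    have a2 : r ≠ h + 2 := by omega
    simp [hr.ne, a1, a2]
  · rintro s' ⟨-, -, -, h4, h5, h6, h7⟩
    exact ⟨h4, h5, fun i => h6 i (Nat.zero_le i), h7⟩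

theorem copyProg_runsTo {h o q V : ℕ} (hq : q < h) (ho : o ≠ 0) {s : State} {l : List ℕ}
    (hl : Printer.Holds o q l s) (hV : ∀ y ∈ l, y ≤ V) (hz : ∀ i, s.mem 0 i = 0) :
    RunsTo (copyProg h o q) s (l.length + 5 + ((l.length + 1) * (l.length + 1) +
        l.length * (3 * l.length + 2 * V + 11))) fun s' =>
      (∀ r < h, s'.reg r = s.reg r) ∧ (∀ a, a ≠ 0 → s'.mem a = s.mem a) ∧
        (∀ i, s'.mem 0 i = l.getD i 0) ∧ s'.coins = s.coins := by
  set L := l.length with hL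
  let I : ℕ → State → Prop := fun j s' => s'.reg h = j ∧ s'.reg (h + 1) = 1 ∧
    (∀ r < h, s'.reg r = s.reg r) ∧ (∀ a, a ≠ 0 → s'.mem a = s.mem a) ∧
    (∀ i, j ≤ i → s'.mem 0 i = l.getD i 0) ∧ s'.coins = s.coins
  have hV' : ∀ i, l.getD i 0 ≤ V := by
    intro i
    rcases lt_or_ge i l.length with hi | hi
    · rw [List.getD_eq_getElem _ _ hi]; exact hV _ (List.getElem_mem hi)
    · rw [List.getD_eq_default _ _ hi]; exact Nat.zero_le _
  refine RunsTo.seq_le (c₂ := L + 2 + (2 + ((L + 1) * (L + 1) + L * (3 * L + 2 * V + 11))))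
    (RunsTo.const (RunsTo.seq (RunsTo.add (by simp [hq.ne, hl.2, hL]) (RunsTo.seq
      (RunsTo.const ?_))))) (by omega)
  refine (RunsTo.loop (n := L) (c := 3 * L + 2 * V + 11) I (fun j s hI => hI.1) ?_ L _
    le_rfl ?_).mono le_rfl ?_
  · rintro j s' hj ⟨h1, h2, h4, h5, h6, h7⟩
    have hm : s'.mem o j = l.getD j 0 := by rw [h5 o ho, hl.1]
    have hVj := hV' j
    rw [← hm] at hVj
    refine RunsTo.seq_le (RunsTo.sub (c := L + 3) (by rw [h1, h2]; omega) (RunsTo.seq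
      (c₁ := L + V + 2) (c₂ := L + V + 2) (RunsTo.load (by simp [h1, h2]; omega)
      (RunsTo.store (by simp [h1, h2]; omega) ?_)))) (by omega)
    refine ⟨by simp [h1, h2], by simp [h2], ?_, ?_, ?_, by simp [h7]⟩
    · intro r hr
      have a1 : r ≠ h + 2 := by omega
      simp [hr.ne, a1, h4 r hr]
    · intro a ha; funext i; simp [ha, h5 a ha]
    · intro i hi
      have h6' : i ≠ j → s'.mem 0 i = l.getD i 0 := fun hij => h6 i (by omega)
      by_cases hij : i = j
      · subst hij
        simpa [h1, h2] using hm
      · simpa [hij, h1, h2] using h6' hij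
  · refine ⟨by simp [hq.ne, hl.2, hL], by simp, ?_, fun _ _ => rfl, ?_, rfl⟩
    · intro r hr
      have a1 : r ≠ h + 1 := by omega
      simp [hr.ne, a1]
    · intro i hi
      rw [List.getD_eq_default _ _ hi]
      exact hz i
  · rintro s' ⟨-, -, h4, h5, h6, h7⟩
    exact ⟨h4, h5, fun i => h6 i (Nat.zero_le i), h7⟩

/-- Set register `R + 1` to the value of `expo` and replace the input by the printed list. -/
def prepareProg (R : ℕ) (expo : Tm) (pr : Printer) : Prog :=
  .seq (expo.compile (fun _ => 0) (R + 1)) <| .seq (.const R 0) <|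
    .seq (pr.compile R R (fun _ => 0) (R + 2)) <| .seq (clearProg (R + 2)) <|
      .seq (copyProg (R + 2) R R) <| .seq (.const 0 0) (.add 0 0 R)

/-- A bound for the cost of `prepareProg`. -/
def prepareCost (expo : Tm) (pr : Printer) (B : ℕ) : ℕ :=
  expo.costBound B + (1 + (pr.costBound (pr.lenBound B) B +
    ((B + 6 + ((B + 1) * (B + 1) + B * (2 * B + 7))) +
      ((pr.lenBound B + 5 + ((pr.lenBound B + 1) * (pr.lenBound B + 1) +
        pr.lenBound B * (3 * pr.lenBound B + 2 * pr.valBound B + 11))) +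
        (1 + (pr.lenBound B + 2))))))

theorem isPoly_prepareCost (expo : Tm) (pr : Printer) : IsPoly (prepareCost expo pr) := by
  have hl := pr.isPoly_lenBound
  have hv := pr.isPoly_valBound
  have hB := IsPoly.id
  have h1 := fun c => IsPoly.const c
  exact expo.isPoly_costBound.add <| (h1 1).add <| (pr.isPoly_costBound hl .id).add <|
    IsPoly.add ((hB.add (h1 6)).add (((hB.add (h1 1)).mul (hB.add (h1 1))).add
      (hB.mul (((h1 2).mul hB).add (h1 7))))) <|
    IsPoly.add ((hl.add (h1 5)).add (((hl.add (h1 1)).mul (hl.add (h1 1))).add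
      (hl.mul ((((h1 3).mul hl).add ((h1 2).mul hv)).add (h1 11))))) <|
    (h1 1).add (hl.add (h1 2))

/-- `A` must find the state of a fresh machine below `R`. The list is therefore printed to bank `R`,
bank 0 is erased (its cells past the input are zero anyway), and the list is copied over. The
exponent is computed first, while the input is still there. -/
theorem prepareProg_runsTo {R : ℕ} (hR : 0 < R) (expo : Tm) (pr : Printer) {x : List ℕ}
    {ω : ℕ → Bool} {B : ℕ} (hB : x.length ≤ B) (hX : ∀ i, x.getD i 0 ≤ B) {s : State}
    (hs : AgreeBelow R (initState x ω) s) (hsR : ∀ i, s.mem R i = 0) :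
    RunsTo (prepareProg R expo pr) s (prepareCost expo pr B) fun s' =>
      AgreeBelow R (initState (pr.out (fun i => x.getD i 0) fun _ => x.length) ω) s' ∧
        s'.reg (R + 1) = expo.eval (fun i => x.getD i 0) fun _ => x.length := by
  have hm : s.mem 0 = fun i => x.getD i 0 := by rw [← hs.mem 0 hR]; simp [initState]
  have hr : s.reg 0 = x.length := by rw [← hs.reg 0 hR]; simp [initState]
  set X : ℕ → ℕ := fun i => x.getD i 0 with hX_def
  have hX0 : ∀ i, s.mem 0 i ≤ B := by rw [hm]; exact hX
  have hσ0 : ∀ _ : ℕ, s.reg 0 ≤ B := fun _ => by rw [hr]; exact hB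
  set l := pr.out X fun _ => x.length with hl
  have hlen : l.length ≤ pr.lenBound B := pr.length_out_le hX fun _ => hB
  have hval : ∀ y ∈ l, y ≤ pr.valBound B := pr.le_valBound hX fun _ => hB
  refine RunsTo.seq ((expo.compile_runsTo (fun _ => by omega) hX0 hσ0).mono le_rfl ?_)
  rintro s₁ ⟨f₁, e₁⟩
  have a1 : (0 : ℕ) ≠ R := by omega
  refine RunsTo.seq (RunsTo.const (RunsTo.seq ((pr.compile_runsTo (B := B) (acc := [])
    (K := pr.lenBound B) (o := R) (q := R) (ρ := fun _ => 0) (h := R + 2) (by omega)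
    (fun _ => by omega) (fun _ => by omega) (by omega) ?_ ?_ ?_ (by simp)).mono le_rfl ?_)))
  · simpa [f₁.mem] using hX0
  · intro v; simpa [a1, f₁.reg 0 (by omega)] using hσ0 v
  · exact ⟨fun i => by simp [f₁.mem, hsR], by simp⟩
  rintro s₂ ⟨f₂, e₂⟩
  simp only [State.setReg_mem, State.setReg_reg, a1, if_false, f₁.mem, f₁.reg 0 (by omega), hm, hr,
    List.nil_append] at e₂
  rw [← hl] at e₂
  have r₂ : ∀ r < R, s₂.reg r = s.reg r := fun r hr => by
    rw [f₂.reg r (by omega) hr.ne, State.setReg_reg, if_neg hr.ne, f₁.reg r (by omega)]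
  have m₂ : ∀ a, a ≠ R → s₂.mem a = s.mem a := fun a ha => by
    rw [f₂.mem a ha, State.setReg_mem, f₁.mem]
  have x₂ : s₂.reg (R + 1) = expo.eval X fun _ => x.length := by
    rw [f₂.reg _ (by omega) (by omega), State.setReg_reg, if_neg (by omega), e₁, hm, hr]
  refine RunsTo.seq ((clearProg_runsTo (L := x.length) (by omega) ((r₂ 0 hR).trans hr) ?_).mono
    ?_ ?_)
  · intro i hi
    rw [m₂ 0 a1, hm]
    exact List.getD_eq_default _ _ hi
  · gcongr
  rintro s₃ ⟨r₃, m₃, z₃, c₃⟩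
  refine RunsTo.seq ((copyProg_runsTo (V := pr.valBound B) (l := l) (by omega) a1.symm ?_ hval
    z₃).mono ?_ ?_)
  · exact ⟨fun i => by rw [m₃ R a1.symm, e₂.1], by rw [r₃ R (by omega), e₂.2]⟩
  · gcongr
  rintro s₄ ⟨r₄, m₄, z₄, c₄⟩
  have q₄ : s₄.reg R = l.length := by rw [r₄ R (by omega), r₃ R (by omega), e₂.2]
  refine RunsTo.seq (RunsTo.const (RunsTo.add ?_ ?_))
  · simp [a1.symm, q₄]; omega
  refine ⟨⟨?_, ?_, ?_⟩, ?_⟩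
  · intro r hr'
    by_cases h0 : r = 0
    · simp [h0, a1.symm, q₄, initState]
    · have := hs.reg r hr'
      simp only [initState, h0, if_false] at this
      simp [h0, initState, r₄ r (by omega), r₃ r (by omega), r₂ r hr', ← this]
  · intro a ha
    funext i
    by_cases h0 : a = 0
    · simp only [h0, initState, if_true, State.setReg_mem, z₄]
    · have := congrFun (hs.mem a ha) i
      simp only [initState, h0, if_false] at this
      simp [h0, initState, m₄ a h0, m₃ a h0, m₂ a ha.ne, ← this]
  · simp only [State.setReg_coins, c₄, c₃, f₂.coins, f₁.coins, ← hs.coins]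
    rfl
  · simp [r₄ (R + 1) (by omega), r₃ (R + 1) (by omega), x₂]

/-- Decide whether the rational number with numerator `reg 0 - reg 1` and denominator `reg 2 + 1` is
at least `2⁻ᴱ`, where `E` is held by register `R + 1`. -/
def compareProg (R : ℕ) : Prog :=
  .seq (.sub R 0 1) <| .seq (.const (R + 2) 1) <| .seq (.add (R + 3) 2 (R + 2)) <|
    .seq (.loop (R + 1) (.seq (.add R R R) (.sub (R + 1) (R + 1) (R + 2)))) <|
      .seq (.sub (R + 3) (R + 3) R) (.ite (R + 3) (.const 0 0) (.const 0 1))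

/-- A bound for the cost of `compareProg` if the registers have at most `S` binary digits. -/
def compareCost (E S : ℕ) : ℕ :=
  (2 * S + 2) + (2 + ((S + 3) + (((E + 1) * (E + 1) + E * (2 * S + 3 * E + 6)) +
    ((2 * S + E + 4) + (S + 5)))))

theorem logCost_le_of_size {a S : ℕ} (h : a.size ≤ S) : logCost a ≤ S + 1 := Nat.succ_le_succ h

theorem size_mul_two_pow_le (a i S : ℕ) (h : a.size ≤ S) : (a * 2 ^ i).size ≤ S + i := by
  rw [Nat.size_le] at *
  rw [pow_add]
  exact Nat.mul_lt_mul_of_pos_right h (by positivity)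

/-- The numerator is doubled `E` times and compared with the denominator by truncated subtraction.
The results of `A` may be exponentially large, so here the cost is measured by their digits; it is
linear in `S`. -/
theorem compareProg_runsTo {R E S : ℕ} (hR : 3 ≤ R) {s : State} (hE : s.reg (R + 1) = E)
    (hS : ∀ r < 3, (s.reg r).size ≤ S) :
    RunsTo (compareProg R) s (compareCost E S) fun s' =>
      s'.reg 0 = if s.reg 2 + 1 ≤ (s.reg 0 - s.reg 1) * 2 ^ E then 1 else 0 := by
  set D := s.reg 0 - s.reg 1 with hD
  have hDS : D.size ≤ S := (Nat.size_le_size (Nat.sub_le _ _)).trans (hS 0 (by omega))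
  have l0 := logCost_le_of_size (hS 0 (by omega))
  have l1 := logCost_le_of_size (hS 1 (by omega))
  have l2 := logCost_le_of_size (hS 2 (by omega))
  have one : logCost 1 = 2 := by decide
  let I : ℕ → State → Prop := fun j s' => j ≤ E ∧ s'.reg (R + 1) = j ∧ s'.reg (R + 2) = 1 ∧
    s'.reg (R + 3) = s.reg 2 + 1 ∧ s'.reg R = D * 2 ^ (E - j)
  have n2 : (2 : ℕ) ≠ R := by omega
  have n0 : R ≠ 0 := by omega
  refine RunsTo.seq (RunsTo.sub_log (by omega) (RunsTo.seq (RunsTo.const (RunsTo.seq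
    (RunsTo.add_log ?_ (RunsTo.seq ((RunsTo.loop (n := E) (c := 2 * S + 3 * E + 6) I
      (fun j s hI => hI.2.1) ?_ E _ le_rfl ?_).mono le_rfl ?_)))))))
  · simp [n2, n0, one]; omega
  · rintro j s' hj ⟨-, h1, h2, h3, h4⟩
    have hd : logCost (D * 2 ^ (E - (j + 1))) ≤ S + E + 1 :=
      logCost_le_of_size ((size_mul_two_pow_le _ _ _ hDS).trans (by omega))
    refine RunsTo.seq_le (RunsTo.add_log (c := 2 * (S + E + 1)) (by rw [h4]; omega)
      (RunsTo.sub (c := E + 3) (by simp [h1, h2]; omega) ?_)) (by omega)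
    refine ⟨by omega, by simp [h1, h2], by simp [h2], by simp [h3], ?_⟩
    have : E - j = E - (j + 1) + 1 := by omega
    simp only [State.setReg_reg, h4, this, pow_succ]
    simp
    ring
  · exact ⟨le_rfl, by simp [hE], by simp, by simp [n2, n0], by simp [hD]⟩
  · rintro s' ⟨-, h1, h2, h3, h4⟩
    rw [Nat.sub_zero] at h4
    have hd : logCost (D * 2 ^ E) ≤ S + E + 1 :=
      logCost_le_of_size (size_mul_two_pow_le _ _ _ hDS)
    have hsz : (s.reg 2 + 1).size ≤ S + 1 := by
      have := hS 2 (by omega)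
      rw [Nat.size_le] at this ⊢
      rw [pow_succ]
      omega
    have h3' := logCost_le_of_size hsz
    refine RunsTo.seq (RunsTo.sub_log (by rw [h3, h4]; omega) ?_)
    have hl : logCost (s.reg 2 + 1 - D * 2 ^ E) ≤ S + 2 :=
      logCost_le_of_size ((Nat.size_le_size (Nat.sub_le _ _)).trans hsz)
    by_cases hc : s.reg 2 + 1 ≤ D * 2 ^ E
    · refine ⟨_, _, Exec.iteFalse ?_ (.const _ _ _), ?_, ?_⟩
      · simp [h3, h4]; omega
      · simp only [State.setReg_reg, if_true, h3, h4]
        omega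
      · simp [hc]
    · refine ⟨_, _, Exec.iteTrue ?_ (.const _ _ _), ?_, ?_⟩
      · simp [h3, h4]; omega
      · have zero : logCost 0 = 1 := by decide
        simp only [State.setReg_reg, if_true, h3, h4]
        omega
      · simp [hc]

/-- The decision program: check the input, print the network, run `A`, compare the result. -/
def decideProg (R : ℕ) (chk expo : Tm) (pr : Printer) (A : Prog) : Prog :=
  .seq (chk.compile (fun _ => 0) R)
    (.ite R (.seq (prepareProg R expo pr) (.seq A (compareProg R))) (.const 0 0))

variable {R : ℕ} {chk expo : Tm} {pr : Printer} {A : Prog} {x : List ℕ} {ω : ℕ → Bool}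

theorem decideProg_reject (hR : 0 < R)
    (hchk : chk.eval (fun i => x.getD i 0) (fun _ => x.length) = 0) :
    ∃ T s, Exec (decideProg R chk expo pr A) (initState x ω) T s ∧ s.reg 0 = 0 := by
  obtain ⟨B, hB, hX⟩ : ∃ B, x.length ≤ B ∧ ∀ i, x.getD i 0 ≤ B := by
    refine ⟨x.length + x.sum, by omega, fun i => ?_⟩
    rcases lt_or_ge i x.length with hi | hi
    · rw [List.getD_eq_getElem _ _ hi]
      exact (List.single_le_sum (by simp) _ (List.getElem_mem hi)).trans (Nat.le_add_left _ _)
    · rw [List.getD_eq_default _ _ hi]; exact Nat.zero_le _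
  obtain ⟨T, s, he, -, hf, hv⟩ := chk.compile_runsTo (ρ := fun _ => 0) (h := R)
    (s := initState x ω) (B := B) (fun _ => hR) (by simpa [initState] using hX)
    (by simpa [initState] using hB)
  have h0 : s.reg R = 0 := by rw [hv]; simpa [initState] using hchk
  exact ⟨_, _, .seq he (.iteFalse h0 (.const _ _ _)), by simp⟩

/-- A bound for the cost of the decision program if `A` has cost `T`. -/
def decideCost (chk expo : Tm) (pr : Printer) (B T : ℕ) : ℕ :=
  chk.costBound B + (chk.valBound B + 1 + (prepareCost expo pr B + (T +
    compareCost (expo.valBound B) (pr.lenBound B + pr.valBound B + T))))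

theorem compareCost_mono {E E' S : ℕ} (h : E ≤ E') : compareCost E S ≤ compareCost E' S := by
  unfold compareCost
  gcongr

/-- The run of `A` on a fresh machine with coins ω is transferred to the prepared one, which has
consumed no coins. Its outputs have at most `pr.lenBound B + pr.valBound B + T` digits. -/
theorem decideProg_run (hR : 3 ≤ R) (hA : A.bound ≤ R) {B T : ℕ} {s : State}
    (hB : x.length ≤ B) (hX : ∀ i, x.getD i 0 ≤ B)
    (hchk : chk.eval (fun i => x.getD i 0) (fun _ => x.length) ≠ 0)
    (he : Exec A (initState (pr.out (fun i => x.getD i 0) fun _ => x.length) ω) T s) :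
    RunsTo (decideProg R chk expo pr A) (initState x ω) (decideCost chk expo pr B T) fun s' =>
      s'.reg 0 = if s.reg 2 + 1 ≤ (s.reg 0 - s.reg 1) *
        2 ^ expo.eval (fun i => x.getD i 0) (fun _ => x.length) then 1 else 0 := by
  have hm : (initState x ω).mem 0 = fun i => x.getD i 0 := by simp [initState]
  have hr : (initState x ω).reg 0 = x.length := by simp [initState]
  refine RunsTo.seq ((chk.compile_runsTo (B := B) (fun _ => by omega) (by rw [hm]; exact hX)
    (fun _ => by rw [hr]; exact hB)).mono le_rfl ?_)
  rintro s₁ ⟨f₁, e₁⟩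
  simp only [hm, hr] at e₁
  have hle := chk.eval_le (X := fun i => x.getD i 0) hX (σ := fun _ => x.length) fun _ => hB
  refine (RunsTo.ite_of_ne (by rw [e₁]; exact hchk) (RunsTo.seq ((prepareProg_runsTo (x := x)
    (ω := ω) (by omega) expo pr hB hX ⟨fun r hr => (f₁.reg r hr).symm, fun a _ => by rw [f₁.mem],
      f₁.coins.symm⟩ fun i => ?_).mono le_rfl ?_))).mono (Nat.add_le_add_right
        (by rw [e₁]; omega) _) fun _ h => h
  · rw [f₁.mem]
    have : R ≠ 0 := by omega
    simp [initState, this]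
  rintro s₂ ⟨a₂, x₂⟩
  obtain ⟨s₃, he₃, a₃, f₃⟩ := he.local_run hA a₂
  refine RunsTo.seq ⟨T, s₃, he₃, le_rfl, ?_⟩
  set l := pr.out (fun i => x.getD i 0) fun _ => x.length with hl
  have hsize : SizeLE (pr.lenBound B + pr.valBound B) (initState l ω) := by
    have hsz : ∀ a : ℕ, a.size ≤ a := fun a => Nat.size_le.2 Nat.lt_two_pow_self
    constructor
    · intro r
      refine (hsz _).trans ?_
      have : l.length ≤ pr.lenBound B := pr.length_out_le hX fun _ => hB
      simp only [initState]
      split_ifs <;> omega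
    · intro a i
      refine (hsz _).trans ?_
      simp only [initState]
      split_ifs
      · rcases lt_or_ge i l.length with hi | hi
        · rw [List.getD_eq_getElem _ _ hi]
          exact (pr.le_valBound hX (fun _ => hB) _ (List.getElem_mem hi)).trans
            (Nat.le_add_left _ _)
        · rw [List.getD_eq_default _ _ hi]; exact Nat.zero_le _
      · exact Nat.zero_le _
  have hS := he.sizeLE hsize
  refine (compareProg_runsTo (S := pr.lenBound B + pr.valBound B + T) hR
    ((f₃ (R + 1) (by omega)).trans x₂) ?_).mono (compareCost_mono ?_) ?_
  · intro r hr
    rw [← a₃.reg r (by omega)]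
    exact hS.reg r
  · exact expo.eval_le hX fun _ => hB
  · intro s₄ h
    rw [h, a₃.reg 0 (by omega), a₃.reg 1 (by omega), a₃.reg 2 (by omega)]

/-- The cost is at most a polynomial times the cost of `A`. -/
theorem exists_decideCost_le (chk expo : Tm) (pr : Printer) :
    ∃ f, IsPoly f ∧ ∀ B T, decideCost chk expo pr B T ≤ f B * (T + 1) := by
  let E := expo.valBound
  let V : ℕ → ℕ := fun B => pr.lenBound B + pr.valBound B
  let u : ℕ → ℕ := fun B => decideCost chk expo pr B 0
  have hE : IsPoly E := expo.isPoly_valBound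
  have hV : IsPoly V := pr.isPoly_lenBound.add pr.isPoly_valBound
  have h1 := fun c => IsPoly.const c
  have hu : IsPoly u := by
    refine chk.isPoly_costBound.add <| (chk.isPoly_valBound.add (h1 1)).add <|
      (isPoly_prepareCost expo pr).add <| (h1 0).add ?_
    have hS : IsPoly fun B => V B + 0 := hV.add (h1 0)
    exact (((h1 2).mul hS).add (h1 2)).add <| (h1 2).add <| (hS.add (h1 3)).add <|
      IsPoly.add (((hE.add (h1 1)).mul (hE.add (h1 1))).add (hE.mul
        ((((h1 2).mul hS).add ((h1 3).mul hE)).add (h1 6)))) <|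
      ((((h1 2).mul hS).add hE).add (h1 4)).add (hS.add (h1 5))
  refine ⟨fun B => u B + (2 * E B + 7), hu.add (((h1 2).mul hE).add (h1 7)), fun B T => ?_⟩
  -- The cost is affine in `T`: 1 from the run of `A`, and 2E + 6 from the coefficient of `S` in
  -- `compareCost`.
  have : decideCost chk expo pr B T = u B + (2 * E B + 7) * T := by
    simp only [u, decideCost, compareCost, E]
    ring
  rw [this]
  nlinarith [Nat.zero_le (u B * T), Nat.zero_le (E B)]

/-! ## Numerical estimates -/

theorem exists_poly_le_pow (p : Polynomial ℕ) {r : ℝ} (hr : 1 < r) :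
    ∃ c : ℝ, 0 ≤ c ∧ ∀ n : ℕ, ((p.eval n : ℕ) : ℝ) ≤ c * r ^ n := by
  have hr0 : 0 < r := by linarith
  induction p using Polynomial.induction_on' with
  | add p q hp hq =>
    obtain ⟨c, hc, h⟩ := hp
    obtain ⟨c', hc', h'⟩ := hq
    refine ⟨c + c', by positivity, fun n => ?_⟩
    rw [Polynomial.eval_add, Nat.cast_add, add_mul]
    exact add_le_add (h n) (h' n)
  | monomial k a =>
    obtain ⟨c, hc⟩ := (tendsto_pow_const_div_const_pow_of_one_lt k hr).bddAbove_range
    have hcn : ∀ n : ℕ, (n : ℝ) ^ k ≤ c * r ^ n := fun n => by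
      have := hc ⟨n, rfl⟩
      rwa [div_le_iff₀ (by positivity)] at this
    have hc0 : 0 ≤ c := by
      have := hc ⟨0, rfl⟩
      refine le_trans ?_ this
      positivity
    refine ⟨a * c, by positivity, fun n => ?_⟩
    rw [Polynomial.eval_monomial, Nat.cast_mul, Nat.cast_pow, mul_assoc]
    exact mul_le_mul_of_nonneg_left (hcn n) (by positivity)

/-- A negative numerator is truncated to 0, which does no harm because the threshold is positive. -/
theorem le_mul_two_pow_iff (a b c E : ℕ) :
    c + 1 ≤ (a - b) * 2 ^ E ↔ ((2 : ℝ) ^ E)⁻¹ ≤ ((a : ℝ) - b) / ((c : ℝ) + 1) := by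
  have hc : (0 : ℝ) < (c : ℝ) + 1 := by positivity
  have h2 : (0 : ℝ) < 2 ^ E := by positivity
  rw [le_div_iff₀ hc, inv_mul_le_iff₀ h2]
  rcases le_total b a with h | h
  · rw [← Nat.cast_sub h, mul_comm (2 ^ E : ℝ)]
    exact_mod_cast Iff.rfl
  · rw [Nat.sub_eq_zero_of_le h, zero_mul]
    have : (a : ℝ) - b ≤ 0 := by
      rw [sub_nonpos]; exact_mod_cast h
    constructor
    · intro h; omega
    · intro h
      nlinarith

/-- The ratio of the two bounds is δ⁻²/2, which is at least 2 because δ⁻¹ ≥ 2, so a power of two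
lies between them. -/
theorem exists_two_pow_between {δ : ℝ} (h0 : 0 < δ) (h1 : δ < 1 / 2) (M : ℕ) :
    ∃ e : ℕ, 2 * δ⁻¹ ^ (M + 1) ≤ 2 ^ e ∧ (2 : ℝ) ^ e ≤ δ⁻¹ ^ (M + 3) := by
  have hd : 2 ≤ δ⁻¹ := by
    rw [le_inv_comm₀ two_pos h0]; linarith
  have hp : 1 ≤ δ⁻¹ ^ (M + 1) := one_le_pow₀ (by linarith)
  obtain ⟨n, hn, hn'⟩ := exists_nat_pow_near (x := 2 * δ⁻¹ ^ (M + 1)) (y := 2) (by linarith)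
    one_lt_two
  refine ⟨n + 1, hn'.le, ?_⟩
  rw [pow_succ, show M + 3 = M + 1 + 2 by rfl, pow_add _ (M + 1) 2]
  nlinarith [mul_le_mul hd hd (by norm_num) (by linarith)]

/-! ### The acceptance threshold separates the two cases -/

section Threshold

variable {δ : ℝ} {M e g : ℕ}

theorem half_pow_le_threshold (h0 : 0 < δ) (he : (2 : ℝ) ^ e ≤ δ⁻¹ ^ (M + 3)) :
    δ ^ ((M + 3) * g) / 2 ≤ ((2 : ℝ) ^ (e * g))⁻¹ := by
  have h1 : δ ^ (M + 3) ≤ ((2 : ℝ) ^ e)⁻¹ := by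
    rw [le_inv_comm₀ (by positivity) (by positivity), ← inv_pow]; exact he
  have h2 : δ ^ ((M + 3) * g) ≤ ((2 : ℝ) ^ (e * g))⁻¹ := by
    rw [pow_mul, pow_mul, ← inv_pow]
    exact pow_le_pow_left₀ (by positivity) h1 g
  have : 0 < δ ^ ((M + 3) * g) := by positivity
  linarith

/-- The threshold is at most half of δ^(Mg+1), and the error bound is at most the other half,
because (M + 1)g and (M + 3)g are both at least Mg + 1. -/
theorem threshold_le (h0 : 0 < δ) (h1 : δ < 1 / 2) (hg : 1 ≤ g)
    (he : 2 * δ⁻¹ ^ (M + 1) ≤ (2 : ℝ) ^ e) :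
    ((2 : ℝ) ^ (e * g))⁻¹ ≤ δ ^ (M * g + 1) - δ ^ ((M + 3) * g) / 2 := by
  have h2 : ((2 : ℝ) ^ e)⁻¹ ≤ 2⁻¹ * δ ^ (M + 1) := by
    rw [inv_le_comm₀ (by positivity) (by positivity), mul_inv, inv_inv, ← inv_pow]
    exact he
  have hle : ∀ a b : ℕ, a ≤ b → δ ^ b ≤ δ ^ a := fun a b hab =>
    pow_le_pow_of_le_one h0.le (by linarith) hab
  have h3 : ((2 : ℝ) ^ (e * g))⁻¹ ≤ 2⁻¹ * δ ^ (M * g + 1) := by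
    calc ((2 : ℝ) ^ (e * g))⁻¹ = (((2 : ℝ) ^ e)⁻¹) ^ g := by rw [pow_mul, inv_pow]
      _ ≤ (2⁻¹ * δ ^ (M + 1)) ^ g := pow_le_pow_left₀ (by positivity) h2 g
      _ = 2⁻¹ ^ g * δ ^ ((M + 1) * g) := by rw [mul_pow, ← pow_mul]
      _ ≤ 2⁻¹ ^ 1 * δ ^ (M * g + 1) := by
        refine mul_le_mul (pow_le_pow_of_le_one (by norm_num) (by norm_num) hg)
          (hle _ _ (by nlinarith)) (by positivity) (by positivity)
      _ = _ := by rw [pow_one]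
  have h4 := hle (M * g + 1) ((M + 3) * g) (by nlinarith)
  linarith

end Threshold

/-! ## Running times -/

/-- A run that does not halt has time `⊤`, so a finite bound forces halting; by determinism the
infimum in `time` is attained by the only possible cost. -/
theorem exists_exec_of_worstTime_le {A : Prog} {I : Set (List ℕ)} {y : ℝ} (hy : 0 ≤ y)
    (h : ((A.worstTime I : ℕ∞) : ℝ≥0∞) ≤ ENNReal.ofReal y) {x : List ℕ} (hx : x ∈ I)
    (ω : ℕ → Bool) : ∃ T s, Exec A (initState x ω) T s ∧ (T : ℝ) ≤ y := by
  have h1 : A.time x ω ≤ A.worstTime I :=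
    le_iSup₂_of_le x hx (le_iSup (fun ω => A.time x ω) ω)
  have h2 : ((A.time x ω : ℕ∞) : ℝ≥0∞) ≤ ENNReal.ofReal y :=
    (ENat.toENNReal_le.2 h1).trans h
  by_cases hex : ∃ T s, Exec A (initState x ω) T s
  · obtain ⟨T, s, he⟩ := hex
    have hT : (T : ℕ∞) ≤ A.time x ω := by
      refine le_iInf₂ fun T' hT' => ?_
      obtain ⟨s', he'⟩ := hT'
      rw [(he.det he').1]
    have h3 : ((T : ℕ∞) : ℝ≥0∞) ≤ ENNReal.ofReal y := (ENat.toENNReal_le.2 hT).trans h2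
    rw [ENat.toENNReal_coe, ← ENNReal.ofReal_natCast, ENNReal.ofReal_le_ofReal_iff hy] at h3
    exact ⟨T, s, he, h3⟩
  · have : A.time x ω = ⊤ := by
      refine top_le_iff.1 (le_iInf₂ fun T hT => ?_)
      exact absurd ⟨T, hT⟩ hex
    rw [this] at h2
    simp at h2

theorem worstTime_le_of_runs {B : Prog} {I : Set (List ℕ)} {N : ℕ}
    (h : ∀ x ∈ I, ∀ ω, ∃ T s, Exec B (initState x ω) T s ∧ T ≤ N) : B.worstTime I ≤ N := by
  refine iSup₂_le fun x hx => iSup_le fun ω => ?_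
  obtain ⟨T, s, he, hT⟩ := h x hx ω
  exact (iInf₂_le T ⟨s, he⟩).trans (by exact_mod_cast hT)

/-! ## The reduction -/

namespace SatNet
open Tm

variable {x : List ℕ} {α : CNF} {k n d C wr Lr M e₀ g₀ : ℕ} {δ : ℝ} {θ : Finset ℝ}

/-- The network that is printed for the input `x`. -/
noncomputable def inputNet (δ : ℝ) (d C M e₀ g₀ K : ℕ) (x : List ℕ) : Network d 1 :=
  satNet δ d (K * (M + 3) * scale g₀ C M (fun i => x.getD i 0) x.length)
    (M * scale g₀ C M (fun i => x.getD i 0) x.length + e₀)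
    (clauseNo (fun i => x.getD i 0) x.length) (clauseLit (fun i => x.getD i 0) x.length e₀)

theorem out_printer_inputNet (K : ℕ) :
    (printer θ δ d e₀ M (K * (M + 3)) (scaleTm g₀ C M)).out (fun i => x.getD i 0)
      (fun _ => x.length) = (inputNet δ d C M e₀ g₀ K x).encode θ :=
  out_printer d e₀ M (K * (M + 3)) fun σ' h => by rw [eval_scaleTm, h]

/-- The class index (M + 3)g exceeds the number Mg of variables by 3g. As g ≥ e₀ + d + 5, this
surplus pays for the amplifying layers, the last layers and the loss of d in the depth. -/
theorem inputNet_mem (hr : Reads x α k n) (hθ : curveWeights δ ⊆ θ) (hd : 1 ≤ d) (hk : 1 ≤ k)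
    (hC : 1 ≤ C) (hwr : 1 ≤ wr) (hLr : 1 ≤ Lr) (hM : 1 ≤ M) (hg₀ : g₀ = e₀ + d + 5) :
    inputNet δ d C M e₀ g₀ (max 2 (C * wr * k)) x ∈
      inputClass d k C wr Lr θ ((M + 3) * scale g₀ C M (fun i => x.getD i 0) x.length) \
        inputClass d k C wr Lr θ ((M + 3) * scale g₀ C M (fun i => x.getD i 0) x.length - 1) := by
  obtain ⟨⟨h1, h2, -⟩, -⟩ := scale_spec (g₀ := g₀) hC hM (fun i => x.getD i 0) x.length
  rw [inputNet]
  generalize scale g₀ C M (fun i => x.getD i 0) x.length = g at h1 h2 ⊢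
  have hn : (M + 3) * g = M * g + 3 * g := add_mul ..
  have hW : 2 * ((M + 3) * g) ≤ max 2 (C * wr * k) * ((M + 3) * g) :=
    Nat.mul_le_mul_right _ (le_max_left _ _)
  refine satNet_mem_inputClass hθ hd ?_ (by rw [mul_assoc]) ?_ ?_ ?_ ?_
  · omega
  · rw [mul_assoc]; omega
  · rw [hr.card]; exact hr.pos
  · have hCk : C ≤ max 2 (C * wr * k) :=
      le_max_of_le_right ((Nat.le_mul_of_pos_right C hwr).trans (Nat.le_mul_of_pos_right _ hk))
    calc clauseNo (fun i => x.getD i 0) x.length ≤ C * M * g := h2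
      _ = C * (M * g) := mul_assoc ..
      _ ≤ max 2 (C * wr * k) * ((M + 3) * g) := Nat.mul_le_mul hCk (by omega)
      _ = _ := (mul_assoc ..).symm
  · omega

/-- `litNeuron` is the literal code shifted by 2 + 2e₀, and coding is injective. -/
theorem litTrue_iff {z : ℕ → Bool} {N l : ℕ} (hl : 2 ≤ l) (hlN : l ≤ 2 * N + 1) :
    LitTrue e₀ N z (l + (2 + 2 * e₀)) ↔ z (decodeLit l).1 = (decodeLit l).2 := by
  have hcode := code_decodeLit l
  simp only [Literal.code] at hcode
  constructor
  · rintro ⟨v, b, -, -, he, hz⟩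
    have : l = Literal.code (v, b) := by
      simp only [litNeuron] at he
      simp only [Literal.code]
      omega
    rw [this, decodeLit_code]
    exact hz
  · intro hz
    refine ⟨_, _, ?_, ?_, ?_, hz⟩
    · split_ifs at hcode <;> omega
    · split_ifs at hcode <;> omega
    · simp only [litNeuron]
      omega

theorem clauseLit_iff {c j : ℕ} : clauseLit (fun i => x.getD i 0) x.length e₀ c j ↔
    ∃ l ∈ clauseAt x c, l + (2 + 2 * e₀) = j := by
  simp only [mem_clauseAt, clauseLit]
  constructor
  · rintro ⟨i, hi, h0, h1, h2⟩; exact ⟨_, ⟨i, hi, h0, rfl, h2⟩, h1⟩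
  · rintro ⟨_, ⟨i, hi, h0, rfl, h2⟩, h1⟩; exact ⟨i, hi, h0, h1, h2⟩

theorem lit_bounds (hr : Reads x α k n) (hC : 1 ≤ C) (hM : 1 ≤ M) {c l : ℕ}
    (hl : l ∈ clauseAt x c) :
    2 ≤ l ∧ l ≤ 2 * (M * scale g₀ C M (fun i => x.getD i 0) x.length) + 1 := by
  refine ⟨(hr.lit_le c l hl).1, ?_⟩
  obtain ⟨i, hi, -, rfl, -⟩ := mem_clauseAt.1 hl
  rw [← mul_assoc]
  exact (scale_spec (g₀ := g₀) hC hM (fun i => x.getD i 0) x.length).1.2.2 i hi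

/-- Literal neurons have indices up to 2Mg + 2e₀ + 3: two neurons per variable, which the factor 2
in the width accommodates. -/
theorem four_le_width (hC : 1 ≤ C) (hM : 1 ≤ M) (hg₀ : g₀ = e₀ + d + 5) (K : ℕ) :
    2 * (M * scale g₀ C M (fun i => x.getD i 0) x.length) + 2 * e₀ + 4 ≤
      max 2 K * (M + 3) * scale g₀ C M (fun i => x.getD i 0) x.length := by
  have h1 := (scale_spec (g₀ := g₀) hC hM (fun i => x.getD i 0) x.length).1.1
  generalize scale g₀ C M (fun i => x.getD i 0) x.length = g at h1 ⊢
  have hn : (M + 3) * g = M * g + 3 * g := add_mul ..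
  have hW : 2 * ((M + 3) * g) ≤ max 2 K * ((M + 3) * g) :=
    Nat.mul_le_mul_right _ (le_max_left _ _)
  rw [mul_assoc]
  omega

theorem integral_inputNet_of_not_satisfiable (hr : Reads x α k n) (hα : ¬ α.Satisfiable)
    (h0 : 0 < δ) (hd : 1 ≤ d) (hC : 1 ≤ C) (hM : 1 ≤ M) (hg₀ : g₀ = e₀ + d + 5) (K : ℕ) :
    ∫ y in Set.Icc (0 : Fin d → ℝ) 1,
      (inputNet δ d C M e₀ g₀ (max 2 K) x).realize y 0 = 0 := by
  have hW := four_le_width (x := x) hC hM hg₀ K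
  refine integral_satNet_eq_zero hd (by omega) h0 ?_ ?_
  · intro c _ j hj
    obtain ⟨l, hl, rfl⟩ := clauseLit_iff.1 hj
    obtain ⟨h2, hN⟩ := lit_bounds (g₀ := g₀) hr hC hM hl
    obtain ⟨v, b, hv, hvN, he, -⟩ := (litTrue_iff (e₀ := e₀)
      (z := fun _ => (decodeLit l).2) h2 hN).2 rfl
    exact ⟨v, b, hv, hvN, he⟩
  · intro z
    rw [hr.sat] at hα
    push Not at hα
    obtain ⟨c, hc, hcl⟩ := hα z
    refine ⟨c, by rw [hr.card]; exact hc, fun j hj => ?_⟩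
    obtain ⟨l, hl, rfl⟩ := clauseLit_iff.1 hj
    obtain ⟨h2, hN⟩ := lit_bounds (g₀ := g₀) hr hC hM hl
    rw [litTrue_iff h2 hN]
    exact hcl l hl

theorem le_integral_inputNet_of_satisfiable (hr : Reads x α k n) (hα : α.Satisfiable)
    (h0 : 0 < δ) (h1 : δ < 1 / 2) (he : 1 ≤ δ⁻¹ ^ e₀ * (1 - 2 * δ)) (hd : 1 ≤ d) (hC : 1 ≤ C)
    (hM : 1 ≤ M) (hg₀ : g₀ = e₀ + d + 5) (K : ℕ) :
    δ ^ (M * scale g₀ C M (fun i => x.getD i 0) x.length + 1) ≤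
      ∫ y in Set.Icc (0 : Fin d → ℝ) 1,
        (inputNet δ d C M e₀ g₀ (max 2 K) x).realize y 0 := by
  have hW := four_le_width (x := x) hC hM hg₀ K
  obtain ⟨z, hz⟩ := hr.sat.1 hα
  refine le_integral_satNet (z := z) hd (by omega) h0 h1 he fun c hc => ?_
  rw [hr.card] at hc
  obtain ⟨l, hl, hzl⟩ := hz c hc
  obtain ⟨h2, hN⟩ := lit_bounds (g₀ := g₀) hr hC hM hl
  exact ⟨l + (2 + 2 * e₀), by omega, clauseLit_iff.2 ⟨l, hl, rfl⟩, (litTrue_iff h2 hN).2 hzl⟩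

/-- By minimality it suffices that g₀ + n/M + 1 is an admissible scale; M times it is at least n.
Sparsity is used only here, for the number of clauses. -/
theorem scale_le (hr : Reads x α k n) (hα : α.card ≤ C * n) (hC : 1 ≤ C) (hM : 1 ≤ M) :
    scale g₀ C M (fun i => x.getD i 0) x.length ≤ g₀ + n / M + 1 := by
  have hn : n ≤ M * (g₀ + n / M + 1) := by
    have := Nat.lt_mul_div_succ n hM
    have h2 : M * (n / M + 1) ≤ M * (g₀ + n / M + 1) := Nat.mul_le_mul_left _ (by omega)
    omega
  refine (scale_spec hC hM _ _).2 _
    ⟨(Nat.le_add_right _ _).trans (Nat.le_succ _), ?_, fun i _ => ?_⟩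
  · rw [hr.card, mul_assoc]
    exact hα.trans (Nat.mul_le_mul_left _ hn)
  · rw [mul_assoc]
    exact (hr.entry_le i).trans (by omega)

end SatNet

theorem Network.one_le_depth {d m : ℕ} (Φ : Network d m) : 1 ≤ Φ.depth := by
  cases Φ <;> simp [Network.depth]

theorem Network.mem_widths {d m : ℕ} (Φ : Network d m) : d ∈ Φ.widths := by
  cases Φ <;> simp [Network.widths]

/-! ### Running time and correctness of the decision program -/

section Reduction

open SatNet Tm

/-- The running time of the decision program on sparse formulas is `O(2 ^ (s n))` for `s > t`. -/
theorem exists_cost_le {f : ℕ → ℕ} (hf : IsPoly f) {t s c : ℝ} (ht : 0 < t) (hc : 0 ≤ c)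
    {M : ℕ} (hM : 1 ≤ M) (hMs : t * (M + 3) < s * M) (a g₀ n₀ : ℕ) :
    ∃ c' : ℝ, ∀ n T : ℕ,
      (T : ℝ) ≤ c * 2 ^ (t * ((max ((M + 3) * (g₀ + n / M + 1)) n₀ : ℕ) : ℝ)) →
      (f (a * n + 1) * (T + 1) : ℕ) ≤ c' * (2 : ℝ) ^ (s * n) := by
  have hM0 : (0 : ℝ) < M := by exact_mod_cast hM
  set u : ℝ := t * (M + 3) / M with hu
  have hus : u < s := by rw [hu, div_lt_iff₀ hM0]; exact hMs
  have hu0 : 0 < u := by positivity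
  obtain ⟨p, hp⟩ := hf.comp (((IsPoly.const a).mul .id).add (.const 1))
  obtain ⟨c₁, hc₁, hp'⟩ := exists_poly_le_pow p (r := 2 ^ (s - u))
    (Real.one_lt_rpow one_lt_two (by linarith))
  set b : ℝ := t * ((M + 3) * (g₀ + 1) + n₀) with hb
  refine ⟨c₁ * (c * 2 ^ b + 1), fun n T hT => ?_⟩
  have hmax : ((max ((M + 3) * (g₀ + n / M + 1)) n₀ : ℕ) : ℝ) ≤
      (M + 3) / M * n + ((M + 3) * (g₀ + 1) + n₀) := by
    have h1 : ((n / M : ℕ) : ℝ) ≤ n / M := Nat.cast_div_le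
    have h2 : max ((M + 3) * (g₀ + n / M + 1)) n₀ ≤ (M + 3) * (g₀ + n / M + 1) + n₀ := by omega
    calc ((max ((M + 3) * (g₀ + n / M + 1)) n₀ : ℕ) : ℝ)
        ≤ (((M + 3) * (g₀ + n / M + 1) + n₀ : ℕ) : ℝ) := by exact_mod_cast h2
      _ = (M + 3) * ((n / M : ℕ) : ℝ) + ((M + 3) * (g₀ + 1) + n₀) := by push_cast; ring
      _ ≤ (M + 3) * ((n : ℝ) / M) + ((M + 3) * (g₀ + 1) + n₀) := by gcongr
      _ = _ := by ring
  have hexp : t * ((max ((M + 3) * (g₀ + n / M + 1)) n₀ : ℕ) : ℝ) ≤ u * n + b := by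
    calc _ ≤ t * ((M + 3) / M * n + ((M + 3) * (g₀ + 1) + n₀)) := by gcongr
      _ = _ := by rw [hu, hb]; ring
  have hT' : (T : ℝ) + 1 ≤ (c * 2 ^ b + 1) * 2 ^ (u * n) := by
    have h1 : (2 : ℝ) ^ (t * ((max ((M + 3) * (g₀ + n / M + 1)) n₀ : ℕ) : ℝ)) ≤
        2 ^ b * 2 ^ (u * n) := by
      rw [← Real.rpow_add two_pos, add_comm b]
      exact Real.rpow_le_rpow_of_exponent_le one_le_two hexp
    have h2 : (1 : ℝ) ≤ 2 ^ (u * n) := Real.one_le_rpow one_le_two (by positivity)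
    have h3 := mul_le_mul_of_nonneg_left h1 hc
    rw [add_mul, one_mul, mul_assoc]
    linarith
  have hfp : (f (a * n + 1) : ℝ) ≤ c₁ * 2 ^ ((s - u) * n) := by
    have := hp' n
    rw [hp] at this
    rwa [Real.rpow_mul two_pos.le, Real.rpow_natCast]
  calc ((f (a * n + 1) * (T + 1) : ℕ) : ℝ)
      = (f (a * n + 1) : ℝ) * ((T : ℝ) + 1) := by push_cast; rfl
    _ ≤ (c₁ * 2 ^ ((s - u) * n)) * ((c * 2 ^ b + 1) * 2 ^ (u * n)) := by gcongr
    _ = c₁ * (c * 2 ^ b + 1) * (2 ^ ((s - u) * n) * 2 ^ (u * n)) := by ring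
    _ = _ := by
      rw [← Real.rpow_add two_pos]
      congr 2
      ring

theorem exists_decision_program
    (d k C wr Lr : ℕ) (hd : 1 ≤ d) (hk : 1 ≤ k) (hC : 1 ≤ C) (hwr : 1 ≤ wr) (hLr : 1 ≤ Lr)
    (δ : ℝ) (hδ₀ : 0 < δ) (hδ : δ < 1 / 2) (θ : Finset ℝ) (hθ : curveWeights δ ⊆ θ) (A : Prog)
    (hA : ∀ n : ℕ, 1 ≤ n →
      ∀ Φ ∈ inputClass d k C wr Lr θ n \ inputClass d k C wr Lr θ (n - 1),
        2 / 3 ≤ coinMeasure {ω | ∃ v : ℝ, A.OutputsReal (Φ.encode θ) ω v ∧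
          |v - ∫ x in Set.Icc (0 : Fin d → ℝ) 1, Φ.realize x 0| < δ ^ n / 2})
    (t : ℝ) (ht : 0 < t)
    (hT : IsBigOExp
      (fun n => A.worstTime ((fun Φ => Φ.encode θ) '' inputClass d k C wr Lr θ n)) t)
    (s : ℝ) (hs : t < s) :
    ∃ B : Prog, DecidesKSAT k B ∧
      IsBigOExp (fun n => B.worstTime {x | ∃ α ∈ sparseCNF C k n, Presents x α}) s := by
  obtain ⟨c, n₀, hT⟩ := hT
  -- Equivalent to t(M + 3) < sM, so that the rate t(M + 3)/M stays below s.
  obtain ⟨M, hM⟩ := exists_nat_gt (3 * t / (s - t))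
  have hst : 0 < s - t := by linarith
  rw [div_lt_iff₀ hst] at hM
  have hM1 : 1 ≤ M := by
    rw [Nat.one_le_iff_ne_zero]
    rintro rfl
    simp only [Nat.cast_zero, zero_mul] at hM
    linarith
  have hMs : t * (M + 3) < s * M := by linarith
  obtain ⟨e₀, he₀⟩ : ∃ e₀ : ℕ, 1 ≤ δ⁻¹ ^ e₀ * (1 - 2 * δ) := by
    have h1 : 0 < 1 - 2 * δ := by linarith
    obtain ⟨e₀, he⟩ := pow_unbounded_of_one_lt (1 - 2 * δ)⁻¹
      (one_lt_inv₀ hδ₀ |>.2 (by linarith : δ < 1))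
    exact ⟨e₀, by rw [inv_lt_iff_one_lt_mul₀ h1] at he; exact he.le⟩
  obtain ⟨e, he1, he2⟩ := exists_two_pow_between hδ₀ hδ M
  obtain ⟨g₀, hg₀⟩ : ∃ g₀, g₀ = e₀ + d + 5 := ⟨_, rfl⟩
  set K := C * wr * k with hK
  set chk := checkTm k
  set expo := smul e (scaleTm g₀ C M)
  set pr := printer θ δ d e₀ M (max 2 K * (M + 3)) (scaleTm g₀ C M)
  -- The summand 3 keeps the output registers 0, 1, 2 below `R` even if `A` does not mention them.
  set R := A.bound + 3
  let g : List ℕ → ℕ := fun x => scale g₀ C M (fun i => x.getD i 0) x.length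
  let Φ : List ℕ → Network d 1 := fun x => inputNet δ d C M e₀ g₀ (max 2 K) x
  have hout : ∀ x : List ℕ, pr.out (fun i => x.getD i 0) (fun _ => x.length) =
      (Φ x).encode θ := fun x => out_printer_inputNet (max 2 K)
  have hexpo : ∀ x : List ℕ, expo.eval (fun i => x.getD i 0) (fun _ => x.length) =
      e * g x := fun x => by simp only [expo, eval_smul, eval_scaleTm, g]
  have hchk : ∀ x : List ℕ, chk.eval (fun i => x.getD i 0) (fun _ => x.length) ≠ 0 ↔
      Valid k (fun i => x.getD i 0) x.length := fun x => checkTm_holds k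
  have hg1 : ∀ x, 1 ≤ g x := fun x => by
    have := (scale_spec (g₀ := g₀) hC hM1 (fun i => x.getD i 0) x.length).1.1
    simp only [g]
    omega
  have hrun : ∀ n, ∀ α ∈ kCNF k n, ∀ x, Presents x α → ∀ ω, ∃ T σ,
      Exec A (initState ((Φ x).encode θ) ω) T σ ∧
        (T : ℝ) ≤ |c| * 2 ^ (t * ((max ((M + 3) * g x) n₀ : ℕ) : ℝ)) := by
    intro n α hα x hx ω
    have hmem := (inputNet_mem (hx.reads hα) hθ hd hk hC hwr hLr hM1 hg₀).1
    -- The time bound holds only from `n₀` on; for smaller indices the class is enlarged by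
    -- monotonicity.
    refine exists_exec_of_worstTime_le (by positivity) ((hT _ (le_max_right _ n₀)).trans ?_)
      ⟨_, inputClass_mono (le_max_left _ _) hmem, rfl⟩ ω
    exact ENNReal.ofReal_le_ofReal (mul_le_mul_of_nonneg_right (le_abs_self c) (by positivity))
  have hdecide : ∀ n, ∀ α ∈ kCNF k n, ∀ x, Presents x α → ∀ ω T σ,
      Exec A (initState ((Φ x).encode θ) ω) T σ → ∀ B, x.length ≤ B → (∀ i, x.getD i 0 ≤ B) →
      RunsTo (decideProg R chk expo pr A) (initState x ω) (decideCost chk expo pr B T) fun s' =>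
        s'.reg 0 = if σ.reg 2 + 1 ≤ (σ.reg 0 - σ.reg 1) * 2 ^ (e * g x) then 1 else 0 := by
    intro n α hα x hx ω T σ hE B hB hX
    rw [← hexpo]
    refine decideProg_run (by omega) (by omega) hB hX ((hchk x).2 (hx.reads hα).valid) ?_
    rw [hout]
    exact hE
  have hbound : ∀ n, ∀ α ∈ kCNF k n, ∀ x, Presents x α →
      (∀ m, α.card ≤ C * m → n ≤ m → x.length ≤ (C * (k + 1) + 2) * m + 1 ∧
        ∀ i, x.getD i 0 ≤ (C * (k + 1) + 2) * m + 1) := by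
    intro n α hα x hx m hm hnm
    have hr := hx.reads hα
    have h1 : α.card * (k + 1) ≤ C * m * (k + 1) := Nat.mul_le_mul_right _ hm
    have h2 : (C * (k + 1) + 2) * m = C * m * (k + 1) + 2 * m := by ring
    refine ⟨hr.length_le.trans (by omega), fun i => (hr.entry_le i).trans (by omega)⟩
  have hcorrect : ∀ n, ∀ α ∈ kCNF k n, ∀ x, Presents x α → ∀ b : ℕ,
      (b = 1 ∧ α.Satisfiable ∨ b = 0 ∧ ¬ α.Satisfiable) →
      2 / 3 ≤ coinMeasure {ω | (decideProg R chk expo pr A).OutputsNat x ω b} := by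
    intro n α hα x hx b hb
    have hr := hx.reads hα
    have hn' : 1 ≤ (M + 3) * g x := Nat.mul_pos (by omega) (hg1 x)
    -- For every coin sequence on which `A` is accurate the decision is correct, so the success
    -- probability is inherited.
    refine (hA _ hn' (Φ x) (inputNet_mem hr hθ hd hk hC hwr hLr hM1 hg₀)).trans
      (measure_mono ?_)
    rintro ω ⟨v, ⟨T, σ, hE, hv⟩, herr⟩
    -- Correctness is required for all formulas, not only sparse ones; here any bound on the input
    -- will do.
    obtain ⟨hB, hX⟩ := hbound n α hα x hx (n + α.card) (by nlinarith) (by omega)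
    obtain ⟨T', σ', hE', -, hσ'⟩ := hdecide n α hα x hx ω T σ hE _ hB hX
    refine ⟨T', σ', hE', ?_⟩
    rw [hσ']
    simp only [le_mul_two_pow_iff]
    rw [← hv]
    rw [abs_lt] at herr
    rcases hb with ⟨rfl, hsat⟩ | ⟨rfl, hsat⟩
    · rw [if_pos]
      have h1 := le_integral_inputNet_of_satisfiable hr hsat hδ₀ hδ he₀ hd hC hM1 hg₀ K
      have h2 := threshold_le (M := M) (g := g x) hδ₀ hδ (hg1 x) he1
      linarith [herr.1]
    · rw [if_neg]
      have h1 := integral_inputNet_of_not_satisfiable hr hsat hδ₀ hd hC hM1 hg₀ K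
      have h2 := half_pow_le_threshold (M := M) (g := g x) hδ₀ he2
      have h3 := herr.2
      rw [h1] at h3
      linarith
  refine ⟨decideProg R chk expo pr A, ⟨?_, ?_, ?_⟩, ?_⟩
  · intro n α hα x hx ω
    obtain ⟨T, σ, hE, -⟩ := hrun n α hα x hx ω
    obtain ⟨hB, hX⟩ := hbound n α hα x hx (n + α.card) (by nlinarith) (by omega)
    obtain ⟨T', σ', hE', -, -⟩ := hdecide n α hα x hx ω T σ hE _ hB hX
    exact ⟨T', σ', hE'⟩
  · intro n α hα x hx
    exact ⟨fun h => hcorrect n α hα x hx 1 (Or.inl ⟨rfl, h⟩),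
      fun h => hcorrect n α hα x hx 0 (Or.inr ⟨rfl, h⟩)⟩
  · intro x hx
    have hnv : ¬ Valid k (fun i => x.getD i 0) x.length := fun h => by
      obtain ⟨n, α, hα, hp⟩ := h.presents
      exact hx n α hα hp
    -- The check is deterministic, so inputs that present no formula are rejected for every coin
    -- sequence.
    have hempty : {ω | (decideProg R chk expo pr A).OutputsNat x ω 1} = ∅ := by
      refine Set.eq_empty_of_forall_notMem fun ω => ?_
      rintro ⟨T, σ, hE, h1⟩
      obtain ⟨T', σ', hE', h0⟩ := decideProg_reject (R := R) (chk := chk) (expo := expo)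
        (pr := pr) (A := A) (x := x) (ω := ω) (by omega)
        (not_not.1 ((hchk x).not.2 hnv))
      rw [(hE.det hE').2] at h1
      omega
    rw [hempty, measure_empty]
    exact zero_le
  · obtain ⟨f, hf, hfle⟩ := exists_decideCost_le chk expo pr
    obtain ⟨c', hc'⟩ := exists_cost_le hf ht (abs_nonneg c) hM1 hMs (C * (k + 1) + 2) g₀ n₀
    refine ⟨c', 0, fun n _ => ?_⟩
    set T₀ : ℕ := ⌊|c| * 2 ^ (t * ((max ((M + 3) * (g₀ + n / M + 1)) n₀ : ℕ) : ℝ))⌋₊ with hT₀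
    have hT₀' := hc' n T₀ (Nat.floor_le (by positivity))
    have hw : (decideProg R chk expo pr A).worstTime
        {x | ∃ α ∈ sparseCNF C k n, Presents x α} ≤
        ((f ((C * (k + 1) + 2) * n + 1) * (T₀ + 1) : ℕ) : ℕ∞) := by
      refine worstTime_le_of_runs ?_
      rintro x ⟨α, hα, hx⟩ ω
      obtain ⟨T, σ, hE, hTle⟩ := hrun n α hα.1 x hx ω
      obtain ⟨hB, hX⟩ := hbound n α hα.1 x hx n hα.2 le_rfl
      obtain ⟨T', σ', hE', hT', -⟩ := hdecide n α hα.1 x hx ω T σ hE _ hB hX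
      refine ⟨T', σ', hE', hT'.trans ((hfle _ T).trans (Nat.mul_le_mul_left _
        (Nat.succ_le_succ (Nat.le_floor (hTle.trans ?_)))))⟩
      have hgx : g x ≤ g₀ + n / M + 1 := scale_le (hx.reads hα.1) hα.2 hC hM1
      have hmax : max ((M + 3) * g x) n₀ ≤ max ((M + 3) * (g₀ + n / M + 1)) n₀ :=
        max_le_max_right _ (Nat.mul_le_mul_left _ hgx)
      refine mul_le_mul_of_nonneg_left (Real.rpow_le_rpow_of_exponent_le one_le_two
        (mul_le_mul_of_nonneg_left ?_ ht.le)) (abs_nonneg c)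
      exact_mod_cast hmax
    refine (ENat.toENNReal_le.2 hw).trans ?_
    rw [ENat.toENNReal_coe, ← ENNReal.ofReal_natCast]
    exact ENNReal.ofReal_le_ofReal hT₀'

end Reduction

end QuadHard

theorem theorem3p12
    (d k C wr Lr : ℕ) (hd : 1 ≤ d) (hk : 1 ≤ k) (hC : 1 ≤ C)
    (δ : ℝ) (hδ₀ : 0 < δ) (hδ : δ < 1 / 2)
    (θr : Finset ℝ) (Ψ : QuadHard.Network 1 1) (hΨ : Ψ ∈ QuadHard.Network.netClass 1 wr Lr θr)
    (r : ℝ → ℝ) (hr_cont : Continuous r) (hr_range : ∀ x, r x ∈ Set.Icc (0 : ℝ) 1)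
    (hr_zero : ∀ x, x ≤ 1 / 2 → r x = 0) (hr_one : ∀ x, 1 - δ ≤ x → r x = 1)
    (hrΨ : ∀ x : ℝ, Ψ.realize (fun _ => x) 0 = r x)
    (θ : Finset ℝ) (hθ : QuadHard.cnfWeights θr k ∪ QuadHard.curveWeights δ ⊆ θ)
    (A : QuadHard.Prog)
    (hA : ∀ n : ℕ, 1 ≤ n →
      ∀ Φ ∈ QuadHard.inputClass d k C wr Lr θ n \ QuadHard.inputClass d k C wr Lr θ (n - 1),
        2 / 3 ≤ QuadHard.coinMeasure {ω | ∃ v : ℝ, A.OutputsReal (Φ.encode θ) ω v ∧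
          |v - ∫ x in Set.Icc (0 : Fin d → ℝ) 1, Φ.realize x 0| < δ ^ n / 2})
    (t : ℝ) (ht : 0 < t)
    (hT : QuadHard.IsBigOExp
      (fun n => A.worstTime ((fun Φ => Φ.encode θ) '' QuadHard.inputClass d k C wr Lr θ n)) t) :
    QuadHard.sTilde C k ≤ t := by
  -- The input dimension 1 of Ψ is one of its widths.
  have hwr : 1 ≤ wr := (hΨ.2.1 1 Ψ.mem_widths).2
  have hLr : 1 ≤ Lr := Ψ.one_le_depth.trans hΨ.1
  refine le_of_forall_gt_imp_ge_of_dense fun s hs => csInf_le ⟨0, fun u hu => hu.1.le⟩ ?_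
  exact ⟨ht.trans hs, QuadHard.exists_decision_program d k C wr Lr hd hk hC hwr hLr δ hδ₀ hδ θ
    (Finset.union_subset_right hθ) A hA t ht hT s hs⟩
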